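/- Let $Q=\mathbb R/2\pi\mathbb Z$, $T>0$, $\rho>0$, $p\ge 2$, $\overline Q_T=Q\times[0,T]$. Let $W\in C^3(\mathbb R)$ be strictly convex with $W''\ge c_0>0$, $W(u)\ge\max(0,\,c_1|u|^p-c_2)$ for all $u\in\mathbb R$ (with constants $c_0,c_1,c_2>0$), and $\lim_{|u|\to\infty}W'(u)/|u|^p=0$. Put $\eta(M,\lambda)=\frac{\rho}{2}\lambda^2+W(M)$. **Lattice.** For $N\ge1$ and $\epsilon=2\pi/N$ let $x_i=x_i^{(N)}(t)$, $i\in\mathbb Z$, $t\in[0,T]$, with $x_{i+N}=x_i+2\pi$, solve the equations of motion $$\frac{d}{dt}(\epsilon\rho\,\dot x_i)=W'\Big(\frac{x_{i+1}-x_i}{\epsilon}\Big)-W'\Big(\frac{x_i-x_{i-1}}{\epsilon}\Big).$$ For $X\in[0,2\pi)$ and with $I^i_\epsilon=[i\epsilon,(i+1)\epsilon)$ set $$y^\epsilon(t,X)=\sum_{i=0}^{N-1}\Big(x_i+\tfrac1\epsilon(X-i\epsilon)(x_{i+1}-x_i)\Big)\mathbf 1_{I^i_\epsilon}(X),\qquad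 u^\epsilon=\frac{\partial y^\epsilon}{\partial X},\qquad v^\epsilon=\sum_{i=0}^{N-1}\dot x_i\,\mathbf 1_{I^i_\epsilon}.$$ **Continuum limit.** Let $(\overline u,\overline v)$ be a pair of Lipschitz functions on $\overline Q_T$ which is a weak solution of $\rho\,\partial_t\overline v=\partial_XW'(\overline u)$, $\partial_t\overline u=\partial_X\overline v$, i.e. for all $\phi\in C^1_c(Q\times[0,T))$ $$\int_0^T\!\!\int_Q\big(\rho\,\partial_t\phi\,\overline v-\partial_X\phi\,W'(\overline u)\big)\,dX\,dt+\int_Q\rho\,\phi(X,0)\,\overline v(X,0)\,dX=0,$$ $$\int_0^T\!\!\int_Q\big(\partial_t\phi\,\overline u-\partial_X\phi\,\overline v\big)\,dX\,dt+\int_Q\phi(X,0)\,\overline u(X,0)\,dX=0.$$ **Initial data.** Assume that the energies $\sum_{i=0}^{N-1}\big[\frac{\epsilon\rho}{2}\dot x_i(0)^2+\epsilon W\big(\frac{x_{i+1}(0)-x_i(0)}{\epsilon}\big)\big]$ are bounded above uniformly in $N$, that $(u^\epsilon(0,\cdot),v^\epsilon(0,\cdot))\to(\overline u(\cdot,0),\overline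 v(\cdot,0))$ strongly in $L^p(Q)\times L^2(Q)$, and that $\int_Q\eta(u^\epsilon,v^\epsilon)|_{t=0}\,dX\to\int_Q\eta(\overline u,\overline v)|_{t=0}\,dX$ as $N\to\infty$. **Terminology.** A family $\nu=(\nu_{X,t})$ of probability measures on $\mathbb R^2$ (given for a.e. $(X,t)\in\overline Q_T$, weak-$*$ measurable) is the Young measure of a sequence $f^n:\overline Q_T\to\mathbb R^2$ if for every continuous $g:\mathbb R^2\to\mathbb R$ such that $(g(f^n))_n$ is weakly (sequentially) precompact in $L^1(\overline Q_T)$, $\langle\nu,g\rangle$ is defined a.e., lies in $L^1$, and $g(f^n)\rightharpoonup\langle\nu,g\rangle$ weakly in $L^1(\overline Q_T)$. A finite non-negative Borel measure $\gamma$ on $\overline Q_T$ is the corresponding concentration measure if $\langle\nu,\eta\rangle\in L^1(\overline Q_T)$ and $\iint\psi\,(\eta(f^n)-\langle\nu,\eta\rangle)\,dX\,dt\to\int\psi\,d\gamma$ for all $\psi\in C(\overline Q_T)$. **Conclusion.** As $N\to\infty$: 1. $u^\epsilon\to\overline u$ strongly in $L^p(Q_T)$ and $v^\epsilon\to\overline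 v$ strongly in $L^2(Q_T)$. 2. The sequence $(u^\epsilon,v^\epsilon)$ has Young measure $\delta_{(\overline u(X,t),\overline v(X,t))}$ with concentration measure $0$. Moreover, if a subsequence has a Young measure $\nu$, then $\nu_{X,t}=\delta_{(\overline u(X,t),\overline v(X,t))}$ for a.e. $(X,t)\in Q_T$, and any concentration measure $\gamma$ associated with that subsequence and $\nu$ is null. -/

import Mathlib

open MeasureTheory Set Filter Topology

namespace SpringLattice

noncomputable section

/-- The standing assumptions on the interaction potential: `W ∈ C³` is strictly convex with
`W'' ≥ c₀ > 0` and `W(u) ≥ max(0, c₁|u|^p - c₂)`, and `W'(u)/|u|^p → 0` as `|u| → ∞`. -/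
structure IsPotential (p : ℝ) (W : ℝ → ℝ) : Prop where
  contDiff : ContDiff ℝ 3 W
  strictConvex : StrictConvexOn ℝ univ W
  uniformlyConvex : ∃ c₀ > 0, ∀ u, c₀ ≤ deriv (deriv W) u
  coercive : ∃ c₁ > 0, ∃ c₂ > 0, ∀ u, max 0 (c₁ * |u| ^ p - c₂) ≤ W u
  stress_growth : Tendsto (fun u => deriv W u / |u| ^ p) (cocompact ℝ) (𝓝 0)

/-- The lattice spacing `ε = 2π/N`. -/
def eps (N : ℕ) : ℝ := 2 * Real.pi / N

/-- `x i t` and `v i t` are the positions and velocities, for `0 ≤ t ≤ T`, of the `N`-atom periodic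
chain (continued to `i ∈ ℤ` by `x_{i+N} = x_i + 2π`), obeying the equation of motion
`d/dt (ε ρ ẋ_i) = W'((x_{i+1} - x_i)/ε) - W'((x_i - x_{i-1})/ε)`. -/
structure IsLatticeSolution (W : ℝ → ℝ) (ρ T : ℝ) (N : ℕ) (x v : ℤ → ℝ → ℝ) : Prop where
  quasiPeriodic : ∀ i, ∀ t ∈ Icc 0 T, x (i + N) t = x i t + 2 * Real.pi
  velocity : ∀ i, ∀ t ∈ Icc 0 T, HasDerivWithinAt (x i) (v i t) (Icc 0 T) t
  motion : ∀ i, ∀ t ∈ Icc 0 T,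
    HasDerivWithinAt (fun s => eps N * ρ * v i s)
      (deriv W ((x (i + 1) t - x i t) / eps N) - deriv W ((x i t - x (i - 1) t) / eps N))
      (Icc 0 T) t

/-- The energy `∑_{i<N} [ (ερ/2) ẋ_i² + ε W((x_{i+1} - x_i)/ε) ]` of the chain at time `t`. -/
def latticeEnergy (W : ℝ → ℝ) (ρ : ℝ) (N : ℕ) (x v : ℤ → ℝ → ℝ) (t : ℝ) : ℝ :=
  ∑ i ∈ Finset.range N,
    (eps N * ρ / 2 * (v i t) ^ 2 + eps N * W ((x (i + 1) t - x i t) / eps N))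

/-- The cell `I^i_ε = [iε, (i+1)ε)`; the cells with `0 ≤ i < N` partition `[0, 2π)`. -/
def cell (N i : ℕ) : Set ℝ := Ico (i * eps N) ((i + 1) * eps N)

/-- The piecewise affine interpolation `y^ε(t, X)` of the positions, for `X ∈ [0, 2π)`. -/
def yInterp (N : ℕ) (x : ℤ → ℝ → ℝ) (t X : ℝ) : ℝ :=
  ∑ i ∈ Finset.range N,
    (cell N i).indicator
      (fun X => x i t + 1 / eps N * (X - i * eps N) * (x (i + 1) t - x i t)) X

/-- `u^ε = ∂y^ε/∂X` (the nodes form a null set). -/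
def uInterp (N : ℕ) (x : ℤ → ℝ → ℝ) (t X : ℝ) : ℝ := deriv (yInterp N x t) X

/-- `v^ε = ∑ ẋ_i 1_{I^i_ε}`. -/
def vInterp (N : ℕ) (v : ℤ → ℝ → ℝ) (t X : ℝ) : ℝ :=
  ∑ i ∈ Finset.range N, (cell N i).indicator (fun _ => v i t) X

/-- The pair `(u^ε, v^ε)` as a function of `z = (X, t)`. -/
def interp (N : ℕ) (x v : ℤ → ℝ → ℝ) (z : ℝ × ℝ) : ℝ × ℝ :=
  (uInterp N x z.2 z.1, vInterp N v z.2 z.1)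

/-- The energy density `η(M, λ) = (ρ/2) λ² + W(M)`. -/
def energyDensity (W : ℝ → ℝ) (ρ : ℝ) (a : ℝ × ℝ) : ℝ := ρ / 2 * a.2 ^ 2 + W a.1

/-- A fundamental domain `[0, 2π)` of the circle `Q = ℝ / 2πℤ`. -/
def circleDomain : Set ℝ := Ico 0 (2 * Real.pi)

/-- The space-time domain `Q × [0, T]`, whose points are written `(X, t)`. -/
def spaceTime (T : ℝ) : Set (ℝ × ℝ) := circleDomain ×ˢ Icc 0 T

/-- `2π`-periodicity in the space variable `X`. -/
def SpacePeriodic (f : ℝ × ℝ → ℝ) : Prop := ∀ X t, f (X + 2 * Real.pi, t) = f (X, t)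

/-- `f` is a Lipschitz function on `Q × [0, T]`. -/
def IsLipschitzField (T : ℝ) (f : ℝ × ℝ → ℝ) : Prop :=
  SpacePeriodic f ∧ ∃ K, LipschitzOnWith K f (univ ×ˢ Icc 0 T)

/-- Test functions in `C¹_c(Q × [0, T))`. They need not vanish at `t = 0`. -/
def IsTestFunction (T : ℝ) (φ : ℝ × ℝ → ℝ) : Prop :=
  SpacePeriodic φ ∧ ContDiff ℝ 1 φ ∧ ∃ T' < T, ∀ X t, T' ≤ t → φ (X, t) = 0

/-- Weak form, with initial data `u(·,0), v(·,0)`, of the continuum equations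
`ρ ∂_t v = ∂_X W'(u)`, `∂_t u = ∂_X v` on `Q × [0, T)`. -/
def IsWeakElastodynamics (W : ℝ → ℝ) (ρ T : ℝ) (u v : ℝ × ℝ → ℝ) : Prop :=
  ∀ φ, IsTestFunction T φ →
    (∫ z in spaceTime T, (ρ * deriv (fun s => φ (z.1, s)) z.2 * v z
        - deriv (fun X => φ (X, z.2)) z.1 * deriv W (u z)))
      + (∫ X in circleDomain, ρ * φ (X, 0) * v (X, 0)) = 0 ∧
    (∫ z in spaceTime T, (deriv (fun s => φ (z.1, s)) z.2 * u z
        - deriv (fun X => φ (X, z.2)) z.1 * v z))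
      + (∫ X in circleDomain, φ (X, 0) * u (X, 0)) = 0

/-- Weak convergence in `L¹(μ)` (for a finite measure `μ`): convergence against every `φ ∈ L^∞`. -/
def WeakL1Tendsto {α : Type*} [MeasurableSpace α] (μ : Measure α) (h : ℕ → α → ℝ) (k : α → ℝ) :
    Prop :=
  (∀ n, Integrable (h n) μ) ∧ Integrable k μ ∧
    ∀ φ : α → ℝ, MemLp φ ⊤ μ →
      Tendsto (fun n => ∫ z, φ z * h n z ∂μ) atTop (𝓝 (∫ z, φ z * k z ∂μ))

/-- Weak (sequential) precompactness in `L¹(μ)`: every subsequence has a weakly convergent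
subsequence. -/
def WeakL1Precompact {α : Type*} [MeasurableSpace α] (μ : Measure α) (h : ℕ → α → ℝ) : Prop :=
  (∀ n, Integrable (h n) μ) ∧
    ∀ σ : ℕ → ℕ, StrictMono σ → ∃ τ : ℕ → ℕ, StrictMono τ ∧ ∃ k : α → ℝ,
      WeakL1Tendsto μ (fun n => h (σ (τ n))) k

/-- The sequence `f n` of `ℝ²`-valued functions has Young measure `ν`: a weak-* measurable family
of probability measures such that `g ∘ f n ⇀ ⟨ν, g⟩` weakly in `L¹` for every continuous `g` for
which `g ∘ f n` is weakly precompact in `L¹`. -/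
structure GeneratesYoungMeasure {α : Type*} [MeasurableSpace α] (μ : Measure α)
    (f : ℕ → α → ℝ × ℝ) (ν : α → Measure (ℝ × ℝ)) : Prop where
  prob : ∀ᵐ z ∂μ, IsProbabilityMeasure (ν z)
  weakStarMeasurable : ∀ g : ℝ × ℝ → ℝ, Continuous g → HasCompactSupport g →
    AEStronglyMeasurable (fun z => ∫ a, g a ∂(ν z)) μ
  weak_limit : ∀ g : ℝ × ℝ → ℝ, Continuous g → WeakL1Precompact μ (fun n z => g (f n z)) →
    (∀ᵐ z ∂μ, Integrable g (ν z)) ∧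
      WeakL1Tendsto μ (fun n z => g (f n z)) (fun z => ∫ a, g a ∂(ν z))

/-- `γ = wk*-lim (η(f n) - ⟨ν, η⟩)` in the non-negative Radon measures on `Q × [0, T]`, with
`⟨ν, η⟩ ∈ L¹`. A measure on `Q × [0, T]` is represented on the fundamental domain; test functions
are all the continuous functions on `Q × [0, T]`. -/
structure IsConcentrationMeasure (T : ℝ) (η : ℝ × ℝ → ℝ) (f : ℕ → ℝ × ℝ → ℝ × ℝ)
    (ν : ℝ × ℝ → Measure (ℝ × ℝ)) (γ : Measure (ℝ × ℝ)) : Prop where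
  finite : IsFiniteMeasure γ
  carried : γ (spaceTime T)ᶜ = 0
  integrable_fibre : ∀ᵐ z ∂(volume.restrict (spaceTime T)), Integrable η (ν z)
  integrable_mean : IntegrableOn (fun z => ∫ a, η a ∂(ν z)) (spaceTime T)
  weakStar_limit : ∀ φ : ℝ × ℝ → ℝ, Continuous φ → SpacePeriodic φ →
    Tendsto (fun n => ∫ z in spaceTime T, φ z * (η (f n z) - ∫ a, η a ∂(ν z))) atTop
      (𝓝 (∫ z, φ z ∂γ))

end

end SpringLattice

/-! The proof is the relative energy method carried out on the lattice. Let a_i, b_i be the averages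
of the continuum strain and velocity over the i-th cell, and let u_i, v_i be the lattice strain and
velocity. Closeness is measured by K = Σ ε [ρ/2 (v_i − b_i)² + W(u_i|a_i)], where W(u|a) is the
first-order Taylor remainder of W at a. Since a stays bounded, uniform convexity, coercivity and the
growth of W' show that W(u|a) dominates (u − a)², |u − a|^p and |W'(u|a)| up to a constant
(`exists_relPotential_bounds`).

A Lipschitz weak solution satisfies its balance laws on every interval
(`integral_sub_eq_of_weak_conservation`). Hence the averages are differentiable in time and solve
equations of lattice type, except that increments of averages are replaced by increments of nodal
values. The mismatch is a second-order difference. For a Lipschitz field it is bounded, and it tends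
to zero at each point of differentiability, so Rademacher's theorem and dominated convergence make
its mean vanish without any second derivative (`tendsto_secondDiffSum`).

Differentiating K and summing by parts (`sum_relEnergy_balance`) leaves the quadratic-type term
W'(u|a), which K absorbs, and consistency errors. This gives K' ≤ C K + C · error
(`exists_deriv_latticeRelEnergy_le`), and Grönwall's argument gives `exists_latticeRelEnergy_le`.
Initially K differs from the energy difference only by terms linear in the deviations, up to O(ε),
so convergence of the data and of their energy forces K(0) → 0 (`tendsto_latticeRelEnergy_zero`).

Smallness of K uniformly in time yields the L^p and L² convergence, and the same linear comparison
of K with the energy yields L¹ convergence of the energy density (`strong_convergence`). Strong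
convergence gives a.e. convergent subsequences, which determine all weak limits of g(u^ε, v^ε) and
so force the Dirac Young measure; L¹ convergence of the energy leaves no mass to concentrate. -/

namespace SpringLattice

/-! ### Bounds on the relative potential -/

/-- The relative potential `W(u|a) = W(u) - W(a) - W'(a)(u - a)`. -/
noncomputable def relPotential (W : ℝ → ℝ) (u a : ℝ) : ℝ := W u - W a - deriv W a * (u - a)

theorem exists_bound_of_contDiff_one {g : ℝ → ℝ} (hg : ContDiff ℝ 1 g) (R : ℝ) :
    ∃ M, 0 ≤ M ∧ (∀ x, |x| ≤ R → |g x| ≤ M) ∧ (∀ x, |x| ≤ R → |deriv g x| ≤ M) ∧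
      ∀ x y, |x| ≤ R → |y| ≤ R → |g x - g y| ≤ M * |x - y| := by
  have hc : Continuous (deriv g) := hg.continuous_deriv le_rfl
  obtain ⟨M, hM⟩ := (isCompact_Icc (a := -R) (b := R)).exists_bound_of_continuousOn hc.continuousOn
  obtain ⟨M', hM'⟩ := (isCompact_Icc (a := -R) (b := R)).exists_bound_of_continuousOn
    hg.continuous.continuousOn
  refine ⟨max (max M M') 0, le_max_right _ _, ?_, ?_, ?_⟩
  · intro x hx
    exact (hM' x (abs_le.1 hx)).trans ((le_max_right _ _).trans (le_max_left _ _))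
  · intro x hx
    exact (hM x (abs_le.1 hx)).trans ((le_max_left _ _).trans (le_max_left _ _))
  · intro x y hx hy
    have := Convex.norm_image_sub_le_of_norm_deriv_le (𝕜 := ℝ) (f := g) (s := Icc (-R) R)
      (C := max (max M M') 0) (fun z _ => (hg.differentiable one_ne_zero).differentiableAt)
      (fun z hz => (hM z hz).trans ((le_max_left _ _).trans (le_max_left _ _)))
      (convex_Icc _ _) (abs_le.1 hy) (abs_le.1 hx)
    simpa [Real.norm_eq_abs] using this

/-- Mean value inequality on the segment from y to x for z ↦ g z − g'(y) z: its derivative there is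
at most M|x − y|, because g' is M-Lipschitz on the bounded interval. -/
theorem exists_taylor_bound {g : ℝ → ℝ} (hg : ContDiff ℝ 2 g) (R : ℝ) :
    ∃ M, 0 ≤ M ∧ ∀ x y, |x| ≤ R → |y| ≤ R →
      |g x - g y - deriv g y * (x - y)| ≤ M * (x - y) ^ 2 := by
  have hg1 : ContDiff ℝ 1 (deriv g) := by
    have : ContDiff ℝ (1 + 1) g := by simpa [one_add_one_eq_two] using hg
    exact (contDiff_succ_iff_deriv.1 this).2.2
  obtain ⟨M, hM0, -, -, hM⟩ := exists_bound_of_contDiff_one hg1 R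
  refine ⟨M, hM0, fun x y hx hy => ?_⟩
  have hd : Differentiable ℝ g := hg.differentiable two_ne_zero
  have hder : ∀ z, HasDerivAt (fun z => g z - deriv g y * z) (deriv g z - deriv g y) z := fun z => by
    simpa using (hd z).hasDerivAt.fun_sub ((hasDerivAt_id z).const_mul (deriv g y))
  have hsub : uIcc y x ⊆ Icc (-R) R :=
    uIcc_subset_Icc (abs_le.1 hy) (abs_le.1 hx)
  have := Convex.norm_image_sub_le_of_norm_deriv_le (𝕜 := ℝ) (f := fun z => g z - deriv g y * z)
      (s := uIcc y x) (C := M * |x - y|) (fun z _ => (hder z).differentiableAt)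
      (fun z hz => by
        rw [(hder z).deriv]
        refine (hM z y (abs_le.2 (hsub hz)) hy).trans ?_
        exact mul_le_mul_of_nonneg_left (abs_sub_left_of_mem_uIcc hz) hM0)
      (convex_uIcc _ _) left_mem_uIcc right_mem_uIcc
  rw [Real.norm_eq_abs, Real.norm_eq_abs, mul_assoc, abs_mul_abs_self] at this
  rw [pow_two]
  convert this using 2
  ring

namespace IsPotential

variable {p : ℝ} {W : ℝ → ℝ}

theorem contDiff_deriv (hW : IsPotential p W) : ContDiff ℝ 2 (deriv W) := by
  have : ContDiff ℝ (2 + 1) W := by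
    have h := hW.contDiff
    norm_num at h ⊢
    exact h
  exact (contDiff_succ_iff_deriv.1 this).2.2

theorem differentiable (hW : IsPotential p W) : Differentiable ℝ W :=
  hW.contDiff.differentiable (by norm_num)

theorem differentiable_deriv (hW : IsPotential p W) : Differentiable ℝ (deriv W) :=
  hW.contDiff_deriv.differentiable two_ne_zero

/-- Subtracting c₀/2 (s − a)² from W minus its linear part at a keeps it convex, and the derivative
vanishes at a; so a is a global minimum. -/
theorem exists_sq_le_relPotential (hW : IsPotential p W) :
    ∃ c > 0, ∀ u a, c * (u - a) ^ 2 ≤ relPotential W u a := by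
  obtain ⟨c₀, hc₀, h⟩ := hW.uniformlyConvex
  refine ⟨c₀ / 2, by positivity, fun u a => ?_⟩
  set φ : ℝ → ℝ := fun s => W s - deriv W a * (s - a) - c₀ / 2 * (s - a) ^ 2 with hφ
  have h1 : ∀ s, HasDerivAt φ (deriv W s - deriv W a - c₀ * (s - a)) s := fun s => by
    have hs : HasDerivAt (fun s => s - a) 1 s := (hasDerivAt_id s).sub_const a
    have := (((hW.differentiable s).hasDerivAt.sub (hs.const_mul (deriv W a))).sub
      ((hs.pow 2).const_mul (c₀ / 2)))
    refine this.congr_deriv ?_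
    norm_num; ring
  have h1' : deriv φ = fun s => deriv W s - deriv W a - c₀ * (s - a) := funext fun s => (h1 s).deriv
  have h2 : ∀ s, HasDerivAt (deriv φ) (deriv (deriv W) s - c₀) s := fun s => by
    rw [h1']
    have hs : HasDerivAt (fun s => s - a) 1 s := (hasDerivAt_id s).sub_const a
    have := ((hW.differentiable_deriv s).hasDerivAt.sub_const (deriv W a)).fun_sub (hs.const_mul c₀)
    simpa using this
  have hconv : ConvexOn ℝ univ φ := convexOn_univ_of_deriv2_nonneg (fun s => (h1 s).differentiableAt)
    (fun s => (h2 s).differentiableAt) (fun s => by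
      simp only [Function.iterate_succ, Function.iterate_zero, Function.comp, id]
      rw [(h2 s).deriv]
      linarith [h s])
  have hmin := hconv.isMinOn_of_rightDeriv_eq_zero (x := a) (by simp) (by
    rw [(h1 a).hasDerivWithinAt.derivWithin (uniqueDiffWithinAt_Ioi a)]; ring)
  have := hmin (mem_univ u)
  simp only [hφ, mem_ofPred_eq, sub_self, mul_zero] at this
  unfold relPotential
  norm_num at this
  linarith

-- For bounded u, Taylor's formula makes everything comparable to (u − a)², which uniform convexity
-- controls. For large u, coercivity gives W(u|a) ≥ (c₁/2)|u|^p, and every left-hand side other than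
-- the square is at most a multiple of |u|^p. The constant is uniform in a over the bounded range of
-- the continuum strain.
set_option maxHeartbeats 1000000 in
theorem exists_relPotential_bounds (hp : 2 ≤ p) (hW : IsPotential p W) (B : ℝ) :
    ∃ C > 0, ∀ u a, |a| ≤ B →
      |relPotential (deriv W) u a| ≤ C * relPotential W u a ∧
      |u - a| ^ p ≤ C * relPotential W u a ∧ (u - a) ^ 2 ≤ C * relPotential W u a := by
  obtain ⟨c, hc, hsq⟩ := hW.exists_sq_le_relPotential
  obtain ⟨c₁, hc₁, c₂, hc₂, hcoer⟩ := hW.coercive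
  obtain ⟨M₀, hM₀, hMW, hMW', -⟩ := exists_bound_of_contDiff_one (hW.contDiff.of_le (by norm_num)) B
  obtain ⟨M₁, hM₁, hM1, hM1', -⟩ :=
    exists_bound_of_contDiff_one (hW.contDiff_deriv.of_le (by norm_num)) B
  have hev : ∀ᶠ u in cocompact ℝ, |deriv W u / |u| ^ p| < 1 := by
    have := hW.stress_growth.abs
    rw [abs_zero] at this
    exact this.eventually (gt_mem_nhds one_pos)
  obtain ⟨r, hr⟩ : ∃ r : ℝ, ∀ u, r < |u| → |deriv W u / |u| ^ p| < 1 := by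
    rw [← Metric.cobounded_eq_cocompact] at hev
    obtain ⟨r, hr⟩ := (Metric.hasBasis_cobounded_compl_closedBall (0 : ℝ)).eventually_iff.1 hev
    exact ⟨r, fun u hu => hr.2 (by simpa using hu)⟩
  -- D dominates the coefficients of all terms of at most linear growth in u, once |u| ≥ 1.
  set D : ℝ := c₂ + M₀ + M₀ * (1 + |B|) + M₁ * (1 + |B|) with hD
  have hD0 : 0 ≤ D := by positivity
  -- The cutoff makes |W'(u)| ≤ |u|^p valid beyond it, keeps a inside it, and, through 4D/c₁ and p ≥
  -- 2, makes 2D|u| at most (c₁/2)|u|^p.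
  set R : ℝ := max (max 1 (|r| + 1)) (max |B| (4 * D / c₁)) with hR
  have hR1 : 1 ≤ R := (le_max_left _ _).trans (le_max_left _ _)
  have hRr : r < R :=
    (lt_of_le_of_lt (le_abs_self r) (lt_add_one _)).trans_le
      ((le_max_right _ _).trans (le_max_left _ _))
  have hRB : |B| ≤ R := (le_max_left _ _).trans (le_max_right _ _)
  have hRD : 4 * D / c₁ ≤ R := (le_max_right _ _).trans (le_max_right _ _)
  obtain ⟨M₂, hM₂, hM2⟩ := exists_taylor_bound hW.contDiff_deriv R
  -- When |u| ≤ R one has |u − a| ≤ 2R, hence |u − a|^p ≤ (2R)^(p−2) (u − a)².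
  set K : ℝ := (2 * R) ^ (p - 2) with hK
  have hK0 : 0 ≤ K := by positivity
  -- One summand per estimate: the square, then W' and the p-th power for |u| ≤ R, then the same two
  -- for |u| > R.
  set C : ℝ := 1 / c + M₂ / c + K / c + 2 * (1 + c₁) / c₁ + 2 * (2 ^ p) / c₁ with hC
  have e1 : 0 < 1 / c := by positivity
  have e2 : 0 ≤ M₂ / c := by positivity
  have e3 : 0 ≤ K / c := by positivity
  have e4 : 0 ≤ 2 * (1 + c₁) / c₁ := by positivity
  have e5 : 0 ≤ 2 * (2 ^ p) / c₁ := by positivity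
  refine ⟨C, by positivity, fun u a ha => ?_⟩
  have hrel := hsq u a
  have hrel0 : 0 ≤ relPotential W u a := le_trans (by positivity) hrel
  have hsq' : (u - a) ^ 2 ≤ 1 / c * relPotential W u a := by
    rw [one_div, ← div_eq_inv_mul, le_div_iff₀ hc]; linarith
  have haB : |a| ≤ |B| := ha.trans (le_abs_self B)
  have h3 : (u - a) ^ 2 ≤ C * relPotential W u a :=
    hsq'.trans (mul_le_mul_of_nonneg_right (by linarith) hrel0)
  rcases le_or_gt |u| R with hu | hu
  · refine ⟨?_, ?_, h3⟩
    · refine (hM2 u a hu (haB.trans hRB)).trans ?_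
      calc M₂ * (u - a) ^ 2 ≤ M₂ * (1 / c * relPotential W u a) := by gcongr
        _ = M₂ / c * relPotential W u a := by ring
        _ ≤ _ := mul_le_mul_of_nonneg_right (by linarith) hrel0
    · have hua : |u - a| ≤ 2 * R := (abs_sub _ _).trans (by linarith [haB.trans hRB])
      have : |u - a| ^ p ≤ K * (u - a) ^ 2 := by
        have hpp : |u - a| ^ p = |u - a| ^ (p - 2) * (u - a) ^ 2 := by
          rcases eq_or_ne (u - a) 0 with h0 | h0
          · rw [h0]; simp; rw [Real.zero_rpow (by linarith)]
          · rw [← sq_abs (u - a), ← Real.rpow_natCast, ← Real.rpow_add (abs_pos.2 h0)]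
            norm_num
        rw [hpp]
        exact mul_le_mul_of_nonneg_right
          (Real.rpow_le_rpow (abs_nonneg _) hua (by linarith)) (sq_nonneg _)
      calc |u - a| ^ p ≤ K * (1 / c * relPotential W u a) := this.trans (by gcongr)
        _ = K / c * relPotential W u a := by ring
        _ ≤ _ := mul_le_mul_of_nonneg_right (by linarith) hrel0
  · have hu1 : 1 < |u| := hR1.trans_lt hu
    have hup : |u| ^ (2 : ℝ) ≤ |u| ^ p := Real.rpow_le_rpow_of_exponent_le hu1.le hp
    have hup2 : |u| * |u| ≤ |u| ^ p := by
      rwa [Real.rpow_two, pow_two] at hup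
    have hDu : D * (2 * |u|) ≤ c₁ / 2 * |u| ^ p := by
      have : 4 * D ≤ c₁ * |u| := by
        have := hRD.trans hu.le
        rw [div_le_iff₀ hc₁] at this
        linarith
      have h1 : 4 * D * |u| ≤ c₁ * |u| * |u| := mul_le_mul_of_nonneg_right this (abs_nonneg u)
      have h2 : c₁ * (|u| * |u|) ≤ c₁ * |u| ^ p := mul_le_mul_of_nonneg_left hup2 hc₁.le
      linarith
    have hup0 : 0 ≤ |u| ^ p := by positivity
    have hlow : c₁ / 2 * |u| ^ p ≤ relPotential W u a := by
      have h1 : c₁ * |u| ^ p - c₂ ≤ W u := (le_max_right _ _).trans (hcoer u)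
      have h2 := (abs_le.1 (hMW a ha)).2
      have h4 : deriv W a * (u - a) ≤ M₀ * (|u| + |B|) := by
        refine (le_abs_self _).trans ?_
        rw [abs_mul]
        exact mul_le_mul (hMW' a ha) ((abs_sub _ _).trans (by linarith)) (abs_nonneg _) hM₀
      have h5 : M₀ * (|u| + |B|) ≤ M₀ * (1 + |B|) * |u| := by
        have : |B| ≤ |B| * |u| := le_mul_of_one_le_right (abs_nonneg B) hu1.le
        rw [mul_assoc]
        exact mul_le_mul_of_nonneg_left (by linarith) hM₀
      have h6 : c₂ + M₀ ≤ (c₂ + M₀) * |u| := le_mul_of_one_le_right (by positivity) hu1.le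
      have h7 : 0 ≤ M₁ * (1 + |B|) * |u| := by positivity
      have h8 : 0 ≤ D * |u| := by positivity
      have h9 : D * |u| = (c₂ + M₀) * |u| + M₀ * (1 + |B|) * |u| + M₁ * (1 + |B|) * |u| := by
        rw [hD]; ring
      unfold relPotential
      linarith
    have hlow' : |u| ^ p ≤ 2 / c₁ * relPotential W u a := by
      calc |u| ^ p = 2 / c₁ * (c₁ / 2 * |u| ^ p) := by field_simp
        _ ≤ _ := by gcongr
    refine ⟨?_, ?_, h3⟩
    · have h1 : |deriv W u| ≤ |u| ^ p := by
        have := hr u (hRr.trans hu)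
        rw [abs_div, div_lt_one (abs_pos.2 (by positivity)), abs_of_pos (a := |u| ^ p)
          (by positivity)] at this
        exact this.le
      have h2 : |deriv (deriv W) a * (u - a)| ≤ M₁ * (|u| + |B|) := by
        rw [abs_mul]
        exact mul_le_mul (hM1' a ha) ((abs_sub _ _).trans (by linarith)) (abs_nonneg _) hM₁
      have h4 : M₁ + M₁ * (|u| + |B|) ≤ M₁ * (1 + |B|) * (2 * |u|) := by
        have : |B| ≤ |B| * |u| := le_mul_of_one_le_right (abs_nonneg B) hu1.le
        rw [mul_assoc, ← mul_one_add]
        exact mul_le_mul_of_nonneg_left (by linarith [abs_nonneg B]) hM₁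
      have h5 : M₁ * (1 + |B|) * (2 * |u|) ≤ D * (2 * |u|) := by
        gcongr
        rw [hD]
        have : 0 ≤ c₂ + M₀ + M₀ * (1 + |B|) := by positivity
        linarith
      have h6 : |relPotential (deriv W) u a| ≤ (1 + c₁) * |u| ^ p := by
        unfold relPotential
        refine (abs_sub _ _).trans ?_
        have := abs_sub (deriv W u) (deriv W a)
        have := hM1 a ha
        have : 0 ≤ c₁ * |u| ^ p := by positivity
        linarith
      calc _ ≤ (1 + c₁) * |u| ^ p := h6
        _ ≤ (1 + c₁) * (2 / c₁ * relPotential W u a) := by gcongr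
        _ = 2 * (1 + c₁) / c₁ * relPotential W u a := by ring
        _ ≤ _ := mul_le_mul_of_nonneg_right (by linarith) hrel0
    · have h1 : |u - a| ≤ 2 * |u| := (abs_sub _ _).trans (by linarith [haB.trans hRB])
      calc |u - a| ^ p ≤ (2 * |u|) ^ p := by gcongr
        _ = 2 ^ p * |u| ^ p := Real.mul_rpow (by norm_num) (abs_nonneg _)
        _ ≤ 2 ^ p * (2 / c₁ * relPotential W u a) := by gcongr
        _ = 2 * (2 ^ p) / c₁ * relPotential W u a := by ring
        _ ≤ _ := mul_le_mul_of_nonneg_right (by linarith) hrel0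

end IsPotential

/-! ### From the weak form of a conservation law to its integral form -/

theorem hasDerivAt_integral_of_continuous {f : ℝ → ℝ} (hf : Continuous f) (a x : ℝ) :
    HasDerivAt (fun y => ∫ s in a..y, f s) (f x) x :=
  (hf.integral_hasStrictDerivAt a x).hasDerivAt

theorem contDiff_integral_of_continuous {f : ℝ → ℝ} (hf : Continuous f) (a : ℝ) :
    ContDiff ℝ 1 (fun y => ∫ s in a..y, f s) := by
  refine contDiff_one_iff_deriv.2
    ⟨fun x => (hasDerivAt_integral_of_continuous hf a x).differentiableAt, ?_⟩
  have : deriv (fun y => ∫ s in a..y, f s) = f :=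
    funext fun x => (hasDerivAt_integral_of_continuous hf a x).deriv
  rwa [this]

theorem eq_zero_of_integral_eq_zero {f : ℝ → ℝ} {a b : ℝ} (hab : a < b) (hf : Continuous f)
    (h0 : ∀ x, 0 ≤ f x) (hint : ∫ x in a..b, f x = 0) : ∀ x ∈ Icc a b, f x = 0 := by
  intro x hx
  by_contra hne
  exact (intervalIntegral.integral_pos hab hf.continuousOn (fun y _ => h0 y)
    ⟨x, hx, lt_of_le_of_ne (h0 x) (Ne.symm hne)⟩).ne' hint

/-- A weak solution `p` of `p' = -f` on `[0, T)` is a primitive of `-f`. -/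
theorem eq_sub_integral_of_weak {T : ℝ} (hT : 0 < T) {p f : ℝ → ℝ} (hp : Continuous p)
    (hf : Continuous f)
    (h : ∀ θ : ℝ → ℝ, ContDiff ℝ 1 θ → (∃ T' < T, ∀ t, T' ≤ t → θ t = 0) →
      (∫ t in 0..T, (deriv θ t * p t - θ t * f t)) + θ 0 * p 0 = 0) :
    ∀ t ∈ Icc 0 T, p t = p 0 - ∫ s in 0..t, f s := by
  set F : ℝ → ℝ := fun t => ∫ s in 0..t, f s with hF
  have hFd : ∀ t, HasDerivAt F (f t) t := hasDerivAt_integral_of_continuous hf 0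
  have hFc : Continuous F := continuous_iff_continuousAt.2 fun t => (hFd t).continuousAt
  -- G is the defect in the desired identity. The test function is built from G itself, so that the
  -- weak equation reads ∫ G² · weight = 0.
  set G : ℝ → ℝ := fun t => p t + F t - p 0 with hG
  have hGc : Continuous G := by fun_prop
  have key : ∀ T' ∈ Ioo 0 T, ∀ t ∈ Icc 0 T, G t * (G t * max 0 (T' - t)) = 0 := by
    intro T' hT'
    -- The weight max(0, T' − t) vanishes after T', so the primitive of ψ based at T' is an
    -- admissible test function with no condition at t = 0.
    set ψ : ℝ → ℝ := fun t => G t * max 0 (T' - t) with hψ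
    have hψc : Continuous ψ := by fun_prop
    set θ : ℝ → ℝ := fun t => ∫ s in T'..t, ψ s with hθ
    have hθd : ∀ t, HasDerivAt θ (ψ t) t := hasDerivAt_integral_of_continuous hψc T'
    have hθ0 : ∀ t, T' ≤ t → θ t = 0 := by
      intro t ht
      rw [hθ]
      refine intervalIntegral.integral_zero_ae (Eventually.of_forall fun s hs => ?_)
      rw [uIoc_of_le ht] at hs
      simp only [hψ]
      rw [max_eq_left (by linarith [hs.1]), mul_zero]
    have hw := h θ (contDiff_integral_of_continuous hψc T') ⟨T', hT'.2, hθ0⟩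
    have hdθ : deriv θ = ψ := funext fun t => (hθd t).deriv
    have hθc : Continuous θ := continuous_iff_continuousAt.2 fun t => (hθd t).continuousAt
    rw [hdθ] at hw
    have hparts : ∫ t in 0..T, θ t * f t = θ T * F T - θ 0 * F 0 - ∫ t in 0..T, ψ t * F t :=
      intervalIntegral.integral_mul_deriv_eq_deriv_mul (fun t _ => hθd t) (fun t _ => hFd t)
        (hψc.intervalIntegrable _ _) (hf.intervalIntegrable _ _)
    have hF0 : F 0 = 0 := by simp [hF]
    have hψint : ∫ t in 0..T, ψ t = θ T - θ 0 :=
      intervalIntegral.integral_eq_sub_of_hasDerivAt (fun t _ => hθd t)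
        (hψc.intervalIntegrable _ _)
    rw [hθ0 T hT'.2.le] at hparts hψint
    have hzero : ∫ t in 0..T, G t * ψ t = 0 := by
      have e : (fun t => G t * ψ t) = fun t => (ψ t * p t + ψ t * F t) - p 0 * ψ t := by
        funext t; simp only [hG]; ring
      rw [e, intervalIntegral.integral_sub, intervalIntegral.integral_add,
        intervalIntegral.integral_const_mul, hψint]
      · rw [intervalIntegral.integral_sub, hparts, hF0] at hw
        · linarith
        · exact (by fun_prop : Continuous fun t => ψ t * p t).intervalIntegrable _ _
        · exact (by fun_prop : Continuous fun t => θ t * f t).intervalIntegrable _ _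
      · exact (by fun_prop : Continuous fun t => ψ t * p t).intervalIntegrable _ _
      · exact (by fun_prop : Continuous fun t => ψ t * F t).intervalIntegrable _ _
      · exact (by fun_prop : Continuous fun t => ψ t * p t + ψ t * F t).intervalIntegrable _ _
      · exact (by fun_prop : Continuous fun t => p 0 * ψ t).intervalIntegrable _ _
    refine eq_zero_of_integral_eq_zero hT (by fun_prop) (fun t => ?_) hzero
    rw [← mul_assoc]
    exact mul_nonneg (mul_self_nonneg _) (le_max_left _ _)
  have hIco : ∀ t ∈ Ico 0 T, G t = 0 := by
    intro t ht
    have := key ((t + T) / 2) ⟨by linarith [ht.1], by linarith [ht.2]⟩ t ⟨ht.1, ht.2.le⟩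
    have hpos : 0 < max 0 ((t + T) / 2 - t) := lt_max_of_lt_right (by linarith [ht.2])
    rcases mul_eq_zero.1 this with h0 | h0
    · exact h0
    · exact (mul_eq_zero.1 h0).resolve_right hpos.ne'
  intro t ht
  -- The test functions see only t < T; the endpoint follows by continuity.
  have hcl : closure (Ico 0 T) ⊆ {t | G t = 0} :=
    closure_minimal hIco (isClosed_eq hGc continuous_const)
  rw [closure_Ico hT.ne] at hcl
  have h0 : G t = 0 := hcl ht
  simp only [hG, hF] at h0 ⊢
  linarith

/-- A weak periodic solution of `Φ' = D` is a primitive of `D`. -/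
theorem sub_eq_integral_of_weak_periodic {c : ℝ} (hc : 0 < c) {D Φ : ℝ → ℝ} (hD : Continuous D)
    (hΦ : Continuous Φ) (hDp : Function.Periodic D c) (hΦp : Function.Periodic Φ c)
    (h : ∀ χ : ℝ → ℝ, ContDiff ℝ 1 χ → Function.Periodic χ c →
      ∫ X in 0..c, χ X * D X = -∫ X in 0..c, deriv χ X * Φ X) (a b : ℝ) :
    ∫ X in a..b, D X = Φ b - Φ a := by
  set E : ℝ → ℝ := fun X => ∫ s in 0..X, D s with hE
  have hEd : ∀ X, HasDerivAt E (D X) X := hasDerivAt_integral_of_continuous hD 0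
  have hEc : Continuous E := continuous_iff_continuousAt.2 fun t => (hEd t).continuousAt
  -- The constant test function gives the zero mean that makes the primitive E of D periodic.
  have hmean : ∫ X in 0..c, D X = 0 := by
    have := h (fun _ => 1) contDiff_const (fun _ => rfl)
    simpa using this
  have hper : ∀ f : ℝ → ℝ, Continuous f → Function.Periodic f c → ∫ X in 0..c, f X = 0 →
      Function.Periodic (fun X => ∫ s in 0..X, f s) c := by
    intro f hf hfp h0 X
    have h1 := intervalIntegral.integral_add_adjacent_intervals
      (hf.intervalIntegrable (μ := volume) 0 X) (hf.intervalIntegrable X (X + c))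
    have h2 := hfp.intervalIntegral_add_eq X 0
    rw [zero_add, h0] at h2
    simp only
    rw [← h1, h2, add_zero]
  have hEp : Function.Periodic E c := hper D hD hDp hmean
  set g : ℝ → ℝ := fun X => Φ X - E X with hg
  have hgc : Continuous g := by fun_prop
  -- Subtracting the mean of Φ − E makes the primitive of ψ periodic, hence a legitimate test
  -- function; testing with it gives ∫ ψ² = 0, so Φ − E is constant.
  set m : ℝ := (∫ X in 0..c, g X) / c with hm
  set ψ : ℝ → ℝ := fun X => g X - m with hψ
  have hψc : Continuous ψ := by fun_prop
  have hψp : Function.Periodic ψ c := fun X => by simp only [hψ, hg, hΦp X, hEp X]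
  have hψ0 : ∫ X in 0..c, ψ X = 0 := by
    rw [hψ, intervalIntegral.integral_sub (hgc.intervalIntegrable _ _) (by simp)]
    simp only [intervalIntegral.integral_const, sub_zero, smul_eq_mul, hm]
    field_simp
    ring
  set χ : ℝ → ℝ := fun X => ∫ s in 0..X, ψ s with hχ
  have hχd : ∀ X, HasDerivAt χ (ψ X) X := hasDerivAt_integral_of_continuous hψc 0
  have hdχ : deriv χ = ψ := funext fun X => (hχd X).deriv
  have hw := h χ (contDiff_integral_of_continuous hψc 0) (hper ψ hψc hψp hψ0)
  rw [hdχ] at hw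
  have hparts : ∫ X in 0..c, χ X * D X = χ c * E c - χ 0 * E 0 - ∫ X in 0..c, ψ X * E X :=
    intervalIntegral.integral_mul_deriv_eq_deriv_mul (fun t _ => hχd t) (fun t _ => hEd t)
      (hψc.intervalIntegrable _ _) (hD.intervalIntegrable _ _)
  have hχc : χ c = 0 := hψ0
  have hE0 : E 0 = 0 := by simp [hE]
  rw [hχc, hE0] at hparts
  have hsq : ∫ X in 0..c, ψ X * ψ X = 0 := by
    have e : (fun X => ψ X * ψ X) = fun X => (ψ X * Φ X - ψ X * E X) - m * ψ X := by
      funext X; simp only [hψ, hg]; ring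
    rw [e, intervalIntegral.integral_sub, intervalIntegral.integral_sub,
      intervalIntegral.integral_const_mul, hψ0]
    · linarith
    · exact (by fun_prop : Continuous fun t => ψ t * Φ t).intervalIntegrable _ _
    · exact (by fun_prop : Continuous fun t => ψ t * E t).intervalIntegrable _ _
    · exact (by fun_prop : Continuous fun t => ψ t * Φ t - ψ t * E t).intervalIntegrable _ _
    · exact (by fun_prop : Continuous fun t => m * ψ t).intervalIntegrable _ _
  have hzero : ∀ X, g X = m := by
    intro X
    obtain ⟨Y, hY, hXY⟩ := hψp.exists_mem_Ico₀ hc X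
    have := eq_zero_of_integral_eq_zero hc (by fun_prop : Continuous fun X => ψ X * ψ X)
      (fun X => mul_self_nonneg _) hsq Y ⟨hY.1, hY.2.le⟩
    have h0 : ψ X = 0 := by rw [hXY]; exact mul_self_eq_zero.1 this
    simp only [hψ] at h0
    linarith
  have hab : ∫ X in a..b, D X = E b - E a :=
    (intervalIntegral.integral_interval_sub_left (hD.intervalIntegrable _ _)
      (hD.intervalIntegrable _ _)).symm
  have ha := hzero a
  have hb := hzero b
  simp only [hg] at ha hb
  rw [hab]
  linarith

theorem integral_spaceTime {T : ℝ} (hT : 0 ≤ T) {F : ℝ → ℝ → ℝ}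
    (hF : Continuous fun z : ℝ × ℝ => F z.1 z.2) :
    ∫ z in spaceTime T, F z.1 z.2 = ∫ t in 0..T, ∫ X in 0..2 * Real.pi, F X t := by
  have hint : IntegrableOn (fun z : ℝ × ℝ => F z.1 z.2)
      (Icc 0 (2 * Real.pi) ×ˢ Icc 0 T) volume :=
    hF.continuousOn.integrableOn_compact (isCompact_Icc.prod isCompact_Icc)
  have hint2 : IntegrableOn (fun z : ℝ × ℝ => F z.1 z.2) (spaceTime T) volume :=
    hint.mono_set (prod_mono Ico_subset_Icc_self le_rfl)
  have hint3 : IntegrableOn (Function.uncurry fun t X => F X t)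
      (uIoc 0 T ×ˢ uIoc 0 (2 * Real.pi)) volume := by
    have hc : Continuous (Function.uncurry fun t X => F X t) := hF.comp continuous_swap
    refine (hc.continuousOn.integrableOn_compact
      (isCompact_Icc.prod isCompact_Icc : IsCompact (Icc 0 T ×ˢ Icc 0 (2 * Real.pi)))).mono_set ?_
    rw [uIoc_of_le hT, uIoc_of_le Real.two_pi_pos.le]
    exact prod_mono Ioc_subset_Icc_self Ioc_subset_Icc_self
  rw [intervalIntegral_intervalIntegral_swap hint3,
    intervalIntegral.integral_of_le Real.two_pi_pos.le, ← integral_Ico_eq_integral_Ioc]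
  unfold spaceTime circleDomain at *
  rw [Measure.volume_eq_prod, setIntegral_prod _ hint2]
  refine integral_congr_ae (Eventually.of_forall fun X => ?_)
  simp only
  rw [intervalIntegral.integral_of_le hT, ← integral_Icc_eq_integral_Ioc]

theorem integral_circleDomain (f : ℝ → ℝ) :
    ∫ X in circleDomain, f X = ∫ X in 0..2 * Real.pi, f X := by
  rw [intervalIntegral.integral_of_le Real.two_pi_pos.le, ← integral_Ico_eq_integral_Ioc]
  rfl

/-- The integral form of a conservation law `∂_t P = ∂_X F` that holds in the weak sense. -/
theorem integral_sub_eq_of_weak_conservation {T : ℝ} (hT : 0 < T) {P F : ℝ → ℝ → ℝ}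
    (hP : Continuous fun z : ℝ × ℝ => P z.1 z.2) (hF : Continuous fun z : ℝ × ℝ => F z.1 z.2)
    (hPp : ∀ X t, P (X + 2 * Real.pi) t = P X t) (hFp : ∀ X t, F (X + 2 * Real.pi) t = F X t)
    (h : ∀ φ, IsTestFunction T φ →
      (∫ z in spaceTime T, (deriv (fun s => φ (z.1, s)) z.2 * P z.1 z.2
        - deriv (fun X => φ (X, z.2)) z.1 * F z.1 z.2))
      + (∫ X in circleDomain, φ (X, 0) * P X 0) = 0)
    (a b : ℝ) {t : ℝ} (ht : t ∈ Icc 0 T) :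
    ∫ X in a..b, P X t = (∫ X in a..b, P X 0) + ∫ s in 0..t, (F b s - F a s) := by
  have hPc : ∀ t, Continuous fun X => P X t := fun t => hP.comp (Continuous.prodMk_left t)
  have hFc : ∀ X, Continuous fun t => F X t := fun X => hF.comp (Continuous.prodMk_right X)
  have hFc' : ∀ t, Continuous fun X => F X t := fun t => hF.comp (Continuous.prodMk_left t)
  -- Product test functions χ(X) θ(t): for fixed χ, the weak equation becomes a scalar equation in
  -- time alone.
  have hweak : ∀ χ : ℝ → ℝ, ContDiff ℝ 1 χ → Function.Periodic χ (2 * Real.pi) →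
      ∫ X in 0..2 * Real.pi, χ X * P X t = (∫ X in 0..2 * Real.pi, χ X * P X 0)
        - ∫ s in 0..t, ∫ X in 0..2 * Real.pi, deriv χ X * F X s := by
    intro χ hχ hχp
    have hχd : Differentiable ℝ χ := hχ.differentiable one_ne_zero
    have hχ' : Continuous (deriv χ) := hχ.continuous_deriv le_rfl
    have hχc : Continuous χ := hχ.continuous
    have c1 : Continuous (Function.uncurry fun t X => χ X * P X t) :=
      (hχc.comp continuous_snd).mul (hP.comp continuous_swap)
    have c2 : Continuous (Function.uncurry fun t X => deriv χ X * F X t) :=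
      (hχ'.comp continuous_snd).mul (hF.comp continuous_swap)
    refine eq_sub_integral_of_weak hT
      (p := fun t => ∫ X in 0..2 * Real.pi, χ X * P X t)
      (f := fun t => ∫ X in 0..2 * Real.pi, deriv χ X * F X t)
      (intervalIntegral.continuous_parametric_intervalIntegral_of_continuous' c1 _ _)
      (intervalIntegral.continuous_parametric_intervalIntegral_of_continuous' c2 _ _) ?_ t ht
    intro θ hθ ⟨T', hT', hθ0⟩
    have hθd : Differentiable ℝ θ := hθ.differentiable one_ne_zero
    have hθ' : Continuous (deriv θ) := hθ.continuous_deriv le_rfl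
    have hθc : Continuous θ := hθ.continuous
    have := h (fun z => χ z.1 * θ z.2)
      ⟨fun X t => by simp only [hχp X],
        (hχ.comp contDiff_fst).mul (hθ.comp contDiff_snd),
        T', hT', fun X t ht => by simp only [hθ0 t ht, mul_zero]⟩
    have d1 : ∀ X t, deriv (fun s => χ X * θ s) t = χ X * deriv θ t := fun X t =>
      deriv_const_mul _ (hθd t)
    have d2 : ∀ X t, deriv (fun Y => χ Y * θ t) X = deriv χ X * θ t := fun X t =>
      deriv_mul_const (hχd X) _
    simp only [d1, d2] at this
    rw [integral_spaceTime hT.le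
      (F := fun X t => χ X * deriv θ t * P X t - deriv χ X * θ t * F X t) (by fun_prop),
      integral_circleDomain] at this
    refine Eq.trans ?_ this
    rw [← intervalIntegral.integral_const_mul]
    congr 1
    · refine intervalIntegral.integral_congr fun s _ => ?_
      rw [← intervalIntegral.integral_const_mul, ← intervalIntegral.integral_const_mul,
        ← intervalIntegral.integral_sub]
      · refine intervalIntegral.integral_congr fun X _ => ?_
        ring
      · exact (continuous_const.mul (hχc.mul (hPc s))).intervalIntegrable _ _
      · exact (continuous_const.mul (hχ'.mul (hFc' s))).intervalIntegrable _ _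
    · refine intervalIntegral.integral_congr fun X _ => ?_
      ring
  have hFs : Continuous (Function.uncurry fun X s => F X s) := hF
  have hswapc : Continuous (Function.uncurry fun s X => F X s) := hF.comp continuous_swap
  -- What remains is a weak equation in X alone: P(·, t) − P(·, 0) is the derivative of the flux
  -- integrated over [0, t].
  have := sub_eq_integral_of_weak_periodic Real.two_pi_pos
    (D := fun X => P X t - P X 0) (Φ := fun X => ∫ s in 0..t, F X s)
    ((hPc t).sub (hPc 0))
    (intervalIntegral.continuous_parametric_intervalIntegral_of_continuous' hFs _ _)
    (fun X => by simp only [hPp]) (fun X => by simp only [hFp]) ?_ a b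
  · rw [intervalIntegral.integral_sub ((hPc t).intervalIntegrable _ _)
      ((hPc 0).intervalIntegrable _ _)] at this
    rw [intervalIntegral.integral_sub ((hFc b).intervalIntegrable _ _)
      ((hFc a).intervalIntegrable _ _)]
    linarith
  · intro χ hχ hχp
    have hχ' : Continuous (deriv χ) := hχ.continuous_deriv le_rfl
    have hχc : Continuous χ := hχ.continuous
    have hw := hweak χ hχ hχp
    have e : ∀ X, χ X * (P X t - P X 0) = χ X * P X t - χ X * P X 0 := fun X => by ring
    simp only [e]
    have hcP : ∀ t, Continuous fun X => χ X * P X t := fun t => hχc.mul (hPc t)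
    rw [intervalIntegral.integral_sub ((hcP t).intervalIntegrable _ _)
      ((hcP 0).intervalIntegrable _ _), hw, sub_sub_cancel_left]
    congr 1
    rw [intervalIntegral_intervalIntegral_swap]
    · refine intervalIntegral.integral_congr fun X _ => ?_
      rw [intervalIntegral.integral_const_mul]
    · have hc : Continuous (Function.uncurry fun s X => deriv χ X * F X s) :=
        (hχ'.comp continuous_snd).mul hswapc
      refine (hc.continuousOn.integrableOn_compact
        (isCompact_uIcc.prod isCompact_uIcc :
          IsCompact (uIcc 0 t ×ˢ uIcc 0 (2 * Real.pi)))).mono_set ?_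
      exact prod_mono uIoc_subset_uIcc uIoc_subset_uIcc

/-! ### Lattice cells and the interpolated fields -/

theorem eps_pos {N : ℕ} (hN : 1 ≤ N) : 0 < eps N :=
  div_pos Real.two_pi_pos (by exact_mod_cast hN)

theorem natCast_mul_eps {N : ℕ} (hN : 1 ≤ N) : N * eps N = 2 * Real.pi := by
  have : (N : ℝ) ≠ 0 := by exact_mod_cast (Nat.one_le_iff_ne_zero.1 hN)
  unfold eps
  field_simp

theorem tendsto_eps : Tendsto eps atTop (𝓝 0) :=
  tendsto_const_nhds.div_atTop tendsto_natCast_atTop_atTop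

/-- The index of the lattice cell containing `X`. -/
noncomputable def cellIndex (N : ℕ) (X : ℝ) : ℤ := ⌊X / eps N⌋

theorem measurable_cellIndex (N : ℕ) : Measurable (cellIndex N) :=
  Int.measurable_floor.comp (measurable_id.div_const _)

theorem mem_Ico_iff_cellIndex_eq {N : ℕ} (hN : 1 ≤ N) (X : ℝ) (i : ℤ) :
    X ∈ Ico (i * eps N) ((i + 1) * eps N) ↔ cellIndex N X = i := by
  unfold cellIndex
  rw [Int.floor_eq_iff, le_div_iff₀ (eps_pos hN), div_lt_iff₀ (eps_pos hN)]
  rfl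

theorem mem_cell_iff {N : ℕ} (hN : 1 ≤ N) (X : ℝ) (i : ℕ) :
    X ∈ cell N i ↔ cellIndex N X = i := by
  rw [← mem_Ico_iff_cellIndex_eq hN]
  simp [cell]

theorem exists_mem_cell {N : ℕ} (hN : 1 ≤ N) {X : ℝ} (hX : X ∈ circleDomain) :
    ∃ i ∈ Finset.range N, X ∈ cell N i := by
  have h0 : 0 ≤ cellIndex N X := Int.floor_nonneg.2 (div_nonneg hX.1 (eps_pos hN).le)
  obtain ⟨i, hi⟩ := Int.eq_ofNat_of_zero_le h0
  refine ⟨i, ?_, (mem_cell_iff hN X i).2 hi⟩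
  have h1 := ((mem_cell_iff hN X i).2 hi).1
  rw [Finset.mem_range]
  by_contra hge
  have : (N : ℝ) * eps N ≤ i * eps N :=
    mul_le_mul_of_nonneg_right (by exact_mod_cast not_lt.1 hge) (eps_pos hN).le
  rw [natCast_mul_eps hN] at this
  linarith [hX.2]

theorem cell_subset_circleDomain {N : ℕ} (hN : 1 ≤ N) {i : ℕ} (hi : i < N) :
    cell N i ⊆ circleDomain := by
  intro X hX
  have hε := eps_pos hN
  refine ⟨le_trans (by positivity) hX.1, hX.2.trans_le ?_⟩
  rw [← natCast_mul_eps hN]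
  exact mul_le_mul_of_nonneg_right (by exact_mod_cast hi) hε.le

theorem circleDomain_eq_biUnion {N : ℕ} (hN : 1 ≤ N) :
    circleDomain = ⋃ i ∈ Finset.range N, cell N i := by
  ext X
  simp only [mem_iUnion]
  constructor
  · intro hX
    obtain ⟨i, hi, h⟩ := exists_mem_cell hN hX
    exact ⟨i, hi, h⟩
  · rintro ⟨i, hi, h⟩
    exact cell_subset_circleDomain hN (Finset.mem_range.1 hi) h

theorem pairwiseDisjoint_cell {N : ℕ} (hN : 1 ≤ N) (s : Set ℕ) : s.PairwiseDisjoint (cell N) := by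
  intro i _ j _ hij
  refine Set.disjoint_left.2 fun X hi hj => hij ?_
  rw [mem_cell_iff hN] at hi hj
  exact_mod_cast hi.symm.trans hj

theorem measurableSet_cell (N i : ℕ) : MeasurableSet (cell N i) := measurableSet_Ico

theorem volume_cell {N : ℕ} (i : ℕ) : volume (cell N i) = ENNReal.ofReal (eps N) := by
  unfold cell
  rw [Real.volume_Ico]
  congr 1
  ring

theorem measurableSet_circleDomain : MeasurableSet circleDomain := measurableSet_Ico

theorem lintegral_comp_cellIndex {N : ℕ} (hN : 1 ≤ N) (G : ℤ → ENNReal) :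
    ∫⁻ X in circleDomain, G (cellIndex N X) =
      ∑ i ∈ Finset.range N, ENNReal.ofReal (eps N) * G i := by
  rw [circleDomain_eq_biUnion hN,
    lintegral_biUnion_finset (pairwiseDisjoint_cell hN _) fun i _ => measurableSet_cell N i]
  refine Finset.sum_congr rfl fun i _ => ?_
  rw [setLIntegral_congr_fun (measurableSet_cell N i)
    (g := fun _ => G i) (fun X hX => by simp only [(mem_cell_iff hN X i).1 hX])]
  rw [setLIntegral_const, volume_cell, mul_comm]

theorem integral_circleDomain_eq_sum {N : ℕ} (hN : 1 ≤ N) {f : ℝ → ℝ}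
    (hf : IntegrableOn f circleDomain) :
    ∫ X in circleDomain, f X = ∑ i ∈ Finset.range N, ∫ X in cell N i, f X := by
  have hfi : ∀ i ∈ Finset.range N, IntegrableOn f (cell N i) := fun i hi =>
    hf.mono_set (cell_subset_circleDomain hN (Finset.mem_range.1 hi))
  rw [← integral_biUnion_finset _ (fun i _ => measurableSet_cell N i)
    (pairwiseDisjoint_cell hN _) hfi, ← circleDomain_eq_biUnion hN]

theorem integral_comp_cellIndex {N : ℕ} (hN : 1 ≤ N) (G : ℤ → ℝ) :
    IntegrableOn (fun X => G (cellIndex N X)) circleDomain ∧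
    ∫ X in circleDomain, G (cellIndex N X) = ∑ i ∈ Finset.range N, eps N * G i := by
  have hcell : ∀ i : ℕ, IntegrableOn (fun X => G (cellIndex N X)) (cell N i) := fun i => by
    refine IntegrableOn.congr_fun (f := fun _ => G i) ?_ (fun X hX => ?_) (measurableSet_cell N i)
    · exact integrableOn_const (by rw [volume_cell]; exact ENNReal.ofReal_ne_top)
    · simp only [(mem_cell_iff hN X i).1 hX]
  have hint : IntegrableOn (fun X => G (cellIndex N X)) circleDomain := by
    rw [circleDomain_eq_biUnion hN, integrableOn_finset_iUnion]
    exact fun i _ => hcell i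
  refine ⟨hint, ?_⟩
  rw [integral_circleDomain_eq_sum hN hint]
  refine Finset.sum_congr rfl fun i _ => ?_
  rw [setIntegral_congr_fun (measurableSet_cell N i)
    (g := fun _ => G i) (fun X hX => by simp only [(mem_cell_iff hN X i).1 hX]),
    setIntegral_const, measureReal_def, volume_cell,
    ENNReal.toReal_ofReal (eps_pos hN).le, smul_eq_mul]

theorem sum_indicator_cell {N : ℕ} (hN : 1 ≤ N) {X : ℝ} (hX : X ∈ circleDomain)
    (g : ℕ → ℝ → ℝ) {j : ℕ} (hj : X ∈ cell N j) :
    ∑ i ∈ Finset.range N, (cell N i).indicator (g i) X = g j X := by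
  obtain ⟨k, hk, hXk⟩ := exists_mem_cell hN hX
  have hkj : k = j := by
    rw [mem_cell_iff hN] at hj hXk
    exact_mod_cast hXk.symm.trans hj
  subst hkj
  rw [Finset.sum_eq_single_of_mem k hk, indicator_of_mem hj]
  intro i _ hik
  refine indicator_of_notMem (fun hXi => hik ?_) _
  rw [mem_cell_iff hN] at hXi hXk
  exact_mod_cast hXi.symm.trans hXk

theorem vInterp_eq {N : ℕ} (hN : 1 ≤ N) (v : ℤ → ℝ → ℝ) (t : ℝ) {X : ℝ} (hX : X ∈ circleDomain) :
    vInterp N v t X = v (cellIndex N X) t := by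
  obtain ⟨i, -, hXi⟩ := exists_mem_cell hN hX
  unfold vInterp
  rw [sum_indicator_cell hN hX (fun i _ => v i t) hXi, (mem_cell_iff hN X i).1 hXi]

/-- The strain `(x_{i+1} - x_i)/ε` of the `i`-th bond. -/
noncomputable def strain (N : ℕ) (x : ℤ → ℝ → ℝ) (i : ℤ) (t : ℝ) : ℝ :=
  (x (i + 1) t - x i t) / eps N

/-- Off the nodes the interpolant coincides near X with a single affine piece, whose slope is the
bond strain. At a node no such neighbourhood is available, hence the exclusion of a null set. -/
theorem uInterp_eq {N : ℕ} (hN : 1 ≤ N) (x : ℤ → ℝ → ℝ) (t : ℝ) {X : ℝ} (hX : X ∈ circleDomain)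
    (hnode : ∀ i : ℤ, X ≠ i * eps N) :
    uInterp N x t X = strain N x (cellIndex N X) t := by
  obtain ⟨i, hi, hXi⟩ := exists_mem_cell hN hX
  have hev : yInterp N x t =ᶠ[𝓝 X]
      fun X => x i t + 1 / eps N * (X - i * eps N) * (x (i + 1) t - x i t) := by
    have hlt : (i : ℝ) * eps N < X := lt_of_le_of_ne hXi.1 (by simpa using (hnode i).symm)
    filter_upwards [Ioo_mem_nhds hlt hXi.2] with Y hY
    have hYi : Y ∈ cell N i := ⟨hY.1.le, hY.2⟩
    exact sum_indicator_cell hN (cell_subset_circleDomain hN (Finset.mem_range.1 hi) hYi)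
      (fun i X => x i t + 1 / eps N * (X - i * eps N) * (x (i + 1) t - x i t)) hYi
  have hd : HasDerivAt
      (fun X => x i t + 1 / eps N * (X - i * eps N) * (x (i + 1) t - x i t))
      (1 / eps N * 1 * (x (i + 1) t - x i t)) X :=
    ((((hasDerivAt_id X).sub_const _).const_mul _).mul_const _).const_add _
  unfold uInterp strain
  rw [hev.deriv_eq, hd.deriv, (mem_cell_iff hN X i).1 hXi]
  ring

theorem ae_ne_node (N : ℕ) : ∀ᵐ X : ℝ, ∀ i : ℤ, X ≠ i * eps N :=
  ae_all_iff.2 fun _ => Measure.ae_ne volume _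

/-! ### Cell averages of periodic Lipschitz fields -/

/-- The average of `f` over the `i`-th cell. -/
noncomputable def cellAverage (N : ℕ) (f : ℝ → ℝ) (i : ℤ) : ℝ :=
  (eps N)⁻¹ * ∫ Y in (i * eps N)..((i + 1) * eps N), f Y

theorem abs_cellAverage_sub_le {N : ℕ} (hN : 1 ≤ N) {f g : ℝ → ℝ} (hf : Continuous f)
    (hg : Continuous g) (i : ℤ) {δ : ℝ}
    (h : ∀ Y ∈ Icc (i * eps N) ((i + 1) * eps N), |f Y - g Y| ≤ δ) :
    |cellAverage N f i - cellAverage N g i| ≤ δ := by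
  have hε := eps_pos hN
  have hle : i * eps N ≤ (i + 1) * eps N := by nlinarith
  unfold cellAverage
  rw [← mul_sub, ← intervalIntegral.integral_sub (hf.intervalIntegrable _ _)
    (hg.intervalIntegrable _ _), abs_mul, abs_of_pos (inv_pos.2 hε), inv_mul_le_iff₀ hε]
  have := intervalIntegral.norm_integral_le_of_norm_le_const (a := i * eps N)
    (b := (i + 1) * eps N) (C := δ) (f := fun Y => f Y - g Y) (fun Y hY => by
      rw [uIoc_of_le hle] at hY
      exact h Y (Ioc_subset_Icc_self hY))
  refine this.trans (le_of_eq ?_)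
  rw [abs_of_nonneg (by linarith)]
  ring

/-- An affine function averages to its midpoint value. Adjacent averages therefore differ by exactly
βε, as adjacent nodal values do, which is why `secondDiff` annihilates affine functions. -/
theorem cellAverage_affine {N : ℕ} (hN : 1 ≤ N) (α β X : ℝ) (i : ℤ) :
    cellAverage N (fun Y => α + β * (Y - X)) i = α + β * ((i + 1 / 2) * eps N - X) := by
  have hε := (eps_pos hN).ne'
  unfold cellAverage
  rw [intervalIntegral.integral_add (by simp) (by
    exact (by fun_prop : Continuous fun Y => β * (Y - X)).intervalIntegrable _ _),
    intervalIntegral.integral_const_mul, intervalIntegral.integral_sub (by simp) (by simp)]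
  simp only [intervalIntegral.integral_const, integral_id, smul_eq_mul]
  field_simp
  ring

theorem cellAverage_const {N : ℕ} (hN : 1 ≤ N) (α : ℝ) (i : ℤ) :
    cellAverage N (fun _ => α) i = α := by
  simpa using cellAverage_affine hN α 0 0 i

theorem abs_cellAverage_sub_const_le {N : ℕ} (hN : 1 ≤ N) {f : ℝ → ℝ} (hf : Continuous f)
    (i : ℤ) {c δ : ℝ} (h : ∀ Y ∈ Icc (i * eps N) ((i + 1) * eps N), |f Y - c| ≤ δ) :
    |cellAverage N f i - c| ≤ δ := by
  have := abs_cellAverage_sub_le hN hf (continuous_const (y := c)) i h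
  rwa [cellAverage_const hN] at this

/-- A `2π`-periodic function of `X`, depending on a parameter `t`, that is jointly continuous,
bounded by `B` and `L`-Lipschitz in `X`. -/
structure PeriodicLipschitz (L B : ℝ) (U : ℝ → ℝ → ℝ) : Prop where
  continuous : Continuous fun z : ℝ × ℝ => U z.1 z.2
  lipschitz : ∀ X Y t, |U X t - U Y t| ≤ L * |X - Y|
  periodic : ∀ X t, U (X + 2 * Real.pi) t = U X t
  bound : ∀ X t, |U X t| ≤ B

namespace PeriodicLipschitz

variable {L B : ℝ} {U : ℝ → ℝ → ℝ}

theorem nonneg_lipschitz (hU : PeriodicLipschitz L B U) : 0 ≤ L := by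
  have := (abs_nonneg _).trans (hU.lipschitz 1 0 0)
  simpa using this

theorem continuous_left (hU : PeriodicLipschitz L B U) (t : ℝ) : Continuous fun X => U X t :=
  hU.continuous.comp (Continuous.prodMk_left t)

theorem continuous_right (hU : PeriodicLipschitz L B U) (X : ℝ) : Continuous fun t => U X t :=
  hU.continuous.comp (Continuous.prodMk_right X)

theorem continuous_cellAverage (hU : PeriodicLipschitz L B U) (N : ℕ) (i : ℤ) :
    Continuous fun t => cellAverage N (fun X => U X t) i := by
  have : Continuous (Function.uncurry fun t X => U X t) := hU.continuous.comp continuous_swap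
  exact continuous_const.mul
    (intervalIntegral.continuous_parametric_intervalIntegral_of_continuous' this _ _)

theorem abs_cellAverage_le (hU : PeriodicLipschitz L B U) {N : ℕ} (hN : 1 ≤ N) (i : ℤ) (t : ℝ) :
    |cellAverage N (fun X => U X t) i| ≤ B := by
  simpa using abs_cellAverage_sub_const_le (c := 0) hN (hU.continuous_left t) i
    (fun Y _ => by simpa using hU.bound Y t)

theorem abs_cellAverage_sub_le (hU : PeriodicLipschitz L B U) {N : ℕ} (hN : 1 ≤ N) (i : ℤ) (t : ℝ)
    {X : ℝ} (hX : X ∈ Icc (i * eps N) ((i + 1) * eps N)) :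
    |cellAverage N (fun X => U X t) i - U X t| ≤ L * eps N := by
  refine abs_cellAverage_sub_const_le hN (hU.continuous_left t) i fun Y hY => ?_
  refine (hU.lipschitz Y X t).trans (mul_le_mul_of_nonneg_left ?_ hU.nonneg_lipschitz)
  rw [abs_le]
  constructor <;> linarith [hX.1, hX.2, hY.1, hY.2]

theorem abs_cellAverage_add_one_sub_le (hU : PeriodicLipschitz L B U) {N : ℕ} (hN : 1 ≤ N) (i : ℤ)
    (t : ℝ) :
    |cellAverage N (fun X => U X t) (i + 1) - cellAverage N (fun X => U X t) i| ≤
      2 * L * eps N := by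
  have hε := eps_pos hN
  -- Both averages are compared with the value at the node (i + 1)ε shared by the two cells.
  have h1 := hU.abs_cellAverage_sub_le hN (i + 1) t (X := (i + 1) * eps N)
    (by push_cast; constructor <;> nlinarith)
  have h2 := hU.abs_cellAverage_sub_le hN i t (X := (i + 1) * eps N) (by constructor <;> nlinarith)
  rw [abs_le] at *
  constructor <;> linarith [h1.1, h1.2, h2.1, h2.2]

theorem abs_node_sub_le (hU : PeriodicLipschitz L B U) {N : ℕ} (hN : 1 ≤ N) (i : ℤ) (t : ℝ) :
    |U ((i + 1) * eps N) t - U (i * eps N) t| ≤ L * eps N := by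
  have hε := eps_pos hN
  refine (hU.lipschitz _ _ t).trans (le_of_eq ?_)
  rw [← sub_mul, add_sub_cancel_left, one_mul, abs_of_pos hε]

theorem node_add_period (hU : PeriodicLipschitz L B U) {N : ℕ} (hN : 1 ≤ N) (i : ℤ) (t : ℝ) :
    U ((i + N : ℤ) * eps N) t = U (i * eps N) t := by
  push_cast
  rw [add_mul, natCast_mul_eps hN, hU.periodic]

theorem cellAverage_add_period (hU : PeriodicLipschitz L B U) {N : ℕ} (hN : 1 ≤ N) (i : ℤ)
    (t : ℝ) : cellAverage N (fun X => U X t) (i + N) = cellAverage N (fun X => U X t) i := by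
  unfold cellAverage
  congr 1
  have e1 : ((i + N : ℤ) : ℝ) * eps N = i * eps N + 2 * Real.pi := by
    rw [← natCast_mul_eps hN]; push_cast; ring
  have e2 : (((i + N : ℤ) : ℝ) + 1) * eps N = (i + 1) * eps N + 2 * Real.pi := by
    rw [← natCast_mul_eps hN]; push_cast; ring
  rw [e1, e2, ← intervalIntegral.integral_comp_add_right (fun X => U X t)]
  simp only [hU.periodic]

end PeriodicLipschitz

/-! ### Second-order differences and their vanishing mean -/

/-- The second-order difference that compares the increments of nodal values and of averages. -/
noncomputable def secondDiff (N : ℕ) (k : ℤ) (f : ℝ → ℝ) (i : ℤ) : ℝ :=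
  (f ((i + 1) * eps N) - f (i * eps N) - (cellAverage N f (i + k) - cellAverage N f (i + k - 1)))
    / eps N

/-- The second difference of the affine part is zero, so only the deviations of two nodal values and
two averages remain. Each is at most δ(|k| + 2)ε because the whole stencil lies within (|k| + 2)ε of
X. -/
theorem abs_secondDiff_le_of_affine {N : ℕ} (hN : 1 ≤ N) (k : ℤ) {f : ℝ → ℝ} (hf : Continuous f)
    {X α β δ : ℝ} (hδ : 0 ≤ δ)
    (h : ∀ Y, |Y - X| ≤ (|(k : ℝ)| + 2) * eps N → |f Y - (α + β * (Y - X))| ≤ δ * |Y - X|) :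
    |secondDiff N k f (cellIndex N X)| ≤ 4 * (δ * (|(k : ℝ)| + 2)) := by
  have hε := eps_pos hN
  set i := cellIndex N X with hi
  have hXi := (mem_Ico_iff_cellIndex_eq hN X i).2 hi.symm
  have hk0 := abs_nonneg (k : ℝ)
  have hk1 := le_abs_self (k : ℝ)
  have hk2 := neg_abs_le (k : ℝ)
  have hk3 : |(k : ℝ)| * eps N ≥ k * eps N := mul_le_mul_of_nonneg_right hk1 hε.le
  have hk4 : -|(k : ℝ)| * eps N ≤ k * eps N := mul_le_mul_of_nonneg_right hk2 hε.le
  have hk5 : 0 ≤ |(k : ℝ)| * eps N := by positivity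
  have hclose : ∀ Y, |Y - X| ≤ (|(k : ℝ)| + 2) * eps N →
      |f Y - (α + β * (Y - X))| ≤ δ * (|(k : ℝ)| + 2) * eps N := fun Y hY => by
    refine (h Y hY).trans ?_
    rw [mul_assoc]
    exact mul_le_mul_of_nonneg_left hY hδ
  have hlin : Continuous fun Y => α + β * (Y - X) := by fun_prop
  have h1 := hclose ((i + 1) * eps N) (by rw [abs_le]; constructor <;> linarith [hXi.1, hXi.2])
  have h2 := hclose (i * eps N) (by rw [abs_le]; constructor <;> linarith [hXi.1, hXi.2])
  have h3 := abs_cellAverage_sub_le hN hf hlin (i + k) (δ := δ * (|(k : ℝ)| + 2) * eps N)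
    (fun Y hY => hclose Y (by
      have := hY.1; have := hY.2; push_cast at *
      rw [abs_le]; constructor <;> linarith [hXi.1, hXi.2]))
  have h4 := abs_cellAverage_sub_le hN hf hlin (i + k - 1) (δ := δ * (|(k : ℝ)| + 2) * eps N)
    (fun Y hY => hclose Y (by
      have := hY.1; have := hY.2; push_cast at *
      rw [abs_le]; constructor <;> linarith [hXi.1, hXi.2]))
  rw [cellAverage_affine hN] at h3 h4
  unfold secondDiff
  rw [abs_div, abs_of_pos hε, div_le_iff₀ hε]
  push_cast at h3 h4
  rw [abs_le] at *
  constructor <;> linarith [h1.1, h1.2, h2.1, h2.2, h3.1, h3.2, h4.1, h4.2]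

/-- Differentiability at X is precisely an affine approximation with error δ|Y − X| near X, and the
stencil shrinks to X as ε → 0. -/
theorem tendsto_secondDiff {f : ℝ → ℝ} (hf : Continuous f) (k : ℤ) {X : ℝ}
    (hX : DifferentiableAt ℝ f X) :
    Tendsto (fun N => secondDiff N k f (cellIndex N X)) atTop (𝓝 0) := by
  rw [Metric.tendsto_nhds]
  intro η hη
  set δ : ℝ := η / (8 * (|(k : ℝ)| + 2)) with hδ
  have hK : 0 < |(k : ℝ)| + 2 := by positivity
  have hδ0 : 0 < δ := by positivity
  have hlo := (hasDerivAt_iff_isLittleO.1 hX.hasDerivAt).def hδ0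
  obtain ⟨r, hr, hball⟩ := Metric.eventually_nhds_iff.1 hlo
  have hsmall : ∀ᶠ N in atTop, (|(k : ℝ)| + 2) * eps N < r := by
    have := tendsto_eps.const_mul (|(k : ℝ)| + 2)
    rw [mul_zero] at this
    exact this.eventually (gt_mem_nhds hr)
  filter_upwards [hsmall, eventually_ge_atTop 1] with N hN hN1
  have := abs_secondDiff_le_of_affine hN1 k hf (X := X) (α := f X) (β := deriv f X) hδ0.le
    (fun Y hY => by
      have := hball (y := Y) (by rw [Real.dist_eq]; linarith)
      simp only [Real.norm_eq_abs, smul_eq_mul] at this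
      rwa [sub_sub, mul_comm (Y - X)] at this)
  rw [Real.dist_eq, sub_zero]
  refine this.trans_lt ?_
  rw [hδ]
  field_simp
  linarith

/-- The mean size of the second-order differences of `f`. -/
noncomputable def secondDiffSum (N : ℕ) (k : ℤ) (f : ℝ → ℝ) : ℝ :=
  ∑ i ∈ Finset.range N, eps N * |secondDiff N k f i|

namespace PeriodicLipschitz

variable {L B : ℝ} {U : ℝ → ℝ → ℝ}

/-- The nodal increment contributes L and the increment of averages 2L. This uniform bound is the
dominating constant in the limits below. -/
theorem abs_secondDiff_le (hU : PeriodicLipschitz L B U) {N : ℕ} (hN : 1 ≤ N) (k i : ℤ) (t : ℝ) :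
    |secondDiff N k (fun X => U X t) i| ≤ 3 * L := by
  have h1 := hU.abs_node_sub_le hN i t
  have h2 := hU.abs_cellAverage_add_one_sub_le hN (i + k - 1) t
  rw [sub_add_cancel] at h2
  unfold secondDiff
  rw [abs_div, abs_of_pos (eps_pos hN), div_le_iff₀ (eps_pos hN)]
  rw [abs_le] at *
  constructor <;> linarith [h1.1, h1.2, h2.1, h2.2]

theorem continuous_secondDiffSum (hU : PeriodicLipschitz L B U) (N : ℕ) (k : ℤ) :
    Continuous fun t => secondDiffSum N k (fun X => U X t) := by
  unfold secondDiffSum secondDiff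
  have h1 := hU.continuous_right
  have h2 := hU.continuous_cellAverage N
  exact continuous_finsetSum _ fun i _ => continuous_const.mul
    ((((h1 _).sub (h1 _)).sub ((h2 _).sub (h2 _))).div_const _).abs

theorem secondDiffSum_nonneg {N : ℕ} (hN : 1 ≤ N) (k : ℤ) (f : ℝ → ℝ) :
    0 ≤ secondDiffSum N k f :=
  Finset.sum_nonneg fun _ _ => mul_nonneg (eps_pos hN).le (abs_nonneg _)

theorem secondDiffSum_le (hU : PeriodicLipschitz L B U) {N : ℕ} (hN : 1 ≤ N) (k : ℤ) (t : ℝ) :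
    secondDiffSum N k (fun X => U X t) ≤ 2 * Real.pi * (3 * L) := by
  unfold secondDiffSum
  refine (Finset.sum_le_sum fun i _ =>
    mul_le_mul_of_nonneg_left (hU.abs_secondDiff_le hN k (i : ℕ) t) (eps_pos hN).le).trans (le_of_eq ?_)
  rw [Finset.sum_const, Finset.card_range, nsmul_eq_mul, ← mul_assoc, natCast_mul_eps hN]

/-- The sum is the integral over the circle of a function constant on cells. By Rademacher's theorem
the integrand tends to zero almost everywhere, and it is dominated by 3L. -/
theorem tendsto_secondDiffSum (hU : PeriodicLipschitz L B U) (k : ℤ) (t : ℝ) :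
    Tendsto (fun N => secondDiffSum N k (fun X => U X t)) atTop (𝓝 0) := by
  have hlip : LipschitzWith L.toNNReal fun X => U X t := by
    refine LipschitzWith.of_dist_le_mul fun X Y => ?_
    rw [Real.dist_eq, Real.dist_eq, Real.coe_toNNReal _ hU.nonneg_lipschitz]
    exact hU.lipschitz X Y t
  have hae : ∀ᵐ X : ℝ, DifferentiableAt ℝ (fun X => U X t) X := hlip.ae_differentiableAt
  -- The index is shifted by one so that the spacing is positive for every term.
  have hlim : Tendsto (fun N => ∫ X in circleDomain,
      |secondDiff (N + 1) k (fun X => U X t) (cellIndex (N + 1) X)|) atTop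
      (𝓝 (∫ _ in circleDomain, (0 : ℝ))) := by
    refine tendsto_integral_of_dominated_convergence (fun _ => 3 * L) (fun N => ?_) ?_ (fun N => ?_)
      ?_
    · exact ((measurable_from_top (f := fun i : ℤ =>
        |secondDiff (N + 1) k (fun X => U X t) i|)).comp
          (measurable_cellIndex (N + 1))).aestronglyMeasurable
    · refine integrableOn_const ?_
      rw [circleDomain, Real.volume_Ico]
      exact ENNReal.ofReal_ne_top
    · refine Eventually.of_forall fun X => ?_
      rw [Real.norm_eq_abs, abs_abs]
      exact hU.abs_secondDiff_le (by omega) k _ t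
    · filter_upwards [ae_restrict_of_ae hae] with X hX
      have := ((tendsto_secondDiff (hU.continuous_left t) k hX).comp (tendsto_add_atTop_nat 1)).abs
      simpa using this
  rw [integral_zero] at hlim
  rw [← tendsto_add_atTop_iff_nat 1]
  refine hlim.congr fun N => ?_
  exact (integral_comp_cellIndex (by omega)
    (fun i => |secondDiff (N + 1) k (fun X => U X t) i|)).2

theorem tendsto_integral_secondDiffSum (hU : PeriodicLipschitz L B U) (k : ℤ) (T : ℝ) :
    Tendsto (fun N => ∫ t in 0..T, secondDiffSum N k (fun X => U X t)) atTop (𝓝 0) := by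
  have : Tendsto (fun N => ∫ t in 0..T, secondDiffSum N k (fun X => U X t)) atTop
      (𝓝 (∫ _ in 0..T, (0 : ℝ))) := by
    refine intervalIntegral.tendsto_integral_filter_of_dominated_convergence
      (fun _ => 2 * Real.pi * (3 * L)) ?_ ?_ (by simp) ?_
    · exact Eventually.of_forall fun N =>
        (hU.continuous_secondDiffSum N k).aestronglyMeasurable
    · filter_upwards [eventually_ge_atTop 1] with N hN
      refine Eventually.of_forall fun t _ => ?_
      rw [Real.norm_eq_abs, abs_of_nonneg (secondDiffSum_nonneg hN k _)]
      exact hU.secondDiffSum_le hN k t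
    · exact Eventually.of_forall fun t _ => hU.tendsto_secondDiffSum k t
  simpa using this

end PeriodicLipschitz

/-! ### The balance of relative energy -/

theorem sum_range_sub_shift_eq_zero {N : ℕ} {G : ℤ → ℝ} (hG : ∀ i, G (i + N) = G i) :
    ∑ i ∈ Finset.range N, (G i - G (i - 1)) = 0 := by
  have h := Finset.sum_range_sub (fun n : ℕ => G ((n : ℤ) - 1)) N
  have e : ∀ n : ℕ, G (((n + 1 : ℕ) : ℤ) - 1) = G n := fun n => by
    congr 1; push_cast; ring
  simp only [e] at h
  rw [h]
  have := hG (-1)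
  rw [show (-1 : ℤ) + N = (N : ℤ) - 1 by ring] at this
  simp [this]

/-- The summation by parts behind the balance of relative energy. -/
theorem sum_relEnergy_balance {N : ℕ} {v b σ s α w r : ℤ → ℝ} (hv : ∀ i, v (i + N) = v i)
    (hb : ∀ i, b (i + N) = b i) (hσ : ∀ i, σ (i + N) = σ i) (hs : ∀ i, s (i + N) = s i)
    (hα : ∀ i, α (i + N) = α i) :
    ∑ i ∈ Finset.range N, ((v i - b i) * ((σ i - σ (i - 1)) - (s i - s (i - 1)))
      + (σ i - α i) * (v (i + 1) - v i) - w i * (r (i + 1) - r i)) =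
    ∑ i ∈ Finset.range N, ((b (i + 1) - b i) * (σ i - α i - w i) + (b (i + 1) - b i) * (α i - s i)
      + w i * ((b (i + 1) - b i) - (r (i + 1) - r i))
      - v i * ((s i - α i) - (s (i - 1) - α (i - 1)))) := by
  -- The two sides differ termwise by G_i − G_{i−1}. The first part of G moves the difference from
  -- the stress onto v − b; the second moves it from v onto s − α.
  have hG := sum_range_sub_shift_eq_zero (N := N)
    (G := fun i => (v (i + 1) - b (i + 1)) * (σ i - s i) + v (i + 1) * (s i - α i)) (fun i => by
      simp only [add_right_comm i (N : ℤ) 1, hv, hb, hσ, hs, hα])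
  rw [← sub_eq_zero, ← Finset.sum_sub_distrib, ← hG]
  refine Finset.sum_congr rfl fun i _ => ?_
  simp only [sub_add_cancel]
  ring

/-- A pair of periodic Lipschitz fields satisfying the integral form of the continuum equations. -/
structure IsIntegralSolution (W : ℝ → ℝ) (ρ T L B : ℝ) (U V : ℝ → ℝ → ℝ) : Prop where
  strain_field : PeriodicLipschitz L B U
  velocity_field : PeriodicLipschitz L B V
  compatibility : ∀ a b, ∀ t ∈ Icc 0 T,
    ∫ X in a..b, U X t = (∫ X in a..b, U X 0) + ∫ s in 0..t, (V b s - V a s)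
  momentum : ∀ a b, ∀ t ∈ Icc 0 T,
    ∫ X in a..b, ρ * V X t = (∫ X in a..b, ρ * V X 0)
      + ∫ s in 0..t, (deriv W (U b s) - deriv W (U a s))

namespace IsIntegralSolution

variable {W : ℝ → ℝ} {ρ T L B : ℝ} {U V : ℝ → ℝ → ℝ}

/-- The integral form over one cell writes the average as a constant plus a time integral of a
continuous flux difference. It is therefore differentiable at every time, although the Lipschitz
field itself need not be. -/
theorem hasDerivWithinAt_cellAverage_strain (h : IsIntegralSolution W ρ T L B U V) (N : ℕ) (i : ℤ)
    {t : ℝ} (ht : t ∈ Icc 0 T) :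
    HasDerivWithinAt (fun t => cellAverage N (fun X => U X t) i)
      ((V ((i + 1) * eps N) t - V (i * eps N) t) / eps N) (Icc 0 T) t := by
  have hc : Continuous fun s => V ((i + 1) * eps N) s - V (i * eps N) s :=
    (h.velocity_field.continuous_right _).sub (h.velocity_field.continuous_right _)
  have hd := ((hasDerivAt_integral_of_continuous hc 0 t).const_add
    (∫ X in (i * eps N)..((i + 1) * eps N), U X 0)).const_mul (eps N)⁻¹
  rw [← div_eq_inv_mul] at hd
  refine hd.hasDerivWithinAt.congr (fun s hs => ?_) ?_
  · rw [cellAverage, h.compatibility _ _ s hs]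
  · rw [cellAverage, h.compatibility _ _ t ht]

theorem hasDerivWithinAt_cellAverage_velocity (hρ : 0 < ρ) (hW : Continuous (deriv W))
    (h : IsIntegralSolution W ρ T L B U V) (N : ℕ) (i : ℤ)
    {t : ℝ} (ht : t ∈ Icc 0 T) :
    HasDerivWithinAt (fun t => cellAverage N (fun X => V X t) i)
      ((deriv W (U ((i + 1) * eps N) t) - deriv W (U (i * eps N) t)) / (eps N * ρ))
      (Icc 0 T) t := by
  have hc : Continuous fun s => deriv W (U ((i + 1) * eps N) s) - deriv W (U (i * eps N) s) :=
    (hW.comp (h.strain_field.continuous_right _)).sub (hW.comp (h.strain_field.continuous_right _))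
  have hd := ((hasDerivAt_integral_of_continuous hc 0 t).const_add
    (∫ X in (i * eps N)..((i + 1) * eps N), ρ * V X 0)).const_mul (eps N * ρ)⁻¹
  rw [← div_eq_inv_mul] at hd
  have e : ∀ s ∈ Icc 0 T, cellAverage N (fun X => V X s) i =
      (eps N * ρ)⁻¹ * ((∫ X in (i * eps N)..((i + 1) * eps N), ρ * V X 0)
        + ∫ s in 0..s, (deriv W (U ((i + 1) * eps N) s) - deriv W (U (i * eps N) s))) := by
    intro s hs
    rw [← h.momentum _ _ s hs, intervalIntegral.integral_const_mul, cellAverage]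
    field_simp
  exact hd.hasDerivWithinAt.congr e (e t ht)

end IsIntegralSolution

theorem strain_add_period {W : ℝ → ℝ} {ρ T : ℝ} {N : ℕ} {x v : ℤ → ℝ → ℝ}
    (h : IsLatticeSolution W ρ T N x v) (i : ℤ) {t : ℝ} (ht : t ∈ Icc 0 T) :
    strain N x (i + N) t = strain N x i t := by
  unfold strain
  rw [add_right_comm, h.quasiPeriodic _ t ht, h.quasiPeriodic _ t ht]
  ring

/-- Quasi-periodicity of the positions passes to velocities by uniqueness of one-sided derivatives
on [0, T], where T > 0 is needed. -/
theorem velocity_add_period {W : ℝ → ℝ} {ρ T : ℝ} (hT : 0 < T) {N : ℕ} {x v : ℤ → ℝ → ℝ}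
    (h : IsLatticeSolution W ρ T N x v) (i : ℤ) {t : ℝ} (ht : t ∈ Icc 0 T) :
    v (i + N) t = v i t := by
  have h1 := h.velocity (i + N) t ht
  have h2 := (h.velocity i t ht).add_const (2 * Real.pi)
  exact (uniqueDiffOn_Icc hT t ht).eq_deriv _
    (h1.congr (fun s hs => (h.quasiPeriodic i s hs).symm) (h.quasiPeriodic i t ht).symm) h2

/-- The energy of the `i`-th cell relative to the cell averages of `(U, V)`. -/
noncomputable def cellRelEnergy (W : ℝ → ℝ) (ρ : ℝ) (N : ℕ) (x v : ℤ → ℝ → ℝ) (U V : ℝ → ℝ → ℝ)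
    (i : ℤ) (t : ℝ) : ℝ :=
  ρ / 2 * (v i t - cellAverage N (fun X => V X t) i) ^ 2
    + relPotential W (strain N x i t) (cellAverage N (fun X => U X t) i)

/-- The energy of the lattice relative to the cell averages of `(U, V)`. -/
noncomputable def latticeRelEnergy (W : ℝ → ℝ) (ρ : ℝ) (N : ℕ) (x v : ℤ → ℝ → ℝ)
    (U V : ℝ → ℝ → ℝ) (t : ℝ) : ℝ :=
  ∑ i ∈ Finset.range N, eps N * cellRelEnergy W ρ N x v U V i t

/-- The terms W'(a) a' cancel, so a' enters only through W''(a)(u − a) a', the product that later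
combines with W'(u) − W'(a) into W'(u|a). -/
theorem hasDerivWithinAt_relPotential {W u a : ℝ → ℝ} {u' a' t : ℝ} {S : Set ℝ}
    (hW : Differentiable ℝ W) (hW' : Differentiable ℝ (deriv W))
    (hu : HasDerivWithinAt u u' S t) (ha : HasDerivWithinAt a a' S t) :
    HasDerivWithinAt (fun t => relPotential W (u t) (a t))
      ((deriv W (u t) - deriv W (a t)) * u' - deriv (deriv W) (a t) * (u t - a t) * a') S t := by
  have h1 := (hW (u t)).hasDerivAt.comp_hasDerivWithinAt t hu
  have h2 := (hW (a t)).hasDerivAt.comp_hasDerivWithinAt t ha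
  have h3 := (hW' (a t)).hasDerivAt.comp_hasDerivWithinAt t ha
  refine ((h1.sub h2).sub (h3.mul (hu.sub ha))).congr_deriv ?_
  simp only [Function.comp, Pi.sub_apply]
  ring

/-- The weights ε and ρ in the energy cancel the denominators in both sets of evolution equations,
leaving only undivided increments of stresses and velocities. -/
theorem hasDerivWithinAt_latticeRelEnergy {p : ℝ} {W : ℝ → ℝ} (hW : IsPotential p W)
    {ρ T L B : ℝ} (hρ : 0 < ρ) {U V : ℝ → ℝ → ℝ} (hUV : IsIntegralSolution W ρ T L B U V)
    {N : ℕ} (hN : 1 ≤ N) {x v : ℤ → ℝ → ℝ} (hlat : IsLatticeSolution W ρ T N x v)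
    {t : ℝ} (ht : t ∈ Icc 0 T) :
    HasDerivWithinAt (latticeRelEnergy W ρ N x v U V)
      (∑ i ∈ Finset.range N,
        ((v i t - cellAverage N (fun X => V X t) i)
          * ((deriv W (strain N x i t) - deriv W (strain N x (i - 1 : ℤ) t))
            - (deriv W (U ((i + 1) * eps N) t) - deriv W (U (i * eps N) t)))
        + (deriv W (strain N x i t) - deriv W (cellAverage N (fun X => U X t) i))
            * (v (i + 1) t - v i t)
        - deriv (deriv W) (cellAverage N (fun X => U X t) i)
            * (strain N x i t - cellAverage N (fun X => U X t) i)
            * (V ((i + 1) * eps N) t - V (i * eps N) t))) (Icc 0 T) t := by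
  have hε := (eps_pos hN).ne'
  have hterm : ∀ i : ℤ, HasDerivWithinAt (fun t => eps N * cellRelEnergy W ρ N x v U V i t)
      ((v i t - cellAverage N (fun X => V X t) i)
          * ((deriv W (strain N x i t) - deriv W (strain N x (i - 1 : ℤ) t))
            - (deriv W (U ((i + 1) * eps N) t) - deriv W (U (i * eps N) t)))
        + (deriv W (strain N x i t) - deriv W (cellAverage N (fun X => U X t) i))
            * (v (i + 1) t - v i t)
        - deriv (deriv W) (cellAverage N (fun X => U X t) i)
            * (strain N x i t - cellAverage N (fun X => U X t) i)
            * (V ((i + 1) * eps N) t - V (i * eps N) t)) (Icc 0 T) t := by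
    intro i
    have hv : HasDerivWithinAt (v i)
        ((eps N * ρ)⁻¹ * (deriv W (strain N x i t) - deriv W (strain N x (i - 1 : ℤ) t)))
        (Icc 0 T) t := by
      have := (hlat.motion i t ht).const_mul (eps N * ρ)⁻¹
      simp only [inv_mul_cancel_left₀ (mul_ne_zero hε hρ.ne')] at this
      refine this.congr_deriv ?_
      unfold strain
      rw [sub_add_cancel]
    have hu : HasDerivWithinAt (strain N x i) ((v (i + 1) t - v i t) / eps N) (Icc 0 T) t :=
      ((hlat.velocity (i + 1) t ht).sub (hlat.velocity i t ht)).div_const _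
    have ha := hUV.hasDerivWithinAt_cellAverage_strain N i ht
    have hb := hUV.hasDerivWithinAt_cellAverage_velocity hρ hW.contDiff_deriv.continuous N i ht
    have hrel := hasDerivWithinAt_relPotential hW.differentiable hW.differentiable_deriv hu ha
    refine (((((hv.sub hb).pow 2).const_mul (ρ / 2)).add hrel).const_mul (eps N)).congr_deriv ?_
    simp only [Pi.sub_apply]
    field_simp
    ring
  exact HasDerivWithinAt.fun_sum fun i _ => hterm i

theorem abs_mul_le_half_sq_add (a b : ℝ) : |a * b| ≤ (a ^ 2 + b ^ 2) / 2 := by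
  rw [abs_mul, ← sq_abs a, ← sq_abs b]
  nlinarith [sq_nonneg (|a| - |b|)]

/-- All four arguments of W' lie within Lε of the nodal value U(iε, t). Expanding there, the linear
parts combine to W'' times ε · `secondDiff`, and the three remainders are O(ε²). -/
theorem abs_deriv_comp_secondDiff_le {p : ℝ} {W : ℝ → ℝ} (hW : IsPotential p W) (L B : ℝ) :
    ∃ C, 0 ≤ C ∧ ∀ U, PeriodicLipschitz L B U → ∀ N, 1 ≤ N → ∀ (i : ℤ) (t : ℝ),
      |(deriv W (U ((i + 1) * eps N) t) - deriv W (cellAverage N (fun X => U X t) i))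
        - (deriv W (U (i * eps N) t) - deriv W (cellAverage N (fun X => U X t) (i - 1)))| ≤
      C * eps N * (eps N + |secondDiff N 0 (fun X => U X t) i|) := by
  obtain ⟨M₁, hM₁, -, hM1', -⟩ :=
    exists_bound_of_contDiff_one (hW.contDiff_deriv.of_le (by norm_num)) B
  obtain ⟨M₂, hM₂, hM2⟩ := exists_taylor_bound hW.contDiff_deriv B
  refine ⟨3 * M₂ * L ^ 2 + M₁, by positivity, fun U hU N hN i t => ?_⟩
  have hε := eps_pos hN
  have htay : ∀ y, |y| ≤ B → |y - U (i * eps N) t| ≤ L * eps N →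
      |deriv W y - deriv W (U (i * eps N) t)
        - deriv (deriv W) (U (i * eps N) t) * (y - U (i * eps N) t)| ≤ M₂ * (L * eps N) ^ 2 := by
    intro y hy hyd
    refine (hM2 y _ hy (hU.bound _ _)).trans (mul_le_mul_of_nonneg_left ?_ hM₂)
    rw [← sq_abs]
    exact pow_le_pow_left₀ (abs_nonneg _) hyd 2
  have h1 := htay _ (hU.bound ((i + 1) * eps N) t) (hU.abs_node_sub_le hN i t)
  have h2 := htay _ (hU.abs_cellAverage_le hN i t)
    (hU.abs_cellAverage_sub_le hN i t (X := i * eps N) (by constructor <;> nlinarith))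
  have h3 := htay _ (hU.abs_cellAverage_le hN (i - 1) t)
    (hU.abs_cellAverage_sub_le hN (i - 1) t (X := i * eps N)
      (by push_cast; constructor <;> nlinarith))
  set S := secondDiff N 0 (fun X => U X t) i with hS
  have hSe : U ((i + 1) * eps N) t - U (i * eps N) t
      - (cellAverage N (fun X => U X t) i - cellAverage N (fun X => U X t) (i - 1)) = eps N * S := by
    rw [hS, secondDiff, add_zero]
    field_simp
  have h4 : |deriv (deriv W) (U (i * eps N) t) * (eps N * S)| ≤ M₁ * (eps N * |S|) := by
    rw [abs_mul, abs_mul, abs_of_pos hε]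
    exact mul_le_mul_of_nonneg_right (hM1' _ (hU.bound _ _)) (by positivity)
  rw [← hSe] at h4
  have h5 : 0 ≤ M₂ * L ^ 2 * eps N * |S| := by positivity
  have h6 : 0 ≤ M₁ * eps N * eps N := by positivity
  rw [abs_le] at *
  constructor <;> nlinarith [h1.1, h1.2, h2.1, h2.2, h3.1, h3.2, h4.1, h4.2]

/-- The consistency error of the lattice equations on the averaged continuum solution. -/
noncomputable def consistencyError (N : ℕ) (U V : ℝ → ℝ → ℝ) (t : ℝ) : ℝ :=
  2 * Real.pi * eps N + secondDiffSum N 0 (fun X => U X t) + secondDiffSum N 1 (fun X => V X t)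

-- After summation by parts there are four terms per cell. The term with W'(u|a) carries a factor
-- b_{i+1} − b_i = O(ε) and is absorbed by the relative energy. The others carry either ε² or ε
-- times a second difference; their products with u − a or v are split so that squares go into the
-- relative energy and the errors enter to first power.
set_option maxHeartbeats 1000000 in
theorem exists_deriv_latticeRelEnergy_le {p : ℝ} (hp : 2 ≤ p) {W : ℝ → ℝ} (hW : IsPotential p W)
    {ρ : ℝ} (hρ : 0 < ρ) (L B : ℝ) :
    ∃ C, 0 ≤ C ∧ ∀ T, 0 < T → ∀ U V, IsIntegralSolution W ρ T L B U V → ∀ N, 1 ≤ N →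
      ∀ x v, IsLatticeSolution W ρ T N x v → ∀ t ∈ Icc 0 T,
      ∃ K', HasDerivWithinAt (latticeRelEnergy W ρ N x v U V) K' (Icc 0 T) t ∧
        K' ≤ C * latticeRelEnergy W ρ N x v U V t + C * consistencyError N U V t := by
  obtain ⟨C₁, hC₁, hrel⟩ := hW.exists_relPotential_bounds hp B
  obtain ⟨c, hc, hconv⟩ := hW.exists_sq_le_relPotential
  obtain ⟨M, hM, -, hM', hMl⟩ :=
    exists_bound_of_contDiff_one (hW.contDiff_deriv.of_le (by norm_num)) B
  obtain ⟨D, hD, hDbd⟩ := abs_deriv_comp_secondDiff_le hW L B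
  -- Z is an a priori bound for the error factor D(ε + |S₀|), from ε ≤ 2π and |S₀| ≤ 3L.
  set Z : ℝ := D * (2 * Real.pi + 3 * |L|) with hZ
  set C : ℝ := 2 * |L| * C₁ + 2 * L ^ 2 * M + M * C₁ + 3 * |L| * M + 1 / ρ + (Z + |B|) * D with hC
  have hZ0 : 0 ≤ Z := by have := Real.pi_pos; positivity
  have p1 : 0 ≤ 2 * |L| * C₁ := by positivity
  have p2 : 0 ≤ 2 * L ^ 2 * M := by positivity
  have p3 : 0 ≤ M * C₁ := by positivity
  have p4 : 0 ≤ 3 * |L| * M := by positivity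
  have p5 : 0 ≤ 1 / ρ := by positivity
  have p6 : 0 ≤ (Z + |B|) * D := by positivity
  refine ⟨C, by positivity, fun T hT U V hUV N hN x v hlat t ht => ⟨_,
    hasDerivWithinAt_latticeRelEnergy hW hρ hUV hN hlat ht, ?_⟩⟩
  have hε := eps_pos hN
  have hε2 : eps N ≤ 2 * Real.pi := by
    rw [← natCast_mul_eps hN]
    exact le_mul_of_one_le_left hε.le (by exact_mod_cast hN)
  have hU := hUV.strain_field
  have hV := hUV.velocity_field
  have hL : |L| = L := abs_of_nonneg hU.nonneg_lipschitz
  have hL0 := hU.nonneg_lipschitz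
  -- The stress s_i sits at the right node (i + 1)ε of cell i, so s_i − s_{i−1} is compared with the
  -- averages of cells i and i − 1 (shift k = 0), while nodal increments of V are compared with
  -- cells i + 1 and i (shift k = 1).
  have hbal := sum_relEnergy_balance (N := N) (v := fun i => v i t)
    (b := fun i => cellAverage N (fun X => V X t) i)
    (σ := fun i => deriv W (strain N x i t))
    (s := fun i => deriv W (U ((i + 1) * eps N) t))
    (α := fun i => deriv W (cellAverage N (fun X => U X t) i))
    (w := fun i => deriv (deriv W) (cellAverage N (fun X => U X t) i)
      * (strain N x i t - cellAverage N (fun X => U X t) i))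
    (r := fun i => V (i * eps N) t)
    (fun i => velocity_add_period hT hlat i ht)
    (fun i => hV.cellAverage_add_period hN i t)
    (fun i => by simp only [strain_add_period hlat i ht])
    (fun i => by
      have := hU.node_add_period hN (i + 1) t
      push_cast at this ⊢
      rw [← this]
      ring_nf)
    (fun i => by simp only [hU.cellAverage_add_period hN i t])
  simp only [Int.cast_sub, Int.cast_one, sub_add_cancel, Int.cast_natCast, Int.cast_add] at hbal
  rw [hbal]
  have hterm : ∀ i : ℕ, ((cellAverage N (fun X => V X t) (i + 1) - cellAverage N (fun X => V X t) i)
        * (deriv W (strain N x i t) - deriv W (cellAverage N (fun X => U X t) i)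
          - deriv (deriv W) (cellAverage N (fun X => U X t) i)
            * (strain N x i t - cellAverage N (fun X => U X t) i))
      + (cellAverage N (fun X => V X t) (i + 1) - cellAverage N (fun X => V X t) i)
        * (deriv W (cellAverage N (fun X => U X t) i) - deriv W (U ((i + 1) * eps N) t))
      + deriv (deriv W) (cellAverage N (fun X => U X t) i)
            * (strain N x i t - cellAverage N (fun X => U X t) i)
        * ((cellAverage N (fun X => V X t) (i + 1) - cellAverage N (fun X => V X t) i)
          - (V ((i + 1) * eps N) t - V (i * eps N) t))
      - v i t * ((deriv W (U ((i + 1) * eps N) t) - deriv W (cellAverage N (fun X => U X t) i))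
        - (deriv W (U (i * eps N) t) - deriv W (cellAverage N (fun X => U X t) (i - 1 : ℤ))))) ≤
      C * (eps N * cellRelEnergy W ρ N x v U V i t)
        + C * (eps N * eps N + eps N * |secondDiff N 0 (fun X => U X t) i|
          + eps N * |secondDiff N 1 (fun X => V X t) i|) := by
    intro i
    set a := cellAverage N (fun X => U X t) i with ha
    set b := cellAverage N (fun X => V X t) i with hb
    set u := strain N x i t with hu
    set S₀ := secondDiff N 0 (fun X => U X t) i with hS₀
    set S₁ := secondDiff N 1 (fun X => V X t) i with hS₁
    set R := relPotential W u a with hR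
    set k := (v i t - b) ^ 2 with hk
    have hk0 : 0 ≤ k := sq_nonneg _
    have haB : |a| ≤ B := hU.abs_cellAverage_le hN i t
    have hbB : |b| ≤ B := hV.abs_cellAverage_le hN i t
    have hB : |B| = B := abs_of_nonneg ((abs_nonneg _).trans haB)
    have hB0 : 0 ≤ B := (abs_nonneg _).trans haB
    obtain ⟨r1, -, r3⟩ := hrel u a haB
    rw [← hR] at r1 r3
    have hR0 : 0 ≤ R := le_trans (by positivity) (hconv u a)
    have hb1 : |cellAverage N (fun X => V X t) (i + 1) - b| ≤ 2 * L * eps N := by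
      exact_mod_cast hV.abs_cellAverage_add_one_sub_le hN i t
    have hS₁L : |S₁| ≤ 3 * L := hV.abs_secondDiff_le hN 1 i t
    have hS₀L : |S₀| ≤ 3 * L := hU.abs_secondDiff_le hN 0 i t
    have t1 : (cellAverage N (fun X => V X t) (i + 1) - b)
        * (deriv W u - deriv W a - deriv (deriv W) a * (u - a)) ≤ eps N * (2 * |L| * C₁ * R) := by
      refine (le_abs_self _).trans ?_
      rw [abs_mul, hL]
      calc _ ≤ (2 * L * eps N) * (C₁ * R) := mul_le_mul hb1 r1 (abs_nonneg _) (by positivity)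
        _ = _ := by ring
    have t2 : (cellAverage N (fun X => V X t) (i + 1) - b)
        * (deriv W a - deriv W (U ((i + 1) * eps N) t)) ≤ eps N * (2 * L ^ 2 * M * eps N) := by
      refine (le_abs_self _).trans ?_
      rw [abs_mul]
      have h1 := hMl a (U ((i + 1) * eps N) t) haB (hU.bound _ _)
      have h2 := hU.abs_cellAverage_sub_le hN i t (X := (i + 1) * eps N)
        (by push_cast; constructor <;> nlinarith)
      calc _ ≤ (2 * L * eps N) * (M * (L * eps N)) :=
            mul_le_mul hb1 (h1.trans (mul_le_mul_of_nonneg_left h2 hM)) (abs_nonneg _)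
              (by positivity)
        _ = _ := by ring
    -- Here |u − a||S₁| is at most half the sum of squares; (u − a)² is controlled by W(u|a), and
    -- S₁² ≤ 3L|S₁| restores the first power, the one with vanishing mean.
    have t3 : deriv (deriv W) a * (u - a)
        * ((cellAverage N (fun X => V X t) (i + 1) - b)
          - (V ((i + 1) * eps N) t - V (i * eps N) t)) ≤
        eps N * (M * C₁ * R + 3 * |L| * M * |S₁|) := by
      have hSe : (cellAverage N (fun X => V X t) (i + 1) - b)
          - (V ((i + 1) * eps N) t - V (i * eps N) t) = -(eps N * S₁) := by
        rw [hS₁, secondDiff, add_sub_cancel_right, hb]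
        push_cast
        field_simp
        ring
      rw [hSe]
      refine (le_abs_self _).trans ?_
      have h1 : |u - a| * |S₁| ≤ ((u - a) ^ 2 + S₁ ^ 2) / 2 := by
        rw [← abs_mul]; exact abs_mul_le_half_sq_add _ _
      have h2 : S₁ ^ 2 ≤ 3 * L * |S₁| := by
        rw [← sq_abs, pow_two]; exact mul_le_mul_of_nonneg_right hS₁L (abs_nonneg _)
      have h3 : |u - a| * |S₁| ≤ C₁ * R + 3 * L * |S₁| := by
        have : 0 ≤ L * |S₁| := by positivity
        have : 0 ≤ C₁ * R := by positivity
        linarith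
      rw [abs_mul, abs_mul, abs_neg, abs_mul, abs_of_pos hε, hL]
      calc |deriv (deriv W) a| * |u - a| * (eps N * |S₁|)
          = eps N * (|deriv (deriv W) a| * (|u - a| * |S₁|)) := by ring
        _ ≤ eps N * (M * (C₁ * R + 3 * L * |S₁|)) := by
            refine mul_le_mul_of_nonneg_left ?_ hε.le
            exact mul_le_mul (hM' a haB) h3 (by positivity) hM
        _ = _ := by ring
    -- The velocity has no pointwise bound, so |v| ≤ |v − b| + B. The product |v − b|q gives half a
    -- square for the kinetic part of the relative energy and q² ≤ Zq for the error.
    have t4 : -(v i t * ((deriv W (U ((i + 1) * eps N) t) - deriv W a)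
        - (deriv W (U (i * eps N) t) - deriv W (cellAverage N (fun X => U X t) (i - 1 : ℤ))))) ≤
        eps N * (k / 2 + (Z + |B|) * D * (eps N + |S₀|)) := by
      have h1 := hDbd U hU N hN i t
      push_cast at h1
      set d := (deriv W (U ((i + 1) * eps N) t) - deriv W a)
        - (deriv W (U (i * eps N) t) - deriv W (cellAverage N (fun X => U X t) (i - 1 : ℤ))) with hd
      set q := D * (eps N + |S₀|) with hq
      have hq0 : 0 ≤ q := by positivity
      have hqZ : q ≤ Z := by
        rw [hq, hZ, hL]
        exact mul_le_mul_of_nonneg_left (by linarith) hD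
      have h2 : |v i t| ≤ |v i t - b| + B := by
        have := abs_sub_abs_le_abs_sub (v i t) b
        linarith
      have h3 : |v i t - b| * q ≤ (k + q ^ 2) / 2 := by
        have := abs_mul_le_half_sq_add (v i t - b) q
        rwa [abs_mul, abs_of_nonneg hq0] at this
      have h4 : q ^ 2 ≤ Z * q := by rw [pow_two]; exact mul_le_mul_of_nonneg_right hqZ hq0
      have h5 : |v i t| * q ≤ k / 2 + (Z + B) * q := by
        have := mul_le_mul_of_nonneg_right h2 hq0
        have : 0 ≤ Z * q := by positivity
        linarith
      refine (neg_le_abs _).trans ?_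
      rw [abs_mul, hB]
      calc |v i t| * |d| ≤ |v i t| * (eps N * q) := by
            refine mul_le_mul_of_nonneg_left ?_ (abs_nonneg _)
            refine h1.trans (le_of_eq ?_)
            rw [hq]; ring
        _ = eps N * (|v i t| * q) := by ring
        _ ≤ eps N * (k / 2 + (Z + B) * q) := mul_le_mul_of_nonneg_left h5 hε.le
        _ = _ := by rw [hq]; ring
    have hkρ : k / 2 = 1 / ρ * (ρ / 2 * k) := by field_simp
    have hE : cellRelEnergy W ρ N x v U V i t = ρ / 2 * k + R := rfl
    rw [hE]
    have f1 : 2 * |L| * C₁ * R + M * C₁ * R + k / 2 ≤ C * (ρ / 2 * k + R) := by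
      rw [hkρ]
      have g1 : 0 ≤ ρ / 2 * k := by positivity
      have e : C * (ρ / 2 * k + R) = (2 * |L| * C₁ * R + M * C₁ * R + 1 / ρ * (ρ / 2 * k))
          + (2 * |L| * C₁ + 2 * L ^ 2 * M + M * C₁ + 3 * |L| * M + (Z + |B|) * D) * (ρ / 2 * k)
          + (2 * L ^ 2 * M + 3 * |L| * M + 1 / ρ + (Z + |B|) * D) * R := by rw [hC]; ring
      rw [e]
      have g2 : 0 ≤ (2 * |L| * C₁ + 2 * L ^ 2 * M + M * C₁ + 3 * |L| * M + (Z + |B|) * D)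
          * (ρ / 2 * k) := by positivity
      have g3 : 0 ≤ (2 * L ^ 2 * M + 3 * |L| * M + 1 / ρ + (Z + |B|) * D) * R := by positivity
      linarith
    have f2 : 2 * L ^ 2 * M * eps N + 3 * |L| * M * |S₁| + (Z + |B|) * D * (eps N + |S₀|) ≤
        C * (eps N + |S₀| + |S₁|) := by
      have g1 : (2 * L ^ 2 * M + (Z + |B|) * D) * eps N ≤ C * eps N :=
        mul_le_mul_of_nonneg_right (by linarith) hε.le
      have g2 : (Z + |B|) * D * |S₀| ≤ C * |S₀| :=
        mul_le_mul_of_nonneg_right (by linarith) (abs_nonneg _)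
      have g3 : 3 * |L| * M * |S₁| ≤ C * |S₁| :=
        mul_le_mul_of_nonneg_right (by linarith) (abs_nonneg _)
      linarith
    have f := mul_le_mul_of_nonneg_left (add_le_add f1 f2) hε.le
    linarith
  refine (Finset.sum_le_sum fun i _ => hterm i).trans (le_of_eq ?_)
  rw [Finset.sum_add_distrib, ← Finset.mul_sum, ← Finset.mul_sum _ _ C, Finset.sum_add_distrib,
    Finset.sum_add_distrib, Finset.sum_const, Finset.card_range, nsmul_eq_mul, ← mul_assoc (N : ℝ),
    natCast_mul_eps hN]
  rfl

/-- Grönwall with the integrating factor e^{−Cs}: the product e^{−Cs} K(s) grows no faster than K(0)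
+ C ∫ e, since e^{−Cs} ≤ 1 and the error e is nonnegative. A right-derivative comparison suffices,
so no continuity of K' is required. -/
theorem exists_latticeRelEnergy_le {p : ℝ} (hp : 2 ≤ p) {W : ℝ → ℝ} (hW : IsPotential p W)
    {ρ : ℝ} (hρ : 0 < ρ) (L B : ℝ) :
    ∃ C, 0 ≤ C ∧ ∀ T, 0 < T → ∀ U V, IsIntegralSolution W ρ T L B U V → ∀ N, 1 ≤ N →
      ∀ x v, IsLatticeSolution W ρ T N x v → ∀ t ∈ Icc 0 T,
      latticeRelEnergy W ρ N x v U V t ≤ Real.exp (C * T) *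
        (latticeRelEnergy W ρ N x v U V 0 + C * ∫ s in 0..T, consistencyError N U V s) := by
  obtain ⟨C, hC, h⟩ := exists_deriv_latticeRelEnergy_le hp hW hρ L B
  refine ⟨C, hC, fun T hT U V hUV N hN x v hlat t ht => ?_⟩
  choose! K' hK' hle using h T hT U V hUV N hN x v hlat
  set K := latticeRelEnergy W ρ N x v U V with hKdef
  set e := consistencyError N U V with hedef
  have hec : Continuous e :=
    (continuous_const.add (hUV.strain_field.continuous_secondDiffSum N 0)).add
      (hUV.velocity_field.continuous_secondDiffSum N 1)
  have he0 : ∀ s, 0 ≤ e s := fun s => by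
    have := eps_pos hN
    have := Real.pi_pos
    have h1 := PeriodicLipschitz.secondDiffSum_nonneg hN 0 (fun X => U X s)
    have h2 := PeriodicLipschitz.secondDiffSum_nonneg hN 1 (fun X => V X s)
    simp only [hedef, consistencyError]
    positivity
  have hder : ∀ s ∈ Icc 0 T, HasDerivWithinAt (fun s => Real.exp (-C * s) * K s)
      (Real.exp (-C * s) * (K' s - C * K s)) (Icc 0 T) s := fun s hs => by
    have h1 : HasDerivAt (fun s => Real.exp (-C * s)) (Real.exp (-C * s) * (-C * 1)) s :=
      ((hasDerivAt_id s).const_mul (-C)).exp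
    refine (h1.hasDerivWithinAt.mul (hK' s hs)).congr_deriv ?_
    ring
  have hBd : ∀ s, HasDerivAt (fun s => K 0 + C * ∫ r in 0..s, e r) (C * e s) s := fun s =>
    ((hasDerivAt_integral_of_continuous hec 0 s).const_mul C).const_add _
  have hmem : ∀ s ∈ Ico 0 T, Icc 0 T ∈ 𝓝[≥] s := fun s hs => Icc_mem_nhdsGE_of_mem hs
  have hmain := image_le_of_deriv_right_le_deriv_boundary
    (f := fun s => Real.exp (-C * s) * K s) (f' := fun s => Real.exp (-C * s) * (K' s - C * K s))
    (a := 0) (b := T) (B := fun s => K 0 + C * ∫ r in 0..s, e r) (B' := fun s => C * e s)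
    (fun s hs => (hder s hs).continuousWithinAt)
    (fun s hs => (hder s (Ico_subset_Icc_self hs)).mono_of_mem_nhdsWithin (hmem s hs))
    (by simp)
    (fun s _ => (hBd s).continuousAt.continuousWithinAt)
    (fun s _ => (hBd s).hasDerivWithinAt)
    (fun s hs => by
      have h1 := hle s (Ico_subset_Icc_self hs)
      have h2 : Real.exp (-C * s) ≤ 1 := Real.exp_le_one_iff.2 (by nlinarith [hs.1])
      have h3 : 0 ≤ C * e s := mul_nonneg hC (he0 s)
      calc Real.exp (-C * s) * (K' s - C * K s) ≤ Real.exp (-C * s) * (C * e s) :=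
            mul_le_mul_of_nonneg_left (by linarith) (Real.exp_pos _).le
        _ ≤ 1 * (C * e s) := mul_le_mul_of_nonneg_right h2 h3
        _ = C * e s := one_mul _) ht
  have hmono : ∫ r in 0..t, e r ≤ ∫ r in 0..T, e r :=
    intervalIntegral.integral_mono_interval le_rfl ht.1 ht.2
      (Eventually.of_forall he0) (hec.intervalIntegrable _ _)
  have hK0 : 0 ≤ K 0 + C * ∫ r in 0..T, e r := by
    have h1 : 0 ≤ ∫ r in 0..T, e r := intervalIntegral.integral_nonneg hT.le fun s _ => he0 s
    have h2 : 0 ≤ K 0 := by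
      obtain ⟨c, hc, hconv⟩ := hW.exists_sq_le_relPotential
      refine Finset.sum_nonneg fun i _ => mul_nonneg (eps_pos hN).le (add_nonneg (by positivity) ?_)
      exact le_trans (by positivity) (hconv _ _)
    positivity
  have h1 : Real.exp (-C * t) * K t ≤ K 0 + C * ∫ r in 0..T, e r :=
    hmain.trans (by gcongr)
  have h2 : K t = Real.exp (C * t) * (Real.exp (-C * t) * K t) := by
    rw [← mul_assoc, ← Real.exp_add]; simp
  rw [h2]
  calc _ ≤ Real.exp (C * t) * (K 0 + C * ∫ r in 0..T, e r) :=
        mul_le_mul_of_nonneg_left h1 (Real.exp_pos _).le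
    _ ≤ _ := mul_le_mul_of_nonneg_right
        (Real.exp_le_exp.2 (mul_le_mul_of_nonneg_left ht.2 hC)) hK0

theorem tendsto_integral_consistencyError {W : ℝ → ℝ} {ρ T L B : ℝ} {U V : ℝ → ℝ → ℝ}
    (hUV : IsIntegralSolution W ρ T L B U V) :
    Tendsto (fun N => ∫ s in 0..T, consistencyError N U V s) atTop (𝓝 0) := by
  have h1 := hUV.strain_field.tendsto_integral_secondDiffSum 0 T
  have h2 := hUV.velocity_field.tendsto_integral_secondDiffSum 1 T
  have h3 := (tendsto_eps.const_mul (2 * Real.pi)).const_mul T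
  have := (h3.add h1).add h2
  simp only [mul_zero, add_zero] at this
  refine this.congr fun N => ?_
  have c1 := (hUV.strain_field.continuous_secondDiffSum N 0)
  have c2 := (hUV.velocity_field.continuous_secondDiffSum N 1)
  have c3 : Continuous fun t => 2 * Real.pi * eps N + secondDiffSum N 0 (fun X => U X t) :=
    continuous_const.add c1
  unfold consistencyError
  rw [intervalIntegral.integral_add (c3.intervalIntegrable _ _)
    (c2.intervalIntegrable _ _), intervalIntegral.integral_add
    (continuous_const.intervalIntegrable _ _) (c1.intervalIntegrable _ _)]
  simp only [intervalIntegral.integral_const, sub_zero, smul_eq_mul]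

/-! ### The continuum solution as globally defined fields -/

/-- The extension of a field on `Q × [0, T]` that is constant in time outside `[0, T]`. -/
def clampField (T : ℝ) (f : ℝ × ℝ → ℝ) (X t : ℝ) : ℝ := f (X, max 0 (min T t))

theorem clampField_eq {T : ℝ} (f : ℝ × ℝ → ℝ) (X : ℝ) {t : ℝ} (ht : t ∈ Icc 0 T) :
    clampField T f X t = f (X, t) := by
  rw [clampField, min_eq_right ht.2, max_eq_right ht.1]

theorem clamp_mem_Icc {T : ℝ} (hT : 0 ≤ T) (t : ℝ) : max 0 (min T t) ∈ Icc 0 T :=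
  ⟨le_max_left _ _, max_le hT (min_le_left _ _)⟩

theorem PeriodicLipschitz.mono {L B L' B' : ℝ} {U : ℝ → ℝ → ℝ} (h : PeriodicLipschitz L B U)
    (hL : L ≤ L') (hB : B ≤ B') : PeriodicLipschitz L' B' U where
  continuous := h.continuous
  lipschitz X Y t := (h.lipschitz X Y t).trans (mul_le_mul_of_nonneg_right hL (abs_nonneg _))
  periodic := h.periodic
  bound X t := (h.bound X t).trans hB

/-- Clamping time makes the field continuous on the whole plane while keeping its Lipschitz constant
in X; the bound comes from compactness of one period times [0, T]. -/
theorem IsLipschitzField.exists_periodicLipschitz {T : ℝ} (hT : 0 ≤ T) {f : ℝ × ℝ → ℝ}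
    (hf : IsLipschitzField T f) : ∃ L B, PeriodicLipschitz L B (clampField T f) := by
  obtain ⟨hper, K, hK⟩ := hf
  have hc : Continuous fun z : ℝ × ℝ => clampField T f z.1 z.2 := by
    refine hK.continuousOn.comp_continuous (f := fun z : ℝ × ℝ => (z.1, max 0 (min T z.2)))
      (by fun_prop) fun z => ⟨mem_univ _, clamp_mem_Icc hT _⟩
  have hp : ∀ X t, clampField T f (X + 2 * Real.pi) t = clampField T f X t := fun X t => hper _ _
  obtain ⟨B, hB⟩ := (isCompact_Icc.prod isCompact_Icc :
    IsCompact (Icc 0 (2 * Real.pi) ×ˢ Icc 0 T)).exists_bound_of_continuousOn hc.continuousOn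
  refine ⟨K, B, hc, fun X Y t => ?_, hp, fun X t => ?_⟩
  · have := hK.dist_le_mul (X, max 0 (min T t)) ⟨mem_univ _, clamp_mem_Icc hT _⟩
      (Y, max 0 (min T t)) ⟨mem_univ _, clamp_mem_Icc hT _⟩
    rwa [Prod.dist_eq, dist_self, max_eq_left dist_nonneg, Real.dist_eq, Real.dist_eq] at this
  · obtain ⟨Y, hY, hXY⟩ := Function.Periodic.exists_mem_Ico₀ (f := fun X => clampField T f X t)
      (fun X => hp X t) Real.two_pi_pos X
    have := hB (Y, max 0 (min T t)) ⟨Ico_subset_Icc_self hY, clamp_mem_Icc hT _⟩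
    rw [hXY]
    simp only [Real.norm_eq_abs] at this
    rwa [clampField_eq _ _ (clamp_mem_Icc hT t)] at this

theorem measurableSet_spaceTime (T : ℝ) : MeasurableSet (spaceTime T) :=
  measurableSet_circleDomain.prod measurableSet_Icc

theorem exists_isIntegralSolution {p ρ T : ℝ} (hT : 0 < T) {W : ℝ → ℝ} (hW : IsPotential p W)
    {u v : ℝ × ℝ → ℝ} (hu : IsLipschitzField T u) (hv : IsLipschitzField T v)
    (hsol : IsWeakElastodynamics W ρ T u v) :
    ∃ L B, IsIntegralSolution W ρ T L B (clampField T u) (clampField T v) := by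
  obtain ⟨L₁, B₁, h₁⟩ := hu.exists_periodicLipschitz hT.le
  obtain ⟨L₂, B₂, h₂⟩ := hv.exists_periodicLipschitz hT.le
  have hU := h₁.mono (le_max_left L₁ L₂) (le_max_left B₁ B₂)
  have hV := h₂.mono (le_max_right L₁ L₂) (le_max_right B₁ B₂)
  refine ⟨_, _, hU, hV, fun a b t ht => ?_, fun a b t ht => ?_⟩
  · refine integral_sub_eq_of_weak_conservation hT hU.continuous hV.continuous hU.periodic
      hV.periodic (fun φ hφ => ?_) a b ht
    refine Eq.trans ?_ (hsol φ hφ).2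
    congr 1
    · refine setIntegral_congr_fun (measurableSet_spaceTime T) fun z hz => ?_
      simp only [clampField_eq _ _ hz.2]
    · simp only [clampField_eq _ _ (left_mem_Icc.2 hT.le)]
  · have hW' : Continuous (deriv W) := hW.contDiff_deriv.continuous
    refine integral_sub_eq_of_weak_conservation hT (P := fun X t => ρ * clampField T v X t)
      (F := fun X t => deriv W (clampField T u X t)) (continuous_const.mul hV.continuous)
      (hW'.comp hU.continuous) (fun X t => by simp only [hV.periodic])
      (fun X t => by simp only [hU.periodic]) (fun φ hφ => ?_) a b ht
    refine Eq.trans ?_ (hsol φ hφ).1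
    congr 1
    · refine setIntegral_congr_fun (measurableSet_spaceTime T) fun z hz => ?_
      simp only [clampField_eq _ _ hz.2]
      ring
    · simp only [clampField_eq _ _ (left_mem_Icc.2 hT.le)]
      refine integral_congr_ae (Eventually.of_forall fun X => ?_)
      simp only
      ring

/-! ### Vanishing of the initial relative energy -/

/-- Convergence to zero in `L^q`, `q ≥ 1`, implies convergence to zero in `L¹`. -/
theorem tendsto_eLpNorm_one_of_eLpNorm {α : Type*} [MeasurableSpace α] {μ : Measure α}
    [IsFiniteMeasure μ] {q : ENNReal} (hq : 1 ≤ q) {h : ℕ → α → ℝ}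
    (hm : ∀ᶠ n in atTop, AEStronglyMeasurable (h n) μ)
    (hlim : Tendsto (fun n => eLpNorm (h n) q μ) atTop (𝓝 0)) :
    Tendsto (fun n => eLpNorm (h n) 1 μ) atTop (𝓝 0) := by
  have hne : μ univ ^ (1 / (1 : ENNReal).toReal - 1 / q.toReal) ≠ ⊤ := by
    refine ENNReal.rpow_ne_top_of_nonneg ?_ (measure_ne_top μ univ)
    rw [ENNReal.toReal_one, div_one, sub_nonneg]
    rcases eq_or_ne q ⊤ with rfl | hqt
    · simp
    · have : 1 ≤ q.toReal := by
        rw [← ENNReal.toReal_one]; exact (ENNReal.toReal_le_toReal ENNReal.one_ne_top hqt).2 hq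
      exact div_le_one_of_le₀ this (by positivity)
  have := ENNReal.Tendsto.mul_const hlim (Or.inr hne)
  rw [zero_mul] at this
  refine tendsto_of_tendsto_of_tendsto_of_le_of_le' tendsto_const_nhds this
    (Eventually.of_forall fun _ => zero_le) ?_
  filter_upwards [hm] with n hn
  exact eLpNorm_le_eLpNorm_mul_rpow_measure_univ hq hn

theorem tendsto_integral_abs_of_eLpNorm_one {α : Type*} [MeasurableSpace α] {μ : Measure α}
    {h : ℕ → α → ℝ} (hm : ∀ᶠ n in atTop, AEStronglyMeasurable (h n) μ)
    (h1 : Tendsto (fun n => eLpNorm (h n) 1 μ) atTop (𝓝 0)) :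
    Tendsto (fun n => ∫ z, |h n z| ∂μ) atTop (𝓝 0) := by
  have h2 := (ENNReal.tendsto_toReal ENNReal.zero_ne_top).comp h1
  rw [ENNReal.toReal_zero] at h2
  refine h2.congr' ?_
  filter_upwards [hm] with n hn
  simp only [Function.comp, eLpNorm_one_eq_lintegral_enorm]
  rw [← integral_norm_eq_lintegral_enorm hn]
  rfl

theorem latticeRelEnergy_nonneg {p : ℝ} {W : ℝ → ℝ} (hW : IsPotential p W) {ρ : ℝ} (hρ : 0 < ρ)
    {N : ℕ} (hN : 1 ≤ N) (x v : ℤ → ℝ → ℝ) (U V : ℝ → ℝ → ℝ) (t : ℝ) :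
    0 ≤ latticeRelEnergy W ρ N x v U V t := by
  obtain ⟨c, hc, hconv⟩ := hW.exists_sq_le_relPotential
  refine Finset.sum_nonneg fun i _ => mul_nonneg (eps_pos hN).le (add_nonneg (by positivity) ?_)
  exact le_trans (by positivity) (hconv _ _)

/-- The relative energy is the energy difference minus its linear part at the averages, and the
averages are O(ε)-close to the fields. The comparison serves twice: energy convergence makes K small
at t = 0, and smallness of K gives energy convergence at later times. -/
theorem exists_abs_cellRelEnergy_sub_le {p : ℝ} {W : ℝ → ℝ} (hW : IsPotential p W) {ρ : ℝ} (hρ : 0 < ρ)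
    (L B : ℝ) :
    ∃ C, 0 ≤ C ∧ ∀ U V, PeriodicLipschitz L B U → PeriodicLipschitz L B V → ∀ N, 1 ≤ N →
      ∀ (x v : ℤ → ℝ → ℝ) (t X : ℝ),
      |cellRelEnergy W ρ N x v U V (cellIndex N X) t -
        (energyDensity W ρ (strain N x (cellIndex N X) t, v (cellIndex N X) t)
          - energyDensity W ρ (U X t, V X t))| ≤ C * (eps N
          + |strain N x (cellIndex N X) t - U X t| + |v (cellIndex N X) t - V X t|) := by
  obtain ⟨M, hM, -, hM', hMl⟩ := exists_bound_of_contDiff_one (hW.contDiff.of_le (by norm_num)) B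
  refine ⟨2 * M * |L| + 2 * ρ * |B| * |L| + M + ρ * |B|, by positivity,
    fun U V hU hV N hN x v t X => ?_⟩
  set i := cellIndex N X with hi
  have hε := eps_pos hN
  have hX := Ico_subset_Icc_self ((mem_Ico_iff_cellIndex_eq hN X i).2 hi.symm)
  unfold cellRelEnergy energyDensity relPotential
  simp only
  set a := cellAverage N (fun X => U X t) i with ha
  set b := cellAverage N (fun X => V X t) i with hb
  set u := strain N x i t
  have haB : |a| ≤ B := hU.abs_cellAverage_le hN i t
  have hbB : |b| ≤ B := hV.abs_cellAverage_le hN i t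
  have hL : |L| = L := abs_of_nonneg hU.nonneg_lipschitz
  have hL0 := hU.nonneg_lipschitz
  have hB0 : 0 ≤ B := (abs_nonneg _).trans haB
  have hB : |B| = B := abs_of_nonneg hB0
  have hau := hU.abs_cellAverage_sub_le hN i t hX
  have hbv := hV.abs_cellAverage_sub_le hN i t hX
  rw [← ha] at hau
  rw [← hb] at hbv
  rw [hL, hB]
  have h1 : |W a - W (U X t)| ≤ M * (L * eps N) :=
    (hMl _ _ haB (hU.bound _ _)).trans (mul_le_mul_of_nonneg_left hau hM)
  have h2 : |deriv W a * (u - a)| ≤ M * (|u - U X t| + L * eps N) := by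
    rw [abs_mul]
    refine mul_le_mul (hM' a haB) ?_ (abs_nonneg _) hM
    have := abs_sub_le u (U X t) a
    rw [abs_sub_comm (U X t) a] at this
    linarith
  have h3 : |b * (v i t - b)| ≤ B * (|v i t - V X t| + L * eps N) := by
    rw [abs_mul]
    refine mul_le_mul hbB ?_ (abs_nonneg _) hB0
    have := abs_sub_le (v i t) (V X t) b
    rw [abs_sub_comm (V X t) b] at this
    linarith
  have h4 : |(b + V X t) * (b - V X t)| ≤ 2 * B * (L * eps N) := by
    rw [abs_mul]
    refine mul_le_mul ?_ hbv (abs_nonneg _) (by positivity)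
    have := abs_add_le b (V X t)
    linarith [hV.bound X t]
  have h5 : |ρ * (b * (v i t - b))| ≤ ρ * (B * (|v i t - V X t| + L * eps N)) := by
    rw [abs_mul, abs_of_pos hρ]
    exact mul_le_mul_of_nonneg_left h3 hρ.le
  have h6 : |ρ / 2 * ((b + V X t) * (b - V X t))| ≤ ρ / 2 * (2 * B * (L * eps N)) := by
    rw [abs_mul, abs_of_pos (half_pos hρ)]
    exact mul_le_mul_of_nonneg_left h4 (by positivity)
  -- Every term on the right is linear in u − a or v − b, or is a difference between average and
  -- field.
  have e : ρ / 2 * (v i t - b) ^ 2 + (W u - W a - deriv W a * (u - a))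
      - (ρ / 2 * v i t ^ 2 + W u - (ρ / 2 * V X t ^ 2 + W (U X t))) =
      -((W a - W (U X t)) + deriv W a * (u - a) + ρ * (b * (v i t - b))
      + ρ / 2 * ((b + V X t) * (b - V X t))) := by ring
  rw [e, abs_neg]
  refine (abs_add_le _ _).trans ((add_le_add_left ((abs_add_le _ _).trans
    (add_le_add_left (abs_add_le _ _) _)) _).trans ?_)
  have g1 : 0 ≤ (2 * M * L + 2 * ρ * B * L + ρ * B) * |u - U X t| := by positivity
  have g2 : 0 ≤ (2 * M * L + 2 * ρ * B * L + M) * |v i t - V X t| := by positivity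
  have g3 : 0 ≤ (M + ρ * B) * eps N := by positivity
  linarith

theorem continuous_energyDensity {p : ℝ} {W : ℝ → ℝ} (hW : IsPotential p W) (ρ : ℝ) :
    Continuous (energyDensity W ρ) := by
  have := hW.contDiff.continuous
  unfold energyDensity
  fun_prop

theorem integrableOn_circleDomain {f : ℝ → ℝ} (hf : Continuous f) :
    IntegrableOn f circleDomain :=
  (hf.integrableOn_Icc (a := 0) (b := 2 * Real.pi)).mono_set Ico_subset_Icc_self

instance : IsFiniteMeasure (volume.restrict circleDomain) :=
  ⟨by
    rw [Measure.restrict_apply_univ, circleDomain, Real.volume_Ico]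
    exact ENNReal.ofReal_lt_top⟩

theorem volume_real_circleDomain : volume.real circleDomain = 2 * Real.pi := by
  rw [measureReal_def, circleDomain, Real.volume_Ico, sub_zero,
    ENNReal.toReal_ofReal Real.two_pi_pos.le]

theorem ae_interp_eq {N : ℕ} (hN : 1 ≤ N) (x v : ℤ → ℝ → ℝ) :
    ∀ᵐ X ∂(volume.restrict circleDomain), ∀ t, interp N x v (X, t) =
      (strain N x (cellIndex N X) t, v (cellIndex N X) t) := by
  filter_upwards [ae_restrict_of_ae (ae_ne_node N),
    ae_restrict_mem measurableSet_circleDomain] with X hX hXm t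
  simp only [interp, uInterp_eq hN x t hXm hX, vInterp_eq hN v t hXm]

/-- Integrating the pointwise comparison bounds K(0) by the signed difference of total energies plus
L¹ distances of the data. Convergence of the total energy therefore suffices; no pointwise control
of the energy density is assumed. -/
theorem tendsto_latticeRelEnergy_zero {p ρ : ℝ} (hp : 2 ≤ p) (hρ : 0 < ρ) {W : ℝ → ℝ}
    (hW : IsPotential p W) {L B : ℝ} {U V : ℝ → ℝ → ℝ} (hU : PeriodicLipschitz L B U)
    (hV : PeriodicLipschitz L B V) (x v : ℕ → ℤ → ℝ → ℝ)
    (hu0 : Tendsto (fun N => eLpNorm (fun X => uInterp N (x N) 0 X - U X 0)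
      (ENNReal.ofReal p) (volume.restrict circleDomain)) atTop (𝓝 0))
    (hv0 : Tendsto (fun N => eLpNorm (fun X => vInterp N (v N) 0 X - V X 0)
      2 (volume.restrict circleDomain)) atTop (𝓝 0))
    (hE0 : Tendsto (fun N => ∫ X in circleDomain,
        energyDensity W ρ (interp N (x N) (v N) (X, 0))) atTop
      (𝓝 (∫ X in circleDomain, energyDensity W ρ (U X 0, V X 0)))) :
    Tendsto (fun N => latticeRelEnergy W ρ N (x N) (v N) U V 0) atTop (𝓝 0) := by
  obtain ⟨C, hC, hle⟩ := exists_abs_cellRelEnergy_sub_le hW hρ L B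
  have hstep : ∀ (N : ℕ) (G : ℤ → ℝ) (f : ℝ → ℝ), Continuous f →
      AEStronglyMeasurable (fun X => G (cellIndex N X) - f X) (volume.restrict circleDomain) :=
    fun N G f hf => (((measurable_from_top (f := G)).comp (measurable_cellIndex N)).sub
      hf.measurable).aestronglyMeasurable
  have hum : ∀ N, 1 ≤ N → (fun X => uInterp N (x N) 0 X - U X 0) =ᵐ[volume.restrict circleDomain]
      fun X => strain N (x N) (cellIndex N X) 0 - U X 0 := fun N hN => by
    filter_upwards [ae_interp_eq hN (x N) (v N)] with X hX
    have := congrArg Prod.fst (hX 0)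
    simp only [interp] at this
    rw [this]
  have hvm : ∀ N, 1 ≤ N → (fun X => vInterp N (v N) 0 X - V X 0) =ᵐ[volume.restrict circleDomain]
      fun X => v N (cellIndex N X) 0 - V X 0 := fun N hN => by
    filter_upwards [ae_interp_eq hN (x N) (v N)] with X hX
    have := congrArg Prod.snd (hX 0)
    simp only [interp] at this
    rw [this]
  have hU0 := hU.continuous_left 0
  have hV0 := hV.continuous_left 0
  have h1 : Tendsto (fun N => ∫ X in circleDomain, |strain N (x N) (cellIndex N X) 0 - U X 0|)
      atTop (𝓝 0) := by
    have hm := fun N => hstep N (fun i => strain N (x N) i 0) _ hU0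
    refine tendsto_integral_abs_of_eLpNorm_one (Eventually.of_forall hm)
      (tendsto_eLpNorm_one_of_eLpNorm (q := ENNReal.ofReal p) ?_ (Eventually.of_forall hm)
        (hu0.congr' ?_))
    · rw [ENNReal.one_le_ofReal]; linarith
    · filter_upwards [eventually_ge_atTop 1] with N hN
      exact eLpNorm_congr_ae (hum N hN)
  have h2 : Tendsto (fun N => ∫ X in circleDomain, |v N (cellIndex N X) 0 - V X 0|)
      atTop (𝓝 0) := by
    have hm := fun N => hstep N (fun i => v N i 0) _ hV0
    refine tendsto_integral_abs_of_eLpNorm_one (Eventually.of_forall hm)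
      (tendsto_eLpNorm_one_of_eLpNorm (q := 2) (by norm_num) (Eventually.of_forall hm)
        (hv0.congr' ?_))
    filter_upwards [eventually_ge_atTop 1] with N hN
    exact eLpNorm_congr_ae (hvm N hN)
  have hηc : Continuous fun X => energyDensity W ρ (U X 0, V X 0) :=
    (continuous_energyDensity hW ρ).comp (hU0.prodMk hV0)
  have hηU := integrableOn_circleDomain hηc
  have hlim := (hE0.sub_const (∫ X in circleDomain, energyDensity W ρ (U X 0, V X 0))).add
    ((((tendsto_eps.const_mul (2 * Real.pi)).add h1).add h2).const_mul C)
  simp only [sub_self, mul_zero, add_zero] at hlim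
  refine tendsto_of_tendsto_of_tendsto_of_le_of_le' tendsto_const_nhds hlim ?_ ?_
  · filter_upwards [eventually_ge_atTop 1] with N hN
    exact latticeRelEnergy_nonneg hW hρ hN _ _ _ _ _
  · filter_upwards [eventually_ge_atTop 1] with N hN
    obtain ⟨i1, e1⟩ := integral_comp_cellIndex hN (fun i => cellRelEnergy W ρ N (x N) (v N) U V i 0)
    obtain ⟨i2, -⟩ := integral_comp_cellIndex hN
      (fun i => energyDensity W ρ (strain N (x N) i 0, v N i 0))
    obtain ⟨i3, -⟩ := integral_comp_cellIndex hN (fun i => strain N (x N) i 0)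
    obtain ⟨i4, -⟩ := integral_comp_cellIndex hN (fun i => v N i 0)
    have i5 : IntegrableOn (fun X => |strain N (x N) (cellIndex N X) 0 - U X 0|) circleDomain :=
      (i3.sub (integrableOn_circleDomain hU0)).abs
    have i6 : IntegrableOn (fun X => |v N (cellIndex N X) 0 - V X 0|) circleDomain :=
      (i4.sub (integrableOn_circleDomain hV0)).abs
    have i7 : IntegrableOn (fun _ : ℝ => eps N) circleDomain :=
      integrableOn_circleDomain continuous_const
    have e2 : ∫ X in circleDomain, energyDensity W ρ (interp N (x N) (v N) (X, 0)) =
        ∫ X in circleDomain, energyDensity W ρ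
          (strain N (x N) (cellIndex N X) 0, v N (cellIndex N X) 0) := by
      refine integral_congr_ae ?_
      filter_upwards [ae_interp_eq hN (x N) (v N)] with X hX
      rw [hX 0]
    have i8 : IntegrableOn (fun X => energyDensity W ρ
        (strain N (x N) (cellIndex N X) 0, v N (cellIndex N X) 0)
          - energyDensity W ρ (U X 0, V X 0)) circleDomain := i2.sub hηU
    have i9 : IntegrableOn (fun X => eps N + |strain N (x N) (cellIndex N X) 0 - U X 0|)
        circleDomain := i7.add i5
    have i10 : IntegrableOn (fun X => eps N + |strain N (x N) (cellIndex N X) 0 - U X 0|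
        + |v N (cellIndex N X) 0 - V X 0|) circleDomain := i9.add i6
    have hmono := integral_mono i1 (i8.add (i10.const_mul C))
      (fun X => sub_le_iff_le_add'.1
        ((le_abs_self _).trans (hle U V hU hV N hN (x N) (v N) 0 X)))
    simp only [Pi.add_apply] at hmono
    rw [integral_add i8 (i10.const_mul C), integral_const_mul, integral_add i9 i6,
      integral_add i7 i5, integral_sub i2 hηU, ← e2, e1, setIntegral_const,
      volume_real_circleDomain] at hmono
    exact hmono

/-! ### Strong convergence on space-time -/

instance (T : ℝ) : IsFiniteMeasure (volume.restrict (spaceTime T)) :=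
  ⟨by
    rw [Measure.restrict_apply_univ, spaceTime, circleDomain, Measure.volume_eq_prod,
      Measure.prod_prod, Real.volume_Ico, Real.volume_Icc]
    exact ENNReal.mul_lt_top ENNReal.ofReal_lt_top ENNReal.ofReal_lt_top⟩

/-- The cell index takes countably many values, so measurability in time for each index is enough.
Time is clamped because continuity is known only on [0, T]. -/
theorem aestronglyMeasurable_comp_cellIndex {E : Type*} [TopologicalSpace E]
    [TopologicalSpace.PseudoMetrizableSpace E] [MeasurableSpace E] [BorelSpace E]
    [SecondCountableTopology E] {T : ℝ} (hT : 0 ≤ T) (N : ℕ) {G : ℤ → ℝ → E}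
    (hG : ∀ i, ContinuousOn (G i) (Icc 0 T)) :
    AEStronglyMeasurable (fun z : ℝ × ℝ => G (cellIndex N z.1) z.2)
      (volume.restrict (spaceTime T)) := by
  have hm : Measurable fun q : ℤ × ℝ => G q.1 (max 0 (min T q.2)) :=
    measurable_from_prod_countable_right fun i =>
      ((hG i).comp_continuous (by fun_prop) (clamp_mem_Icc hT)).measurable
  have hm2 : Measurable fun z : ℝ × ℝ => G (cellIndex N z.1) (max 0 (min T z.2)) :=
    hm.comp (((measurable_cellIndex N).comp measurable_fst).prodMk measurable_snd)
  refine hm2.aestronglyMeasurable.congr ?_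
  filter_upwards [ae_restrict_mem (measurableSet_spaceTime T)] with z hz
  rw [min_eq_right hz.2.2, max_eq_right hz.2.1]

theorem lintegral_spaceTime_comp_cellIndex {T : ℝ} (hT : 0 ≤ T) {N : ℕ} (hN : 1 ≤ N)
    {G : ℤ → ℝ → ℝ} (hG : ∀ i, ContinuousOn (G i) (Icc 0 T)) :
    ∫⁻ z in spaceTime T, ENNReal.ofReal (G (cellIndex N z.1) z.2) =
      ∫⁻ t in Icc 0 T, ∑ i ∈ Finset.range N, ENNReal.ofReal (eps N) * ENNReal.ofReal (G i t) := by
  have hm := (aestronglyMeasurable_comp_cellIndex hT N hG).aemeasurable.ennreal_ofReal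
  unfold spaceTime at *
  rw [Measure.volume_eq_prod, ← Measure.prod_restrict] at *
  rw [lintegral_prod_symm _ hm]
  refine lintegral_congr fun t => ?_
  exact lintegral_comp_cellIndex hN fun i => ENNReal.ofReal (G i t)

theorem ae_spaceTime_interp_eq (T : ℝ) {N : ℕ} (hN : 1 ≤ N) (x v : ℤ → ℝ → ℝ) :
    ∀ᵐ z ∂(volume.restrict (spaceTime T)), interp N x v z =
      (strain N x (cellIndex N z.1) z.2, v (cellIndex N z.1) z.2) := by
  have h : ∀ᵐ z : ℝ × ℝ, ∀ i : ℤ, z.1 ≠ i * eps N :=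
    Measure.quasiMeasurePreserving_fst.ae (ae_ne_node N)
  filter_upwards [ae_restrict_of_ae h, ae_restrict_mem (measurableSet_spaceTime T)] with z hz hzm
  simp only [interp, uInterp_eq hN x z.2 hzm.1 hz, vInterp_eq hN v z.2 hzm.1]

section LatticeContinuity

variable {W : ℝ → ℝ} {ρ T : ℝ} {N : ℕ} {x v : ℤ → ℝ → ℝ}

theorem IsLatticeSolution.continuousOn_velocity (h : IsLatticeSolution W ρ T N x v) (hρ : 0 < ρ)
    (hN : 1 ≤ N) (i : ℤ) : ContinuousOn (v i) (Icc 0 T) := fun t ht => by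
  have := ((h.motion i t ht).const_mul (eps N * ρ)⁻¹).continuousWithinAt
  simpa only [inv_mul_cancel_left₀ (mul_ne_zero (eps_pos hN).ne' hρ.ne')] using this

theorem IsLatticeSolution.continuousOn_strain (h : IsLatticeSolution W ρ T N x v) (i : ℤ) :
    ContinuousOn (strain N x i) (Icc 0 T) := fun t ht =>
  (((h.velocity (i + 1) t ht).continuousWithinAt).sub
    ((h.velocity i t ht).continuousWithinAt)).div_const _

theorem IsLatticeSolution.continuousOn_cellRelEnergy {p L B : ℝ} (hW : IsPotential p W)
    (h : IsLatticeSolution W ρ T N x v) (hρ : 0 < ρ) (hN : 1 ≤ N) {U V : ℝ → ℝ → ℝ}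
    (hU : PeriodicLipschitz L B U) (hV : PeriodicLipschitz L B V) (i : ℤ) :
    ContinuousOn (cellRelEnergy W ρ N x v U V i) (Icc 0 T) := by
  have h1 := h.continuousOn_velocity hρ hN i
  have h2 := h.continuousOn_strain i
  have h3 := (hU.continuous_cellAverage N i).continuousOn (s := Icc 0 T)
  have h4 := (hV.continuous_cellAverage N i).continuousOn (s := Icc 0 T)
  have h5 := hW.contDiff.continuous
  have h6 := hW.contDiff_deriv.continuous
  unfold cellRelEnergy relPotential
  exact (((h1.sub h4).pow 2).const_smul (ρ / 2)).add
    (((h5.comp_continuousOn h2).sub (h5.comp_continuousOn h3)).sub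
      ((h6.comp_continuousOn h3).mul (h2.sub h3)))

theorem aestronglyMeasurable_interp (h : 1 ≤ N → IsLatticeSolution W ρ T N x v) (hρ : 0 < ρ)
    (hT : 0 ≤ T) : AEStronglyMeasurable (interp N x v) (volume.restrict (spaceTime T)) := by
  -- The sequence starts at N = 0, where no lattice is given; the sums are empty and the interpolant
  -- is zero.
  rcases Nat.eq_zero_or_pos N with rfl | hN
  · have : interp 0 x v = fun _ => (0, 0) := by
      funext z
      have : yInterp 0 x z.2 = fun _ => 0 := by
        funext X
        simp [yInterp]
      simp [interp, uInterp, vInterp, this]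
    rw [this]
    exact aestronglyMeasurable_const
  · have hl := h hN
    refine (aestronglyMeasurable_comp_cellIndex hT N (G := fun i t => (strain N x i t, v i t))
      fun i => (hl.continuousOn_strain i).prodMk (hl.continuousOn_velocity hρ hN i)).congr ?_
    filter_upwards [ae_spaceTime_interp_eq T hN x v] with z hz
    exact hz.symm

end LatticeContinuity

/-- Bounding through Lebesgue integrals of nonnegative functions avoids any measurability
requirement on h and κ. -/
theorem tendsto_eLpNorm_of_le {α : Type*} [MeasurableSpace α] {μ : Measure α} [IsFiniteMeasure μ]
    {q : ℝ} (hq : 0 < q) {C : ℝ} (hC : 0 ≤ C) {h κ : ℕ → α → ℝ} {δ : ℕ → ℝ}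
    (hle : ∀ᶠ n in atTop, ∀ᵐ z ∂μ, |h n z| ^ q ≤ C * (κ n z + δ n))
    (hκ : Tendsto (fun n => ∫⁻ z, ENNReal.ofReal (κ n z) ∂μ) atTop (𝓝 0))
    (hδ : Tendsto δ atTop (𝓝 0)) :
    Tendsto (fun n => eLpNorm (h n) (ENNReal.ofReal q) μ) atTop (𝓝 0) := by
  have hlim : Tendsto (fun n => ENNReal.ofReal C * ((∫⁻ z, ENNReal.ofReal (κ n z) ∂μ)
      + ENNReal.ofReal |δ n| * μ univ)) atTop (𝓝 0) := by
    have h1 : Tendsto (fun n => ENNReal.ofReal |δ n|) atTop (𝓝 0) := by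
      have := ENNReal.tendsto_ofReal hδ.abs
      simpa using this
    have h2 := ENNReal.Tendsto.mul_const h1 (Or.inr (measure_ne_top μ univ))
    rw [zero_mul] at h2
    have h3 := ENNReal.Tendsto.const_mul (a := ENNReal.ofReal C) (hκ.add h2)
      (Or.inr ENNReal.ofReal_ne_top)
    simpa using h3
  have hint : Tendsto (fun n => ∫⁻ z, ‖h n z‖ₑ ^ q ∂μ) atTop (𝓝 0) := by
    refine tendsto_of_tendsto_of_tendsto_of_le_of_le' tendsto_const_nhds hlim
      (Eventually.of_forall fun _ => zero_le) ?_
    filter_upwards [hle] with n hn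
    have : ∫⁻ z, ‖h n z‖ₑ ^ q ∂μ ≤
        ∫⁻ z, ENNReal.ofReal C * (ENNReal.ofReal (κ n z) + ENNReal.ofReal |δ n|) ∂μ := by
      refine lintegral_mono_ae ?_
      filter_upwards [hn] with z hz
      rw [Real.enorm_eq_ofReal_abs, ENNReal.ofReal_rpow_of_nonneg (abs_nonneg _) hq.le]
      refine (ENNReal.ofReal_le_ofReal hz).trans ?_
      rw [ENNReal.ofReal_mul hC]
      gcongr
      refine ENNReal.ofReal_add_le.trans ?_
      gcongr
      exact le_abs_self _
    refine this.trans (le_of_eq ?_)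
    rw [lintegral_const_mul' _ _ ENNReal.ofReal_ne_top, lintegral_add_right _ measurable_const,
      lintegral_const]
  have hne : ENNReal.ofReal q ≠ 0 := by simpa using hq
  have e : ∀ n, eLpNorm (h n) (ENNReal.ofReal q) μ = (∫⁻ z, ‖h n z‖ₑ ^ q ∂μ) ^ (1 / q) := fun n => by
    rw [eLpNorm_eq_lintegral_rpow_enorm_toReal hne ENNReal.ofReal_ne_top,
      ENNReal.toReal_ofReal hq.le]
  simp only [e]
  have := (ENNReal.continuous_rpow_const (y := 1 / q)).tendsto 0 |>.comp hint
  rwa [ENNReal.zero_rpow_of_pos (by positivity)] at this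

theorem cellRelEnergy_nonneg {p : ℝ} {W : ℝ → ℝ} (hW : IsPotential p W) {ρ : ℝ} (hρ : 0 < ρ)
    (N : ℕ) (x v : ℤ → ℝ → ℝ) (U V : ℝ → ℝ → ℝ) (i : ℤ) (t : ℝ) :
    0 ≤ cellRelEnergy W ρ N x v U V i t := by
  obtain ⟨c, hc, hconv⟩ := hW.exists_sq_le_relPotential
  exact add_nonneg (by positivity) (le_trans (by positivity) (hconv _ _))

/-- The Grönwall bound is uniform in t, so integrating it over [0, T] costs only a factor T; its
right-hand side tends to zero by the initial data and the consistency estimate. -/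
theorem tendsto_lintegral_cellRelEnergy {p ρ T L B : ℝ} (hp : 2 ≤ p) (hρ : 0 < ρ) (hT : 0 < T)
    {W : ℝ → ℝ} (hW : IsPotential p W) {U V : ℝ → ℝ → ℝ} (hUV : IsIntegralSolution W ρ T L B U V)
    {x v : ℕ → ℤ → ℝ → ℝ} (hlat : ∀ N, 1 ≤ N → IsLatticeSolution W ρ T N (x N) (v N))
    (hK0 : Tendsto (fun N => latticeRelEnergy W ρ N (x N) (v N) U V 0) atTop (𝓝 0)) :
    Tendsto (fun N => ∫⁻ z in spaceTime T,
      ENNReal.ofReal (cellRelEnergy W ρ N (x N) (v N) U V (cellIndex N z.1) z.2)) atTop (𝓝 0) := by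
  obtain ⟨C, hC, hle⟩ := exists_latticeRelEnergy_le hp hW hρ L B
  have hω := (hK0.add ((tendsto_integral_consistencyError hUV).const_mul C)).const_mul
    (Real.exp (C * T))
  rw [mul_zero, add_zero, mul_zero] at hω
  have hlim := ENNReal.Tendsto.mul_const (b := ENNReal.ofReal T) (ENNReal.tendsto_ofReal hω)
    (Or.inr ENNReal.ofReal_ne_top)
  rw [ENNReal.ofReal_zero, zero_mul] at hlim
  refine tendsto_of_tendsto_of_tendsto_of_le_of_le' tendsto_const_nhds hlim
    (Eventually.of_forall fun _ => zero_le) ?_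
  filter_upwards [eventually_ge_atTop 1] with N hN
  rw [lintegral_spaceTime_comp_cellIndex hT.le hN fun i =>
    (hlat N hN).continuousOn_cellRelEnergy hW hρ hN hUV.strain_field hUV.velocity_field i]
  calc _ ≤ ∫⁻ _ in Icc 0 T, ENNReal.ofReal (Real.exp (C * T) *
        (latticeRelEnergy W ρ N (x N) (v N) U V 0 + C * ∫ s in 0..T, consistencyError N U V s)) := by
        refine setLIntegral_mono measurable_const fun t ht => ?_
        refine le_trans (le_of_eq ?_) (ENNReal.ofReal_le_ofReal
          (hle T hT U V hUV N hN (x N) (v N) (hlat N hN) t ht))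
        unfold latticeRelEnergy
        rw [ENNReal.ofReal_sum_of_nonneg fun i _ => mul_nonneg (eps_pos hN).le
          (cellRelEnergy_nonneg hW hρ _ _ _ _ _ _ _)]
        exact Finset.sum_congr rfl fun i _ => (ENNReal.ofReal_mul (eps_pos hN).le).symm
    _ = _ := by rw [setLIntegral_const, Real.volume_Icc, sub_zero]

theorem add_rpow_le_two_rpow_mul {a b q : ℝ} (ha : 0 ≤ a) (hb : 0 ≤ b) (hq : 0 ≤ q) :
    (a + b) ^ q ≤ 2 ^ q * (a ^ q + b ^ q) := by
  have hm : 0 ≤ max a b := ha.trans (le_max_left _ _)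
  have h1 : (a + b) ^ q ≤ (2 * max a b) ^ q :=
    Real.rpow_le_rpow (by positivity) (by linarith [le_max_left a b, le_max_right a b]) hq
  rw [Real.mul_rpow zero_le_two hm] at h1
  refine h1.trans (mul_le_mul_of_nonneg_left ?_ (by positivity))
  rcases max_choice a b with h | h <;> rw [h]
  · linarith [Real.rpow_nonneg hb q]
  · linarith [Real.rpow_nonneg ha q]

/-- Strong convergence of the interpolated strain, velocity and energy density. -/
theorem strong_convergence {p ρ T L B : ℝ} (hp : 2 ≤ p) (hρ : 0 < ρ) (hT : 0 < T)
    {W : ℝ → ℝ} (hW : IsPotential p W) {U V : ℝ → ℝ → ℝ} (hUV : IsIntegralSolution W ρ T L B U V)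
    {x v : ℕ → ℤ → ℝ → ℝ} (hlat : ∀ N, 1 ≤ N → IsLatticeSolution W ρ T N (x N) (v N))
    (hK0 : Tendsto (fun N => latticeRelEnergy W ρ N (x N) (v N) U V 0) atTop (𝓝 0)) :
    Tendsto (fun N => eLpNorm (fun z : ℝ × ℝ => uInterp N (x N) z.2 z.1 - U z.1 z.2)
      (ENNReal.ofReal p) (volume.restrict (spaceTime T))) atTop (𝓝 0) ∧
    Tendsto (fun N => eLpNorm (fun z : ℝ × ℝ => vInterp N (v N) z.2 z.1 - V z.1 z.2)
      2 (volume.restrict (spaceTime T))) atTop (𝓝 0) ∧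
    Tendsto (fun N => eLpNorm (fun z : ℝ × ℝ => energyDensity W ρ (interp N (x N) (v N) z)
      - energyDensity W ρ (U z.1 z.2, V z.1 z.2)) 1 (volume.restrict (spaceTime T)))
      atTop (𝓝 0) := by
  set κ : ℕ → ℝ × ℝ → ℝ := fun N z =>
    cellRelEnergy W ρ N (x N) (v N) U V (cellIndex N z.1) z.2 with hκdef
  have hκ := tendsto_lintegral_cellRelEnergy hp hρ hT hW hUV hlat hK0
  have hU := hUV.strain_field
  have hV := hUV.velocity_field
  have hκ0 : ∀ N z, 0 ≤ κ N z := fun N z => cellRelEnergy_nonneg hW hρ _ _ _ _ _ _ _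
  have hδ : ∀ q : ℝ, 0 < q → Tendsto (fun N => |L * eps N| ^ q) atTop (𝓝 0) := fun q hq => by
    have := (tendsto_eps.const_mul L).abs
    rw [mul_zero, abs_zero] at this
    have := this.rpow_const (p := q) (Or.inr hq.le)
    rwa [Real.zero_rpow hq.ne'] at this
  have hmemcell : ∀ N, 1 ≤ N → ∀ X, X ∈ Icc (cellIndex N X * eps N)
      ((cellIndex N X + 1) * eps N) := fun N hN X =>
    Ico_subset_Icc_self ((mem_Ico_iff_cellIndex_eq hN X _).2 rfl)
  -- Passing from the field to its cell average costs at most Lε, since z.1 lies in the cell.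
  have hpt : ∀ (F : ℝ → ℝ → ℝ), PeriodicLipschitz L B F → ∀ N, 1 ≤ N → ∀ (z : ℝ × ℝ) (f q : ℝ),
      0 < q → |f - F z.1 z.2| ^ q ≤
        2 ^ q * (|f - cellAverage N (fun X => F X z.2) (cellIndex N z.1)| ^ q
          + |L * eps N| ^ q) := by
    intro F hF N hN z f q hq
    refine le_trans (Real.rpow_le_rpow (abs_nonneg _) ?_ hq.le)
      (add_rpow_le_two_rpow_mul (abs_nonneg _) (abs_nonneg _) hq.le)
    refine (abs_sub_le f (cellAverage N (fun X => F X z.2) (cellIndex N z.1)) _).trans ?_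
    exact add_le_add_right
      ((hF.abs_cellAverage_sub_le hN _ z.2 (hmemcell N hN z.1)).trans (le_abs_self _)) _
  obtain ⟨C₁, hC₁, hrel⟩ := hW.exists_relPotential_bounds hp B
  have hu : Tendsto (fun N => eLpNorm (fun z : ℝ × ℝ => uInterp N (x N) z.2 z.1 - U z.1 z.2)
      (ENNReal.ofReal p) (volume.restrict (spaceTime T))) atTop (𝓝 0) := by
    refine tendsto_eLpNorm_of_le (C := 2 ^ p * (C₁ + 1)) (by linarith) (by positivity) ?_ hκ
      (hδ p (by linarith))
    filter_upwards [eventually_ge_atTop 1] with N hN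
    filter_upwards [ae_spaceTime_interp_eq T hN (x N) (v N)] with z hz
    have hz1 : uInterp N (x N) z.2 z.1 = strain N (x N) (cellIndex N z.1) z.2 :=
      congrArg Prod.fst hz
    rw [hz1]
    refine (hpt U hU N hN z _ p (by linarith)).trans ?_
    rw [mul_assoc]
    refine mul_le_mul_of_nonneg_left ?_ (by positivity)
    have h1 := (hrel (strain N (x N) (cellIndex N z.1) z.2) _
      (hU.abs_cellAverage_le hN (cellIndex N z.1) z.2)).2.1
    have h2 : relPotential W (strain N (x N) (cellIndex N z.1) z.2)
        (cellAverage N (fun X => U X z.2) (cellIndex N z.1)) ≤ κ N z := by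
      simp only [hκdef, cellRelEnergy]
      exact le_add_of_nonneg_left (by positivity)
    have h3 := mul_le_mul_of_nonneg_left h2 hC₁.le
    have h4 : 0 ≤ C₁ * |L * eps N| ^ p := by positivity
    linarith [hκ0 N z]
  have hv : Tendsto (fun N => eLpNorm (fun z : ℝ × ℝ => vInterp N (v N) z.2 z.1 - V z.1 z.2)
      2 (volume.restrict (spaceTime T))) atTop (𝓝 0) := by
    have e2 : (2 : ENNReal) = ENNReal.ofReal 2 := by norm_num
    rw [e2]
    refine tendsto_eLpNorm_of_le (C := 2 ^ (2 : ℝ) * (2 / ρ + 1)) (by norm_num) (by positivity) ?_ hκ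
      (hδ 2 (by norm_num))
    filter_upwards [eventually_ge_atTop 1] with N hN
    filter_upwards [ae_spaceTime_interp_eq T hN (x N) (v N)] with z hz
    have hz1 : vInterp N (v N) z.2 z.1 = v N (cellIndex N z.1) z.2 := congrArg Prod.snd hz
    rw [hz1]
    refine (hpt V hV N hN z _ 2 (by norm_num)).trans ?_
    rw [mul_assoc]
    refine mul_le_mul_of_nonneg_left ?_ (by positivity)
    obtain ⟨c, hc, hconv⟩ := hW.exists_sq_le_relPotential
    have h2 : ρ / 2 * (v N (cellIndex N z.1) z.2
        - cellAverage N (fun X => V X z.2) (cellIndex N z.1)) ^ 2 ≤ κ N z := by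
      simp only [hκdef, cellRelEnergy]
      exact le_add_of_nonneg_right (le_trans (by positivity) (hconv _ _))
    have h3 := mul_le_mul_of_nonneg_left h2 (by positivity : 0 ≤ 2 / ρ)
    rw [← mul_assoc, show 2 / ρ * (ρ / 2) = 1 by field_simp, one_mul] at h3
    rw [Real.rpow_two, sq_abs]
    have h4 : 0 ≤ 2 / ρ * |L * eps N| ^ (2 : ℝ) := by positivity
    linarith [hκ0 N z]
  refine ⟨hu, hv, ?_⟩
  have hmeas := fun N => aestronglyMeasurable_interp (hlat N) hρ hT.le
  have hUm : AEStronglyMeasurable (fun z : ℝ × ℝ => U z.1 z.2) (volume.restrict (spaceTime T)) :=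
    hU.continuous.aestronglyMeasurable
  have hVm : AEStronglyMeasurable (fun z : ℝ × ℝ => V z.1 z.2) (volume.restrict (spaceTime T)) :=
    hV.continuous.aestronglyMeasurable
  have hum : ∀ N, AEStronglyMeasurable (fun z : ℝ × ℝ => uInterp N (x N) z.2 z.1 - U z.1 z.2)
      (volume.restrict (spaceTime T)) := fun N =>
    (continuous_fst.comp_aestronglyMeasurable (hmeas N)).sub hUm
  have hvm : ∀ N, AEStronglyMeasurable (fun z : ℝ × ℝ => vInterp N (v N) z.2 z.1 - V z.1 z.2)
      (volume.restrict (spaceTime T)) := fun N =>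
    (continuous_snd.comp_aestronglyMeasurable (hmeas N)).sub hVm
  have hu1 := tendsto_eLpNorm_one_of_eLpNorm
    (by rw [ENNReal.one_le_ofReal]; linarith) (Eventually.of_forall hum) hu
  have hv1 := tendsto_eLpNorm_one_of_eLpNorm (by norm_num) (Eventually.of_forall hvm) hv
  simp only [eLpNorm_one_eq_lintegral_enorm, Real.enorm_eq_ofReal_abs] at hu1 hv1
  -- The comparison is now read backwards: the energy difference is at most κ plus terms linear in
  -- the deviations, all of which are already known to vanish in L¹.
  obtain ⟨C, hC, hle⟩ := exists_abs_cellRelEnergy_sub_le hW hρ L B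
  have hsum : Tendsto (fun N => ∫⁻ z in spaceTime T, ENNReal.ofReal (κ N z
      + |uInterp N (x N) z.2 z.1 - U z.1 z.2| + |vInterp N (v N) z.2 z.1 - V z.1 z.2|))
      atTop (𝓝 0) := by
    have := (hκ.add hu1).add hv1
    simp only [add_zero] at this
    refine this.congr fun N => ?_
    rw [← lintegral_add_right' _ ((hum N).aemeasurable.abs.ennreal_ofReal),
      ← lintegral_add_right' _ ((hvm N).aemeasurable.abs.ennreal_ofReal)]
    refine lintegral_congr fun z => ?_
    rw [ENNReal.ofReal_add (add_nonneg (hκ0 N z) (abs_nonneg _)) (abs_nonneg _),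
      ENNReal.ofReal_add (hκ0 N z) (abs_nonneg _)]
  rw [← ENNReal.ofReal_one]
  refine tendsto_eLpNorm_of_le (C := 1 + C) one_pos (by positivity) ?_ hsum tendsto_eps
  filter_upwards [eventually_ge_atTop 1] with N hN
  filter_upwards [ae_spaceTime_interp_eq T hN (x N) (v N)] with z hz
  have hz1 : uInterp N (x N) z.2 z.1 = strain N (x N) (cellIndex N z.1) z.2 := congrArg Prod.fst hz
  have hz2 : vInterp N (v N) z.2 z.1 = v N (cellIndex N z.1) z.2 := congrArg Prod.snd hz
  have h1 := hle U V hU hV N hN (x N) (v N) z.2 z.1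
  rw [hz, hz1, hz2, Real.rpow_one]
  have h2 : 0 ≤ C * κ N z := mul_nonneg hC (hκ0 N z)
  have h3 := hκ0 N z
  have h4 := (eps_pos hN).le
  have h5 := abs_nonneg (strain N (x N) (cellIndex N z.1) z.2 - U z.1 z.2)
  have h6 := abs_nonneg (v N (cellIndex N z.1) z.2 - V z.1 z.2)
  have h7 : κ N z = cellRelEnergy W ρ N (x N) (v N) U V (cellIndex N z.1) z.2 := rfl
  rw [← h7] at h1
  rw [abs_le] at h1 ⊢
  constructor <;> linarith [h1.1, h1.2]

/-! ### Weak L¹ limits and almost everywhere convergent subsequences -/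

section WeakConvergence

variable {α : Type*} [MeasurableSpace α] {μ : Measure α}

theorem WeakL1Tendsto.comp_strictMono {h : ℕ → α → ℝ} {k : α → ℝ} (hw : WeakL1Tendsto μ h k)
    {τ : ℕ → ℕ} (hτ : StrictMono τ) : WeakL1Tendsto μ (fun n => h (τ n)) k :=
  ⟨fun _ => hw.1 _, hw.2.1, fun φ hφ => (hw.2.2 φ hφ).comp hτ.tendsto_atTop⟩

/-- A weak `L¹` limit coincides with the almost everywhere limit. -/
theorem WeakL1Tendsto.ae_eq_of_tendsto_ae [IsFiniteMeasure μ] {h : ℕ → α → ℝ} {k l : α → ℝ}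
    (hw : WeakL1Tendsto μ h k) (hl : ∀ᵐ z ∂μ, Tendsto (fun n => h n z) atTop (𝓝 (l z))) :
    k =ᵐ[μ] l := by
  have hm : ∀ n, AEStronglyMeasurable (h n) μ := fun n => (hw.1 n).1
  have hlm : AEStronglyMeasurable l μ := aestronglyMeasurable_of_tendsto_ae _ hm hl
  set g : ℕ → α → ℝ := fun n => (hm n).mk (h n) with hg
  have hgm : ∀ n, Measurable (g n) := fun n => (hm n).stronglyMeasurable_mk.measurable
  have hhg : ∀ᵐ z ∂μ, ∀ n, h n z = g n z := ae_all_iff.2 fun n => (hm n).ae_eq_mk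
  -- On A M the whole sequence is bounded by M, so dominated convergence identifies the weak limit
  -- there. Measurable representatives of h n make these sets measurable.
  set A : ℕ → Set α := fun M => ⋂ n, {z | |g n z| ≤ M} with hA
  have hAm : ∀ M, MeasurableSet (A M) := fun M =>
    MeasurableSet.iInter fun n => measurableSet_le (hgm n).abs measurable_const
  have hon : ∀ M, ∀ᵐ z ∂(μ.restrict (A M)), k z = l z := by
    intro M
    have hbd : ∀ n, ∀ᵐ z ∂(μ.restrict (A M)), ‖h n z‖ ≤ M := fun n => by
      filter_upwards [ae_restrict_of_ae hhg, ae_restrict_mem (hAm M)] with z hz hzA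
      rw [hz n]
      exact mem_iInter.1 hzA n
    have hlb : ∀ᵐ z ∂(μ.restrict (A M)), ‖l z‖ ≤ M := by
      filter_upwards [ae_restrict_of_ae hl, ae_all_iff.2 hbd] with z hz hzb
      exact le_of_tendsto hz.norm (Eventually.of_forall hzb)
    have hli : Integrable l (μ.restrict (A M)) :=
      Integrable.of_bound hlm.restrict _ hlb
    refine Integrable.ae_eq_of_forall_setIntegral_eq k l hw.2.1.restrict hli fun s hs _ => ?_
    rw [Measure.restrict_restrict hs]
    have hle : μ.restrict (s ∩ A M) ≤ μ.restrict (A M) :=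
      Measure.restrict_mono inter_subset_right le_rfl
    have h1 : Tendsto (fun n => ∫ z in s ∩ A M, h n z ∂μ) atTop (𝓝 (∫ z in s ∩ A M, l z ∂μ)) :=
      tendsto_integral_of_dominated_convergence (fun _ => (M : ℝ)) (fun n => (hm n).restrict)
        (integrable_const _) (fun n => ae_mono hle (hbd n)) (ae_restrict_of_ae hl)
    have hsm : MeasurableSet (s ∩ A M) := hs.inter (hAm M)
    have h2 := hw.2.2 ((s ∩ A M).indicator fun _ => (1 : ℝ))
      (memLp_indicator_const _ hsm _ (Or.inr (measure_ne_top _ _)))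
    have e : ∀ f : α → ℝ, ∫ z, (s ∩ A M).indicator (fun _ => (1 : ℝ)) z * f z ∂μ =
        ∫ z in s ∩ A M, f z ∂μ := fun f => by
      rw [← integral_indicator hsm]
      refine integral_congr_ae (Eventually.of_forall fun z => ?_)
      by_cases hz : z ∈ s ∩ A M <;> simp [hz]
    simp only [e] at h2
    exact tendsto_nhds_unique h2 h1
  -- A convergent real sequence is bounded, so the sets A M exhaust almost every point.
  have hU : ∀ᵐ z ∂μ, z ∈ ⋃ M, A M := by
    filter_upwards [hl, hhg] with z hz hzg
    obtain ⟨C, hC⟩ := hz.norm.bddAbove_range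
    obtain ⟨M, hM⟩ := exists_nat_ge C
    refine mem_iUnion.2 ⟨M, mem_iInter.2 fun n => ?_⟩
    have : ‖h n z‖ ≤ C := hC (mem_range_self n)
    rw [hzg n] at this
    exact this.trans hM
  have h1 := ae_restrict_iUnion_iff A (fun z => k z = l z) |>.2 hon
  rw [ae_restrict_iff' (MeasurableSet.iUnion hAm)] at h1
  filter_upwards [h1, hU] with z hz hzU
  exact hz hzU

/-- Every subsequence of `f n` has a further subsequence converging a.e. to `f₀`. -/
def SubseqTendstoAE {E : Type*} [TopologicalSpace E] (μ : Measure α) (f : ℕ → α → E) (f₀ : α → E) :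
    Prop :=
  ∀ σ : ℕ → ℕ, StrictMono σ → ∃ τ : ℕ → ℕ, StrictMono τ ∧
    ∀ᵐ z ∂μ, Tendsto (fun n => f (σ (τ n)) z) atTop (𝓝 (f₀ z))

variable {E : Type*} [TopologicalSpace E] {f : ℕ → α → E} {f₀ : α → E}

theorem SubseqTendstoAE.comp_strictMono (h : SubseqTendstoAE μ f f₀) {σ : ℕ → ℕ}
    (hσ : StrictMono σ) : SubseqTendstoAE μ (fun n => f (σ n)) f₀ :=
  fun τ hτ => h (σ ∘ τ) (hσ.comp hτ)

theorem SubseqTendstoAE.ae_eq_of_weakL1Tendsto [IsFiniteMeasure μ] (h : SubseqTendstoAE μ f f₀) {g : E → ℝ}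
    (hg : Continuous g) {k : α → ℝ} (hw : WeakL1Tendsto μ (fun n z => g (f n z)) k) :
    k =ᵐ[μ] fun z => g (f₀ z) := by
  obtain ⟨τ, hτ, hae⟩ := h id strictMono_id
  refine (hw.comp_strictMono hτ).ae_eq_of_tendsto_ae ?_
  filter_upwards [hae] with z hz
  exact (hg.tendsto _).comp hz

/-- Precompactness supplies a weak limit along a further subsequence of any subsequence, and a.e.
convergence forces it to be g ∘ f₀. As the limit never depends on the subsequence, the whole
sequence converges. -/
theorem SubseqTendstoAE.weakL1Tendsto [IsFiniteMeasure μ] (h : SubseqTendstoAE μ f f₀) {g : E → ℝ}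
    (hg : Continuous g) (hpre : WeakL1Precompact μ fun n z => g (f n z)) :
    WeakL1Tendsto μ (fun n z => g (f n z)) fun z => g (f₀ z) := by
  have key : ∀ σ : ℕ → ℕ, StrictMono σ → ∃ τ : ℕ → ℕ, StrictMono τ ∧
      WeakL1Tendsto μ (fun n z => g (f (σ (τ n)) z)) fun z => g (f₀ z) := by
    intro σ hσ
    obtain ⟨τ, hτ, k, hk⟩ := hpre.2 σ hσ
    have hae := (h.comp_strictMono (hσ.comp hτ)).ae_eq_of_weakL1Tendsto hg hk
    refine ⟨τ, hτ, hk.1, hk.2.1.congr hae, fun φ hφ => ?_⟩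
    have e : ∫ z, φ z * g (f₀ z) ∂μ = ∫ z, φ z * k z ∂μ := by
      refine integral_congr_ae ?_
      filter_upwards [hae] with z hz
      rw [hz]
    rw [e]
    exact hk.2.2 φ hφ
  refine ⟨hpre.1, ?_, fun φ hφ => ?_⟩
  · obtain ⟨τ, -, hτ⟩ := key id strictMono_id
    exact hτ.2.1
  · refine Filter.tendsto_of_subseq_tendsto fun ns hns => ?_
    obtain ⟨σ, hσ, hσ'⟩ := strictMono_subseq_of_tendsto_atTop hns
    obtain ⟨τ, -, hτ⟩ := key (ns ∘ σ) hσ'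
    exact ⟨σ ∘ τ, hτ.2.2 φ hφ⟩

/-- Dominated convergence along the a.e. convergent subsequence. Bounded test functions are thus
always admissible for a Young measure. -/
theorem SubseqTendstoAE.weakL1Precompact_of_bounded [IsFiniteMeasure μ] (h : SubseqTendstoAE μ f f₀) {g : E → ℝ}
    (hg : Continuous g) {M : ℝ} (hM : ∀ a, |g a| ≤ M)
    (hm : ∀ n, AEStronglyMeasurable (fun z => g (f n z)) μ) :
    WeakL1Precompact μ fun n z => g (f n z) := by
  have hi : ∀ n, Integrable (fun z => g (f n z)) μ := fun n =>
    Integrable.of_bound (hm n) M (Eventually.of_forall fun z => hM _)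
  refine ⟨hi, fun σ hσ => ?_⟩
  obtain ⟨τ, hτ, hae⟩ := h σ hσ
  have hae' : ∀ᵐ z ∂μ, Tendsto (fun n => g (f (σ (τ n)) z)) atTop (𝓝 (g (f₀ z))) := by
    filter_upwards [hae] with z hz
    exact (hg.tendsto _).comp hz
  have hm0 : AEStronglyMeasurable (fun z => g (f₀ z)) μ :=
    aestronglyMeasurable_of_tendsto_ae _ (fun n => hm (σ (τ n))) hae'
  refine ⟨τ, hτ, fun z => g (f₀ z), fun n => hi _,
    Integrable.of_bound hm0 M (Eventually.of_forall fun z => hM _), fun φ hφ => ?_⟩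
  have hφi : Integrable φ μ := hφ.integrable le_top
  refine tendsto_integral_of_dominated_convergence (fun z => |φ z| * M)
    (fun n => hφi.1.mul (hm _)) (hφi.abs.mul_const M) (fun n => Eventually.of_forall fun z => ?_) ?_
  · rw [Real.norm_eq_abs, abs_mul]
    exact mul_le_mul_of_nonneg_left (hM _) (abs_nonneg _)
  · filter_upwards [hae'] with z hz
    exact hz.const_mul _

end WeakConvergence

/-! ### Identification of Young and concentration measures -/

theorem eq_dirac_of_ae_eq {E : Type*} [MeasurableSpace E] {ν : Measure E} [IsProbabilityMeasure ν]
    {c : E} (h : ∀ᵐ a ∂ν, a = c) : ν = Measure.dirac c := by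
  have h1 : Measure.map id ν = Measure.map (fun _ => c) ν := Measure.map_congr h
  rwa [Measure.map_id, Measure.map_const, measure_univ, one_smul] at h1

/-- The two moments say that arctan ∘ π has variance zero about arctan c, and arctan is injective.
Using arctan keeps the test functions bounded. -/
theorem ae_eq_of_integral_arctan {E : Type*} [TopologicalSpace E] [MeasurableSpace E] [BorelSpace E]
    {ν : Measure E} [IsProbabilityMeasure ν] {π : E → ℝ} (hπ : Continuous π) {c : ℝ}
    (h1 : ∫ a, Real.arctan (π a) ∂ν = Real.arctan c)
    (h2 : ∫ a, Real.arctan (π a) ^ 2 ∂ν = Real.arctan c ^ 2) : ∀ᵐ a ∂ν, π a = c := by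
  have hc : Continuous fun a => Real.arctan (π a) := Real.continuous_arctan.comp hπ
  have hb : ∀ a, ‖Real.arctan (π a)‖ ≤ Real.pi / 2 := fun a =>
    (abs_lt.2 ⟨by linarith [Real.neg_pi_div_two_lt_arctan (π a)], Real.arctan_lt_pi_div_two _⟩).le
  have hm : AEStronglyMeasurable (fun a => Real.arctan (π a)) ν :=
    hc.measurable.aestronglyMeasurable
  have i1 : Integrable (fun a => Real.arctan (π a)) ν :=
    Integrable.of_bound hm _ (Eventually.of_forall hb)
  have i2 : Integrable (fun a => Real.arctan (π a) ^ 2) ν :=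
    Integrable.of_bound (hm.pow 2) ((Real.pi / 2) ^ 2) (Eventually.of_forall fun a => by
      rw [norm_pow]
      exact pow_le_pow_left₀ (norm_nonneg _) (hb a) 2)
  have hzero : ∫ a, (Real.arctan (π a) - Real.arctan c) ^ 2 ∂ν = 0 := by
    have e : (fun a => (Real.arctan (π a) - Real.arctan c) ^ 2) = fun a =>
        (Real.arctan (π a) ^ 2 - 2 * Real.arctan c * Real.arctan (π a)) + Real.arctan c ^ 2 := by
      funext a; ring
    have i3 : Integrable (fun a => Real.arctan (π a) ^ 2
        - 2 * Real.arctan c * Real.arctan (π a)) ν := i2.sub (i1.const_mul _)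
    rw [e, integral_add i3 (integrable_const _), integral_sub i2 (i1.const_mul _),
      integral_const_mul, h1, h2, integral_const, probReal_univ]
    simp only [smul_eq_mul]
    ring
  have i4 : Integrable (fun a => (Real.arctan (π a) - Real.arctan c) ^ 2) ν := by
    have e : (fun a => (Real.arctan (π a) - Real.arctan c) ^ 2) = fun a =>
        (Real.arctan (π a) ^ 2 - 2 * Real.arctan c * Real.arctan (π a)) + Real.arctan c ^ 2 := by
      funext a; ring
    rw [e]
    exact (i2.sub (i1.const_mul _)).add (integrable_const _)
  filter_upwards [(integral_eq_zero_iff_of_nonneg (fun a => sq_nonneg _) i4).1 hzero] with a ha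
  exact Real.arctan_injective (sub_eq_zero.1 (pow_eq_zero_iff two_ne_zero |>.1 ha))

section Young

variable {α : Type*} [MeasurableSpace α] {μ : Measure α}
  {f : ℕ → α → ℝ × ℝ} {f₀ : α → ℝ × ℝ}

theorem generatesYoungMeasure_dirac [IsFiniteMeasure μ] (h : SubseqTendstoAE μ f f₀)
    (hm₀ : AEStronglyMeasurable f₀ μ) :
    GeneratesYoungMeasure μ f fun z => Measure.dirac (f₀ z) where
  prob := Eventually.of_forall fun _ => inferInstance
  weakStarMeasurable g hg _ := by
    simp only [integral_dirac]
    exact hg.comp_aestronglyMeasurable hm₀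
  weak_limit g hg hpre := by
    refine ⟨Eventually.of_forall fun z => integrable_dirac enorm_lt_top, ?_⟩
    simp only [integral_dirac]
    exact h.weakL1Tendsto hg hpre

/-- Four bounded test functions, arctan and its square in each coordinate, already pin down the
measure: both coordinates have zero variance. -/
theorem GeneratesYoungMeasure.ae_eq_dirac [IsFiniteMeasure μ] {ν : α → Measure (ℝ × ℝ)}
    (hν : GeneratesYoungMeasure μ f ν) (h : SubseqTendstoAE μ f f₀)
    (hm : ∀ n, AEStronglyMeasurable (f n) μ) : ∀ᵐ z ∂μ, ν z = Measure.dirac (f₀ z) := by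
  have key : ∀ (g : ℝ × ℝ → ℝ) (M : ℝ), Continuous g → (∀ a, |g a| ≤ M) →
      ∀ᵐ z ∂μ, ∫ a, g a ∂(ν z) = g (f₀ z) := fun g M hg hM =>
    h.ae_eq_of_weakL1Tendsto hg (hν.weak_limit g hg (h.weakL1Precompact_of_bounded hg hM
      fun n => hg.comp_aestronglyMeasurable (hm n))).2
  have hb : ∀ y : ℝ, |Real.arctan y| ≤ Real.pi / 2 := fun y =>
    (abs_lt.2 ⟨by linarith [Real.neg_pi_div_two_lt_arctan y], Real.arctan_lt_pi_div_two _⟩).le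
  have hb2 : ∀ y : ℝ, |Real.arctan y ^ 2| ≤ (Real.pi / 2) ^ 2 := fun y => by
    rw [abs_pow]
    exact pow_le_pow_left₀ (abs_nonneg _) (hb y) 2
  have c1 : Continuous fun a : ℝ × ℝ => Real.arctan a.1 := Real.continuous_arctan.comp continuous_fst
  have c2 : Continuous fun a : ℝ × ℝ => Real.arctan a.2 := Real.continuous_arctan.comp continuous_snd
  filter_upwards [hν.prob, key _ _ c1 (fun a => hb a.1), key _ _ (c1.pow 2) (fun a => hb2 a.1),
    key _ _ c2 (fun a => hb a.2), key _ _ (c2.pow 2) (fun a => hb2 a.2)] with z hp h1 h2 h3 h4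
  refine eq_dirac_of_ae_eq ?_
  filter_upwards [ae_eq_of_integral_arctan continuous_fst h1 h2,
    ae_eq_of_integral_arctan continuous_snd h3 h4] with a ha1 ha2
  exact Prod.ext ha1 ha2

/-- Convergence in norm gives convergence in measure; the second component is extracted along the
subsequence already chosen for the first. -/
theorem subseqTendstoAE_of_eLpNorm {p q : ENNReal} (hp : p ≠ 0) (hq : q ≠ 0)
    (hm : ∀ n, AEStronglyMeasurable (f n) μ) (hm₀ : AEStronglyMeasurable f₀ μ)
    (h1 : Tendsto (fun n => eLpNorm (fun z => (f n z).1 - (f₀ z).1) p μ) atTop (𝓝 0))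
    (h2 : Tendsto (fun n => eLpNorm (fun z => (f n z).2 - (f₀ z).2) q μ) atTop (𝓝 0)) :
    SubseqTendstoAE μ f f₀ := by
  intro σ hσ
  obtain ⟨τ₁, hτ₁, hae₁⟩ := (tendstoInMeasure_of_tendsto_eLpNorm
    (f := fun n z => (f (σ n) z).1) (g := fun z => (f₀ z).1) hp
    (fun n => continuous_fst.comp_aestronglyMeasurable (hm _))
    (continuous_fst.comp_aestronglyMeasurable hm₀)
    (h1.comp hσ.tendsto_atTop)).exists_seq_tendsto_ae
  obtain ⟨τ₂, hτ₂, hae₂⟩ := (tendstoInMeasure_of_tendsto_eLpNorm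
    (f := fun n z => (f (σ (τ₁ n)) z).2) (g := fun z => (f₀ z).2) hq
    (fun n => continuous_snd.comp_aestronglyMeasurable (hm _))
    (continuous_snd.comp_aestronglyMeasurable hm₀)
    (h2.comp (hσ.comp hτ₁).tendsto_atTop)).exists_seq_tendsto_ae
  refine ⟨τ₁ ∘ τ₂, hτ₁.comp hτ₂, ?_⟩
  filter_upwards [hae₁, hae₂] with z hz1 hz2
  exact (hz1.comp hτ₂.tendsto_atTop).prodMk_nhds hz2

end Young

theorem exists_bound_on_spaceTime {φ : ℝ × ℝ → ℝ} (hφ : Continuous φ) (T : ℝ) :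
    ∃ M, 0 ≤ M ∧ ∀ z ∈ spaceTime T, |φ z| ≤ M := by
  obtain ⟨M, hM⟩ := (isCompact_Icc.prod isCompact_Icc :
    IsCompact (Icc 0 (2 * Real.pi) ×ˢ Icc 0 T)).exists_bound_of_continuousOn hφ.continuousOn
  exact ⟨max M 0, le_max_right _ _, fun z hz =>
    (hM z ⟨Ico_subset_Icc_self hz.1, hz.2⟩).trans (le_max_left _ _)⟩

theorem tendsto_integral_mul_of_eLpNorm_one {T : ℝ} {φ : ℝ × ℝ → ℝ} (hφ : Continuous φ)
    {h : ℕ → ℝ × ℝ → ℝ} (hm : ∀ n, AEStronglyMeasurable (h n) (volume.restrict (spaceTime T)))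
    (h1 : Tendsto (fun n => eLpNorm (h n) 1 (volume.restrict (spaceTime T))) atTop (𝓝 0)) :
    Tendsto (fun n => ∫ z in spaceTime T, φ z * h n z) atTop (𝓝 0) := by
  obtain ⟨M, hM0, hM⟩ := exists_bound_on_spaceTime hφ T
  have hlim := (tendsto_integral_abs_of_eLpNorm_one (Eventually.of_forall hm) h1).const_mul M
  rw [mul_zero] at hlim
  have hfin : ∀ᶠ n in atTop, eLpNorm (h n) 1 (volume.restrict (spaceTime T)) < ⊤ :=
    h1.eventually (gt_mem_nhds ENNReal.zero_lt_top)
  refine squeeze_zero_norm' ?_ hlim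
  filter_upwards [hfin] with n hn
  have hi : Integrable (h n) (volume.restrict (spaceTime T)) := memLp_one_iff_integrable.1 ⟨hm n, hn⟩
  rw [← integral_const_mul]
  refine norm_integral_le_of_norm_le (hi.abs.const_mul M) ?_
  filter_upwards [ae_restrict_mem (measurableSet_spaceTime T)] with z hz
  rw [norm_mul]
  exact mul_le_mul_of_nonneg_right (hM z hz) (abs_nonneg _)

/-- L¹ convergence of the energy density kills every pairing with a continuous function, which is
bounded on the bounded space-time domain. -/
theorem isConcentrationMeasure_dirac_zero {T : ℝ} {η : ℝ × ℝ → ℝ} (hη : Continuous η)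
    {f : ℕ → ℝ × ℝ → ℝ × ℝ} {f₀ : ℝ × ℝ → ℝ × ℝ}
    (hm : ∀ n, AEStronglyMeasurable (f n) (volume.restrict (spaceTime T)))
    (hm₀ : AEStronglyMeasurable f₀ (volume.restrict (spaceTime T)))
    (hi : IntegrableOn (fun z => η (f₀ z)) (spaceTime T))
    (h1 : Tendsto (fun n => eLpNorm (fun z => η (f n z) - η (f₀ z)) 1
      (volume.restrict (spaceTime T))) atTop (𝓝 0)) :
    IsConcentrationMeasure T η f (fun z => Measure.dirac (f₀ z)) 0 where
  finite := inferInstance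
  carried := rfl
  integrable_fibre := Eventually.of_forall fun z => integrable_dirac enorm_lt_top
  integrable_mean := by simpa only [integral_dirac] using hi
  weakStar_limit φ hφ _ := by
    simp only [integral_dirac, integral_zero_measure]
    exact tendsto_integral_mul_of_eLpNorm_one hφ (fun n =>
      (hη.comp_aestronglyMeasurable (hm n)).sub (hη.comp_aestronglyMeasurable hm₀)) h1

theorem IsConcentrationMeasure.eq_zero {T : ℝ} {η : ℝ × ℝ → ℝ} (hη : Continuous η)
    {f : ℕ → ℝ × ℝ → ℝ × ℝ} {f₀ : ℝ × ℝ → ℝ × ℝ} {ν : ℝ × ℝ → Measure (ℝ × ℝ)}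
    {γ : Measure (ℝ × ℝ)} (hγ : IsConcentrationMeasure T η f ν γ)
    (hν : ∀ᵐ z ∂(volume.restrict (spaceTime T)), ν z = Measure.dirac (f₀ z))
    (hm : ∀ n, AEStronglyMeasurable (f n) (volume.restrict (spaceTime T)))
    (hm₀ : AEStronglyMeasurable f₀ (volume.restrict (spaceTime T)))
    (h1 : Tendsto (fun n => eLpNorm (fun z => η (f n z) - η (f₀ z)) 1
      (volume.restrict (spaceTime T))) atTop (𝓝 0)) : γ = 0 := by
  have hfin := hγ.finite
  -- Since γ is a nonnegative finite measure, the single test function 1 suffices: it computes the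
  -- total mass.
  have hlim := hγ.weakStar_limit (fun _ => 1) continuous_const fun _ _ => rfl
  have hlim0 := tendsto_integral_mul_of_eLpNorm_one (φ := fun _ => 1) continuous_const (fun n =>
      (hη.comp_aestronglyMeasurable (hm n)).sub (hη.comp_aestronglyMeasurable hm₀)) h1
  have e : ∀ n, ∫ z in spaceTime T, (1 : ℝ) * (η (f n z) - ∫ a, η a ∂(ν z)) =
      ∫ z in spaceTime T, (1 : ℝ) * (η (f n z) - η (f₀ z)) := fun n => by
    refine integral_congr_ae ?_
    filter_upwards [hν] with z hz
    rw [hz, integral_dirac]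
  simp only [e] at hlim
  have h0 := tendsto_nhds_unique hlim hlim0
  rw [integral_const, smul_eq_mul, mul_one, measureReal_def, ENNReal.toReal_eq_zero_iff] at h0
  exact Measure.measure_univ_eq_zero.1 (h0.resolve_right (measure_ne_top _ _))

end SpringLattice

/-! ### Conclusion for the lattice sequence -/

theorem theorem5p2
    (p ρ T : ℝ) (hp : 2 ≤ p) (hρ : 0 < ρ) (hT : 0 < T)
    (W : ℝ → ℝ) (hW : SpringLattice.IsPotential p W)
    -- the Lipschitz solution of the continuum equations
    (ubar vbar : ℝ × ℝ → ℝ)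
    (hu : SpringLattice.IsLipschitzField T ubar) (hv : SpringLattice.IsLipschitzField T vbar)
    (hsol : SpringLattice.IsWeakElastodynamics W ρ T ubar vbar)
    -- for each number of atoms, a motion of the lattice
    (x v : ℕ → ℤ → ℝ → ℝ)
    (hlat : ∀ N, 1 ≤ N → SpringLattice.IsLatticeSolution W ρ T N (x N) (v N))
    -- uniformly bounded initial energy
    (hE : ∃ E₀ : ℝ, ∀ N, 1 ≤ N → SpringLattice.latticeEnergy W ρ N (x N) (v N) 0 ≤ E₀)
    -- strong convergence of the interpolated initial data, and of their energy
    (hu0 : Tendsto (fun N => eLpNorm (fun X => SpringLattice.uInterp N (x N) 0 X - ubar (X, 0))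
      (ENNReal.ofReal p) (volume.restrict SpringLattice.circleDomain)) atTop (𝓝 0))
    (hv0 : Tendsto (fun N => eLpNorm (fun X => SpringLattice.vInterp N (v N) 0 X - vbar (X, 0))
      2 (volume.restrict SpringLattice.circleDomain)) atTop (𝓝 0))
    (hE0 : Tendsto (fun N => ∫ X in SpringLattice.circleDomain,
        SpringLattice.energyDensity W ρ (SpringLattice.interp N (x N) (v N) (X, 0))) atTop
      (𝓝 (∫ X in SpringLattice.circleDomain,
        SpringLattice.energyDensity W ρ (ubar (X, 0), vbar (X, 0))))) :
    -- strong convergence in `L^p × L²` on space-time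
    (Tendsto (fun N => eLpNorm
        (fun z : ℝ × ℝ => SpringLattice.uInterp N (x N) z.2 z.1 - ubar z)
        (ENNReal.ofReal p) (volume.restrict (SpringLattice.spaceTime T))) atTop (𝓝 0) ∧
      Tendsto (fun N => eLpNorm
        (fun z : ℝ × ℝ => SpringLattice.vInterp N (v N) z.2 z.1 - vbar z)
        2 (volume.restrict (SpringLattice.spaceTime T))) atTop (𝓝 0)) ∧
    -- the whole sequence has the Dirac Young measure and no energy concentration
    (SpringLattice.GeneratesYoungMeasure (volume.restrict (SpringLattice.spaceTime T))
        (fun N => SpringLattice.interp N (x N) (v N))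
        (fun z => Measure.dirac (ubar z, vbar z)) ∧
      SpringLattice.IsConcentrationMeasure T (SpringLattice.energyDensity W ρ)
        (fun N => SpringLattice.interp N (x N) (v N))
        (fun z => Measure.dirac (ubar z, vbar z)) 0) ∧
    -- every Young measure with concentration obtained along a subsequence is the Dirac one,
    -- and its concentration measure is null
    (∀ σ : ℕ → ℕ, StrictMono σ → ∀ ν : ℝ × ℝ → Measure (ℝ × ℝ),
      SpringLattice.GeneratesYoungMeasure (volume.restrict (SpringLattice.spaceTime T))
        (fun n => SpringLattice.interp (σ n) (x (σ n)) (v (σ n))) ν →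
      (∀ᵐ z ∂(volume.restrict (SpringLattice.spaceTime T)),
        ν z = Measure.dirac (ubar z, vbar z)) ∧
      ∀ γ : Measure (ℝ × ℝ),
        SpringLattice.IsConcentrationMeasure T (SpringLattice.energyDensity W ρ)
          (fun n => SpringLattice.interp (σ n) (x (σ n)) (v (σ n))) ν γ → γ = 0) := by
  obtain ⟨L, B, hUV⟩ := SpringLattice.exists_isIntegralSolution hT hW hu hv hsol
  set U := SpringLattice.clampField T ubar with hU
  set V := SpringLattice.clampField T vbar with hV
  have hUe : ∀ z ∈ SpringLattice.spaceTime T, U z.1 z.2 = ubar z := fun z hz =>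
    SpringLattice.clampField_eq ubar z.1 hz.2
  have hVe : ∀ z ∈ SpringLattice.spaceTime T, V z.1 z.2 = vbar z := fun z hz =>
    SpringLattice.clampField_eq vbar z.1 hz.2
  have h0T : (0 : ℝ) ∈ Icc 0 T := left_mem_Icc.2 hT.le
  have hU0 : ∀ X, U X 0 = ubar (X, 0) := fun X => SpringLattice.clampField_eq ubar X h0T
  have hV0 : ∀ X, V X 0 = vbar (X, 0) := fun X => SpringLattice.clampField_eq vbar X h0T
  have hK0 := SpringLattice.tendsto_latticeRelEnergy_zero hp hρ hW hUV.strain_field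
    hUV.velocity_field x v (by simpa only [hU0] using hu0) (by simpa only [hV0] using hv0)
    (by simpa only [hU0, hV0] using hE0)
  obtain ⟨hsu, hsv, hse⟩ := SpringLattice.strong_convergence hp hρ hT hW hUV hlat hK0
  set μ := volume.restrict (SpringLattice.spaceTime T) with hμ
  have hmem := ae_restrict_mem (μ := volume) (SpringLattice.measurableSet_spaceTime T)
  rw [← hμ] at hmem
  have hm := fun N => SpringLattice.aestronglyMeasurable_interp (hlat N) hρ hT.le
  have hηc := SpringLattice.continuous_energyDensity hW ρ
  have hcUV : Continuous fun z : ℝ × ℝ => (U z.1 z.2, V z.1 z.2) :=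
    hUV.strain_field.continuous.prodMk hUV.velocity_field.continuous
  -- The clamped extensions agree with the given fields on the space-time domain, so the fields
  -- inherit measurability and all the limits.
  have hUVe : (fun z : ℝ × ℝ => (U z.1 z.2, V z.1 z.2)) =ᵐ[μ] fun z => (ubar z, vbar z) := by
    filter_upwards [hmem] with z hz
    rw [hUe z hz, hVe z hz]
  have hm₀ : AEStronglyMeasurable (fun z => (ubar z, vbar z)) μ :=
    hcUV.aestronglyMeasurable.congr hUVe
  have hsu' : Tendsto (fun N => eLpNorm
      (fun z : ℝ × ℝ => SpringLattice.uInterp N (x N) z.2 z.1 - ubar z)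
      (ENNReal.ofReal p) μ) atTop (𝓝 0) := by
    refine hsu.congr fun N => eLpNorm_congr_ae ?_
    filter_upwards [hmem] with z hz
    rw [hUe z hz]
  have hsv' : Tendsto (fun N => eLpNorm
      (fun z : ℝ × ℝ => SpringLattice.vInterp N (v N) z.2 z.1 - vbar z) 2 μ) atTop (𝓝 0) := by
    refine hsv.congr fun N => eLpNorm_congr_ae ?_
    filter_upwards [hmem] with z hz
    rw [hVe z hz]
  have hse' : Tendsto (fun N => eLpNorm (fun z : ℝ × ℝ =>
      SpringLattice.energyDensity W ρ (SpringLattice.interp N (x N) (v N) z)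
        - SpringLattice.energyDensity W ρ (ubar z, vbar z)) 1 μ) atTop (𝓝 0) := by
    refine hse.congr fun N => eLpNorm_congr_ae ?_
    filter_upwards [hmem] with z hz
    rw [hUe z hz, hVe z hz]
  have hηi : IntegrableOn (fun z => SpringLattice.energyDensity W ρ (ubar z, vbar z))
      (SpringLattice.spaceTime T) := by
    have hc := hηc.comp hcUV
    obtain ⟨M, -, hM⟩ := SpringLattice.exists_bound_on_spaceTime hc T
    refine Integrable.congr (Integrable.of_bound hc.aestronglyMeasurable M ?_) (f := fun z : ℝ × ℝ =>
      SpringLattice.energyDensity W ρ (U z.1 z.2, V z.1 z.2)) ?_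
    · filter_upwards [hmem] with z hz
      exact hM z hz
    · filter_upwards [hUVe] with z hz
      rw [hz]
  have hsub : SpringLattice.SubseqTendstoAE μ (fun N => SpringLattice.interp N (x N) (v N))
      (fun z => (ubar z, vbar z)) :=
    SpringLattice.subseqTendstoAE_of_eLpNorm (p := ENNReal.ofReal p) (q := 2)
      (by rw [Ne, ENNReal.ofReal_eq_zero]; linarith) (by norm_num) hm hm₀ hsu' hsv'
  refine ⟨⟨hsu', hsv'⟩, ⟨SpringLattice.generatesYoungMeasure_dirac hsub hm₀,
    SpringLattice.isConcentrationMeasure_dirac_zero hηc hm hm₀ hηi hse'⟩, ?_⟩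
  intro σ hσ ν hν
  -- All the convergence statements pass to subsequences, so the full-sequence results apply along
  -- σ.
  have hdirac := hν.ae_eq_dirac (hsub.comp_strictMono hσ) fun n => hm (σ n)
  exact ⟨hdirac, fun γ hγ => hγ.eq_zero hηc hdirac (fun n => hm (σ n)) hm₀
    (hse'.comp hσ.tendsto_atTop)⟩
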